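/- Let $N\ge 5$ be an integer, $\sigma>-4$, $p>1$, $B_1\subset\mathbb R^N$ the open unit ball, $\Omega_e=\mathbb R^N\setminus\overline{B_1}$, $D=(0,\infty)\times\overline{\Omega_e}$, $\Sigma=(0,\infty)\times\partial B_1$, and put $$\mu^*=\Big(\tfrac{N(N-4)}{4}\Big)^2,\qquad \mu_N=\frac{N-4}{2}+\sqrt{\Big(\frac{N-2}{2}\Big)^2+1-\sqrt{(N-2)^2+\mu}},\qquad p_{\mathrm{crit}}=1+\frac{\sigma+4}{\mu_N}\qquad(0<\mu\le\mu^*).$$ Consider the problem $$u_t+\Delta^2u-\frac{\mu}{|x|^4}u=|x|^\sigma|u|^p+f(x)\ \text{ in }(0,\infty)\times\Omega_e,\qquad u=\Delta u=0\ \text{ on }\Sigma .\tag{P}$$ Let $\Phi$ be the set of nonnegative functions $\varphi(t,x)$ with compact support in $D$ that are of class $C^1$ in $t$ and $C^4$ in $x$ on $D$ (up to $\partial B_1$, with $\varphi_t$ and the $x$-derivatives up to order $4$ continuous on $D$) and satisfy $\varphi=\Delta\varphi=0$ on $\Sigma$. For $f\in L^1_{\mathrm{loc}}(\overline{\Omega_e})$,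 a weak solution of (P) is a function $u\in L^p_{\mathrm{loc}}(D)$ such that, for all $\varphi\in\Phi$, $$\int_D|x|^\sigma|u|^p\varphi\,dx\,dt+\int_D f\varphi\,dx\,dt=-\int_D u\,\varphi_t\,dx\,dt+\int_D u\Big(\Delta^2\varphi-\frac{\mu}{|x|^4}\varphi\Big)dx\,dt .$$ **Theorem.** (i) If either $0<\mu\le\mu^*$ and $1<p<p_{\mathrm{crit}}$, or $0<\mu<\mu^*$ and $p=p_{\mathrm{crit}}$, then for every $f\in L^1_{\mathrm{loc}}(\overline{\Omega_e})$ that is positive (almost everywhere) in $\Omega_e$, problem (P) has no weak solution. (ii) If $0<\mu\le\mu^*$ and $p>p_{\mathrm{crit}}$, then there are $f\in L^1_{\mathrm{loc}}(\overline{\Omega_e})$, positive in $\Omega_e$, and $u\in C^\infty(\overline{\Omega_e})$ such that $u$ is a stationary solution of (P): $\Delta^2u-\mu|x|^{-4}u=|x|^\sigma|u|^p+f$ holds pointwise in $\Omega_e$, $u=\Delta u=0$ on $\partial B_1$, and $u$, as a function of $(t,x)$ independent of $t$, is a weak solution of (P). -/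

import Mathlib

open MeasureTheory Set Topology
open scoped ContDiff InnerProductSpace Laplacian

noncomputable section

/-- The exterior domain `Ω_e = ℝ^N \ closure B₁`, where `B₁` is the open unit ball. -/
def extDomain (N : ℕ) : Set (EuclideanSpace ℝ (Fin N)) := {x | 1 < ‖x‖}

/-- The closed exterior domain, i.e. the closure of `Ω_e` (see `closure_extDomain`). -/
def extClosed (N : ℕ) : Set (EuclideanSpace ℝ (Fin N)) := {x | 1 ≤ ‖x‖}

/-- The unit sphere `∂B₁`. -/
def unitSphere (N : ℕ) : Set (EuclideanSpace ℝ (Fin N)) := {x | ‖x‖ = 1}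

/-- The space-time set `D = (0,∞) × closure Ω_e`. -/
def spaceTime (N : ℕ) : Set (ℝ × EuclideanSpace ℝ (Fin N)) := Ioi 0 ×ˢ extClosed N

/-- The Laplacian on the closed exterior domain: the ordinary Laplacian in the interior (see
`extLaplacian_eq`), and its version built from derivatives within the closed set on `∂B₁`. -/
def extLaplacian (N : ℕ) (v : EuclideanSpace ℝ (Fin N) → ℝ) : EuclideanSpace ℝ (Fin N) → ℝ :=
  InnerProductSpace.laplacianWithin v (extClosed N)

/-- The Hardy--Rellich operator `v ↦ Δ²v - μ |x|⁻⁴ v`. -/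
def hardyRellich (N : ℕ) (μ : ℝ) (v : EuclideanSpace ℝ (Fin N) → ℝ)
    (x : EuclideanSpace ℝ (Fin N)) : ℝ :=
  extLaplacian N (extLaplacian N v) x - μ / ‖x‖ ^ 4 * v x

/-- `C_c^{1,4}(D)`: functions `φ(t,x)` of class `C¹` in `t` and `C⁴` in `x` (up to the boundary
`∂B₁`), the derivatives being continuous on `D`, with compact support in `D`. Only the values of
`φ` on `D` matter. -/
structure IsCc14 (N : ℕ) (φ : ℝ × EuclideanSpace ℝ (Fin N) → ℝ) : Prop where
  diff_t : ∀ t > 0, ∀ x ∈ extClosed N, DifferentiableAt ℝ (fun s => φ (s, x)) t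
  cont_t : ContinuousOn (fun z : ℝ × EuclideanSpace ℝ (Fin N) =>
    deriv (fun s => φ (s, z.2)) z.1) (spaceTime N)
  diff_x : ∀ t > 0, ContDiffOn ℝ 4 (fun x => φ (t, x)) (extClosed N)
  cont_x : ∀ k : ℕ, k ≤ 4 → ContinuousOn (fun z : ℝ × EuclideanSpace ℝ (Fin N) =>
    iteratedFDerivWithin ℝ k (fun x => φ (z.1, x)) (extClosed N) z.2) (spaceTime N)
  compact_supp : ∃ C : Set (ℝ × EuclideanSpace ℝ (Fin N)), IsCompact C ∧ C ⊆ spaceTime N ∧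
    ∀ z ∈ spaceTime N, z ∉ C → φ z = 0

/-- The class `Φ` of test functions: nonnegative elements of `C_c^{1,4}(D)` with
`φ = Δφ = 0` on `(0,∞) × ∂B₁`. -/
structure IsTestFunction (N : ℕ) (φ : ℝ × EuclideanSpace ℝ (Fin N) → ℝ) : Prop where
  regular : IsCc14 N φ
  nonneg : ∀ z ∈ spaceTime N, 0 ≤ φ z
  dirichlet : ∀ t > 0, ∀ x ∈ unitSphere N, φ (t, x) = 0
  navier : ∀ t > 0, ∀ x ∈ unitSphere N, extLaplacian N (fun y => φ (t, y)) x = 0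

/-- `u` is a weak solution of `u_t + Δ²u - μ|x|⁻⁴u = |x|^σ |u|^p + f` in `(0,∞) × Ω_e` with
`u = Δu = 0` on `(0,∞) × ∂B₁`: it lies in `L^p_loc(D)` (is `L^p` on compact subsets of `D`) and
satisfies the weak identity against every test function in `Φ`. -/
structure IsWeakSolution (N : ℕ) (μ σ p : ℝ) (f : EuclideanSpace ℝ (Fin N) → ℝ)
    (u : ℝ × EuclideanSpace ℝ (Fin N) → ℝ) : Prop where
  memLp_loc : ∀ C : Set (ℝ × EuclideanSpace ℝ (Fin N)), IsCompact C → C ⊆ spaceTime N →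
    MemLp u (ENNReal.ofReal p) (volume.restrict C)
  weak_eq : ∀ φ : ℝ × EuclideanSpace ℝ (Fin N) → ℝ, IsTestFunction N φ →
    (∫ z in spaceTime N, ‖z.2‖ ^ σ * |u z| ^ p * φ z) + (∫ z in spaceTime N, f z.2 * φ z)
      = -(∫ z in spaceTime N, u z * deriv (fun s => φ (s, z.2)) z.1)
        + ∫ z in spaceTime N, u z * hardyRellich N μ (fun y => φ (z.1, y)) z.2

/-- `u ∈ C^∞(closure Ω_e)` is a stationary solution: it solves the time-independent equation
pointwise in `Ω_e`, satisfies the Navier conditions on `∂B₁`, and, viewed as a function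
independent of time, it is a weak solution of the evolution problem. -/
structure IsSmoothStationarySolution (N : ℕ) (μ σ p : ℝ) (f : EuclideanSpace ℝ (Fin N) → ℝ)
    (u : EuclideanSpace ℝ (Fin N) → ℝ) : Prop where
  smooth : ContDiffOn ℝ ∞ u (extClosed N)
  equation : ∀ x ∈ extDomain N, hardyRellich N μ u x = ‖x‖ ^ σ * |u x| ^ p + f x
  dirichlet : ∀ x ∈ unitSphere N, u x = 0
  navier : ∀ x ∈ unitSphere N, extLaplacian N u x = 0
  weak : IsWeakSolution N μ σ p f (fun z => u z.2)

/-- The Hardy--Rellich constant `μ* = (N(N-4)/4)²`. -/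
def muStar (N : ℕ) : ℝ := ((N : ℝ) * ((N : ℝ) - 4) / 4) ^ 2

/-- `μ_N = (N-4)/2 + √(((N-2)/2)² + 1 - √((N-2)² + μ))`. -/
def muN (N : ℕ) (μ : ℝ) : ℝ :=
  ((N : ℝ) - 4) / 2 +
    Real.sqrt ((((N : ℝ) - 2) / 2) ^ 2 + 1 - Real.sqrt (((N : ℝ) - 2) ^ 2 + μ))

/-- The critical exponent `p_crit = 1 + (σ+4)/μ_N`. -/
def pCrit (N : ℕ) (σ μ : ℝ) : ℝ := 1 + (σ + 4) / muN N μ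

/-- `extClosed` is the closure of `extDomain`. -/
theorem closure_extDomain (N : ℕ) : closure (extDomain N) = extClosed N := by
  have h : extDomain N = (Metric.closedBall (0 : EuclideanSpace ℝ (Fin N)) 1)ᶜ := by
    ext x; simp [extDomain]
  rw [h, closure_compl, interior_closedBall _ one_ne_zero]
  ext x; simp [extClosed]

/-- Derivatives within the closed exterior domain are unique. -/
theorem uniqueDiffOn_extClosed (N : ℕ) : UniqueDiffOn ℝ (extClosed N) := by
  intro x hx
  have hx1 : (1 : ℝ) ≤ ‖x‖ := hx
  have hc : Continuous fun y : EuclideanSpace ℝ (Fin N) => inner ℝ x y := by fun_prop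
  have hconv : Convex ℝ {y : EuclideanSpace ℝ (Fin N) | ‖x‖ ^ 2 ≤ inner ℝ x y} :=
    convex_halfSpace_ge (innerₗ _ x).isLinear _
  have hsub : {y : EuclideanSpace ℝ (Fin N) | ‖x‖ ^ 2 ≤ inner ℝ x y} ⊆ extClosed N := by
    intro y hy
    have h1 : ‖x‖ ^ 2 ≤ inner ℝ x y := hy
    have h2 := real_inner_le_norm x y
    change 1 ≤ ‖y‖
    nlinarith
  refine (uniqueDiffWithinAt_convex hconv ?_ (subset_closure ?_)).mono hsub
  · refine ⟨(2 : ℝ) • x, interior_maximal (s := {y | ‖x‖ ^ 2 ≤ inner ℝ x y})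
      (t := {y | ‖x‖ ^ 2 < inner ℝ x y}) (fun y (hy : ‖x‖ ^ 2 < inner ℝ x y) => hy.le)
      (isOpen_lt continuous_const hc) ?_⟩
    simp only [mem_ofPred_eq, inner_smul_right, real_inner_self_eq_norm_sq]
    nlinarith
  · simp

/-- In the open exterior domain, `extLaplacian` is the ordinary Laplacian. -/
theorem extLaplacian_eq (N : ℕ) (v : EuclideanSpace ℝ (Fin N) → ℝ)
    {x : EuclideanSpace ℝ (Fin N)} (hx : x ∈ extDomain N) : extLaplacian N v x = (Δ v) x := by
  have ho : IsOpen (extDomain N) := isOpen_lt continuous_const continuous_norm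
  have hK : extClosed N ∈ 𝓝 x :=
    Filter.mem_of_superset (ho.mem_nhds hx) fun y (hy : 1 < ‖y‖) => hy.le
  have hmem : x ∈ extClosed N := mem_of_mem_nhds hK
  have h : iteratedFDerivWithin ℝ 2 v (extClosed N) x = iteratedFDeriv ℝ 2 v x := by
    rw [← iteratedFDerivWithin_univ, ← iteratedFDerivWithin_inter (s := univ) hK, univ_inter]
  rw [extLaplacian, InnerProductSpace.laplacianWithin_eq_iteratedFDerivWithin_stdOrthonormalBasis v
    (uniqueDiffOn_extClosed N) hmem,
    InnerProductSpace.laplacian_eq_iteratedFDeriv_stdOrthonormalBasis, h]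

end

/-! With `s = log ‖x‖` and `u = ‖x‖ ^ (-(N-4)/2) * m s`, the Hardy–Rellich operator acts on radial
functions as `‖x‖ ^ (-(N-4)/2 - 4)` times a constant-coefficient operator in `s`, namely `(∂² -
ν²)(∂² - τ²)`. Only even derivatives occur because the weight `-(N-4)/2` is the centre of symmetry.
The exponents satisfy `0 ≤ ν < τ`. The number `ν` is real exactly because `μ ≤ μ*`, it is positive
when `μ < μ*`, and `μ_N = (N-4)/2 + ν` is the decay rate of the slow decaying mode
(`exists_exponents`).

Nonexistence. There is a homogeneous solution `h`, positive for `s > 0`, satisfying the Navier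
conditions and growing like `e^{νs}`, or like `s` if `ν = 0` (`exists_harmonic_profile`). A weak
solution is tested against `η(t/T) ‖x‖ ^ (-(N-4)/2) h(s) χ(s/S)`. Young's inequality absorbs the
nonlinear term (`weakSolution_test_bound`), leaving two errors beside the integral of `f` times the
profile. The time error is `(a/T)^q` times a quantity depending on `S` only, so it disappears as `T
→ ∞`. For the space error, `h` is annihilated by the operator, so every surviving term
differentiates the cutoff and costs a factor `1/S` (`exists_truncation_bound`). If `h ≤ C
e^{(ν+δ)s}` with `δ = (σ+4)/(p-1) - μ_N`, the remaining powers of `‖x‖` multiply to exactly `‖x‖ ^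
(-N)` (`holder_exponent_identity`), whose integral over the shell `S ≤ s ≤ 2S` is proportional to
`S`. The space error is therefore of order `S^{1-q}` and tends to `0`, whereas the integral of `f`
against the profile over a fixed shell is positive. Here `δ ≥ 0` means `p ≤ p_crit`. In the critical
case `δ = 0` the bound `h ≤ C e^{νs}` needs `ν > 0`; this is why `μ = μ*` is excluded there.

Existence. The profile `w = e^{-νs}(log (s+2) + B) - C e^{-τs}` decays at the slow rate up to a
logarithm. The concave logarithm makes it a strict supersolution, with residual at least
`e^{-νs}/(s+2)²`, also when `ν = 0`; `B` and `C` are fixed by the Navier conditions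
(`exists_supersolution_profile`). For `p > p_crit` the nonlinear term decays exponentially faster
than this residual, so for a small multiple `ε w` the difference between the linear and the
nonlinear side is positive, and it is taken as `f`. No sign of `w` is needed. That the smooth
function is also a weak solution follows from Green's identity used twice
(`integral_radialLift_mul_hardyRellich`), the Navier conditions cancelling all boundary terms.
Green's identity up to the sphere is obtained by cutting off the radial factor near the sphere and
passing to the limit. -/

noncomputable section

/-! ### Radial functions in the logarithmic variable. -/

/-- The radial function `x ↦ w (log ‖x‖)`. -/
def radialLift (N : ℕ) (w : ℝ → ℝ) : EuclideanSpace ℝ (Fin N) → ℝ := fun x => w (Real.log ‖x‖)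

/-- The Laplacian of radial functions in the variable `s = log ‖x‖`. -/
def logLap (N : ℕ) (w : ℝ → ℝ) : ℝ → ℝ :=
  fun s => Real.exp (-2 * s) * (deriv (deriv w) s + ((N : ℝ) - 2) * deriv w s)

theorem ne_zero_of_mem_extClosed {N : ℕ} {x : EuclideanSpace ℝ (Fin N)} (hx : x ∈ extClosed N) :
    x ≠ 0 := by
  rintro rfl
  have : (1 : ℝ) ≤ ‖(0 : EuclideanSpace ℝ (Fin N))‖ := hx
  simp at this
  linarith

theorem isClosed_extClosed (N : ℕ) : IsClosed (extClosed N) :=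
  isClosed_le continuous_const continuous_norm

theorem isOpen_extDomain (N : ℕ) : IsOpen (extDomain N) :=
  isOpen_lt continuous_const continuous_norm

theorem extDomain_subset_extClosed (N : ℕ) : extDomain N ⊆ extClosed N :=
  fun x (hx : 1 < ‖x‖) => (le_of_lt hx : 1 ≤ ‖x‖)

theorem exp_mul_log_norm {N : ℕ} {x : EuclideanSpace ℝ (Fin N)} (hx : x ≠ 0) (a : ℝ) :
    Real.exp (a * Real.log ‖x‖) = ‖x‖ ^ a := by
  rw [Real.rpow_def_of_pos (norm_pos_iff.2 hx), mul_comm]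

theorem contDiffAt_log_norm {N : ℕ} {x : EuclideanSpace ℝ (Fin N)} (hx : x ≠ 0) {n : WithTop ℕ∞} :
    ContDiffAt ℝ n (fun y : EuclideanSpace ℝ (Fin N) => Real.log ‖y‖) x :=
  (contDiffAt_norm ℝ hx).log (norm_ne_zero_iff.2 hx)

theorem contDiffAt_radialLift {N : ℕ} {w : ℝ → ℝ} {n : WithTop ℕ∞} (hw : ContDiff ℝ n w)
    {x : EuclideanSpace ℝ (Fin N)} (hx : x ≠ 0) : ContDiffAt ℝ n (radialLift N w) x :=
  hw.contDiffAt.comp x (contDiffAt_log_norm hx)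

theorem contDiffOn_radialLift {N : ℕ} {w : ℝ → ℝ} {n : WithTop ℕ∞} (hw : ContDiff ℝ n w) :
    ContDiffOn ℝ n (radialLift N w) (extClosed N) := fun _ hx =>
  (contDiffAt_radialLift hw (ne_zero_of_mem_extClosed hx)).contDiffWithinAt

theorem continuousOn_radialLift {N : ℕ} {w : ℝ → ℝ} (hw : Continuous w) :
    ContinuousOn (radialLift N w) (extClosed N) :=
  (contDiffOn_radialLift (n := 0) (contDiff_zero.2 hw)).continuousOn

theorem hasFDerivAt_radialLift {N : ℕ} {w : ℝ → ℝ} {w' : ℝ} {x : EuclideanSpace ℝ (Fin N)}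
    (hx : x ≠ 0) (hw : HasDerivAt w w' (Real.log ‖x‖)) :
    HasFDerivAt (radialLift N w)
      ((Real.exp (-2 * Real.log ‖x‖) * w') • innerSL ℝ x) x := by
  have hx' : ‖x‖ ≠ 0 := norm_ne_zero_iff.2 hx
  have h1 : HasFDerivAt (fun y : EuclideanSpace ℝ (Fin N) => ‖y‖ ^ 2) (2 • innerSL ℝ x) x :=
    (hasStrictFDerivAt_norm_sq x).hasFDerivAt
  have h2 : HasFDerivAt (fun y : EuclideanSpace ℝ (Fin N) => Real.log ‖y‖)
      ((‖x‖ ^ 2)⁻¹ • innerSL ℝ x) x := by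
    have h3 := (h1.log (pow_ne_zero 2 hx')).const_mul (1 / 2 : ℝ)
    convert! h3 using 1
    · ext y
      rw [Real.log_pow]; push_cast; ring
    · ext y
      simp
      ring
  have h4 := hw.comp_hasFDerivAt x h2
  convert! h4 using 1
  rw [exp_mul_log_norm hx, smul_smul, Real.rpow_neg (norm_nonneg _)]
  norm_num
  ring_nf

theorem laplacian_radialLift {N : ℕ} {w : ℝ → ℝ} (hw : ContDiff ℝ 2 w)
    {x : EuclideanSpace ℝ (Fin N)} (hx : x ≠ 0) :
    (Δ (radialLift N w)) x = radialLift N (logLap N w) x := by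
  have hd : ContDiff ℝ 1 (deriv w) := by
    have := (contDiff_succ_iff_deriv (n := 1) (f := w)).1 (by norm_num; exact hw)
    exact this.2.2
  have hw1 : ∀ s, HasDerivAt w (deriv w s) s := fun s =>
    (hw.differentiable (by norm_num) s).hasDerivAt
  set m : ℝ → ℝ := fun s => Real.exp (-2 * s) * deriv w s with hm
  have hw2 : ∀ s, HasDerivAt m
      (Real.exp (-2 * s) * (deriv (deriv w) s - 2 * deriv w s)) s := fun s => by
    have h1 := (hd.differentiable (by norm_num) s).hasDerivAt
    have h2 : HasDerivAt (fun s : ℝ => Real.exp (-2 * s)) (Real.exp (-2 * s) * (-2)) s := by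
      simpa using ((hasDerivAt_id s).const_mul (-2)).exp
    convert! h2.mul h1 using 1
    ring
  -- The gradient of a radial function is a radial factor times `x`. `J` is `innerSL ℝ` retyped as a
  -- plain ℝ-linear map, so that the product rule for `•` applies to it.
  obtain ⟨J, hJ⟩ : ∃ J : EuclideanSpace ℝ (Fin N) →L[ℝ] EuclideanSpace ℝ (Fin N) →L[ℝ] ℝ,
    J = innerSL ℝ := ⟨_, rfl⟩
  have hJ' : ∀ a c, J a c = inner ℝ a c := fun a c => by rw [hJ]; rfl
  have hev : fderiv ℝ (radialLift N w) =ᶠ[𝓝 x] fun y => radialLift N m y • J y := by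
    filter_upwards [isOpen_ne.mem_nhds hx] with y hy
    rw [hJ]
    exact (hasFDerivAt_radialLift hy (hw1 _)).fderiv
  have hfd := ((hasFDerivAt_radialLift hx (hw2 _)).smul
    (J.hasFDerivAt (x := x))).congr_of_eventuallyEq hev
  rw [InnerProductSpace.laplacian_eq_iteratedFDeriv_stdOrthonormalBasis]
  simp only [iteratedFDeriv_two_apply, hfd.fderiv]
  set b := stdOrthonormalBasis ℝ (EuclideanSpace ℝ (Fin N))
  have hs : ∑ i, inner ℝ x (b i) * inner ℝ x (b i) = ‖x‖ ^ 2 := by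
    rw [← b.sum_sq_norm_inner_left x]
    refine Finset.sum_congr rfl fun i _ => ?_
    rw [Real.norm_eq_abs, sq_abs, sq]
  have hs' : ∑ i, inner ℝ (b i) (b i) = (N : ℝ) := by
    simp
  have hx' : ‖x‖ ≠ 0 := norm_ne_zero_iff.2 hx
  have he : Real.exp (-2 * Real.log ‖x‖) * ‖x‖ ^ 2 = 1 := by
    rw [exp_mul_log_norm hx, Real.rpow_neg (norm_nonneg _)]
    norm_num
    field_simp
  calc _ = ∑ i, ((Real.exp (-2 * Real.log ‖x‖) * (Real.exp (-2 * Real.log ‖x‖)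
        * (deriv (deriv w) (Real.log ‖x‖) - 2 * deriv w (Real.log ‖x‖))))
          * (inner ℝ x (b i) * inner ℝ x (b i)) + radialLift N m x * inner ℝ (b i) (b i)) := by
        refine Finset.sum_congr rfl fun i _ => ?_
        simp only [add_apply, _root_.smul_apply,
          ContinuousLinearMap.smulRight_apply, innerSL_apply_apply, smul_eq_mul, hJ', Matrix.cons_val_zero,
          Matrix.cons_val_one]
        ring
    _ = _ := by
        rw [Finset.sum_add_distrib, ← Finset.mul_sum, ← Finset.mul_sum, hs, hs']
        simp only [radialLift, logLap, hm]
        linear_combination (Real.exp (-2 * Real.log ‖x‖)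
          * (deriv (deriv w) (Real.log ‖x‖) - 2 * deriv w (Real.log ‖x‖))) * he

/-- Boundary points are included: smoothness in a full neighbourhood makes derivatives within the
closed set agree with ordinary ones. Radial lifts are smooth away from the origin, so this covers
them on the sphere. -/
theorem extLaplacian_eq_laplacian {N : ℕ} {v : EuclideanSpace ℝ (Fin N) → ℝ}
    {x : EuclideanSpace ℝ (Fin N)} (hv : ContDiffAt ℝ 2 v x) (hx : x ∈ extClosed N) :
    extLaplacian N v x = (Δ v) x := by
  rw [extLaplacian, InnerProductSpace.laplacianWithin_eq_iteratedFDerivWithin_stdOrthonormalBasis v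
    (uniqueDiffOn_extClosed N) hx,
    InnerProductSpace.laplacian_eq_iteratedFDeriv_stdOrthonormalBasis,
    iteratedFDerivWithin_eq_iteratedFDeriv (uniqueDiffOn_extClosed N) hv hx]

theorem extLaplacian_congr {N : ℕ} {v v' : EuclideanSpace ℝ (Fin N) → ℝ}
    (h : EqOn v v' (extClosed N)) {x : EuclideanSpace ℝ (Fin N)} (hx : x ∈ extClosed N) :
    extLaplacian N v x = extLaplacian N v' x :=
  (InnerProductSpace.laplacianWithin_congr_nhdsWithin
    (Filter.eventually_of_mem self_mem_nhdsWithin h) (uniqueDiffOn_extClosed N)).self_of_nhdsWithin hx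

theorem extLaplacian_radialLift {N : ℕ} {w : ℝ → ℝ} (hw : ContDiff ℝ 2 w)
    {x : EuclideanSpace ℝ (Fin N)} (hx : x ∈ extClosed N) :
    extLaplacian N (radialLift N w) x = radialLift N (logLap N w) x := by
  have hx0 := ne_zero_of_mem_extClosed hx
  rw [extLaplacian_eq_laplacian (contDiffAt_radialLift hw hx0) hx, laplacian_radialLift hw hx0]

theorem contDiff_two_of_infty {w : ℝ → ℝ} (hw : ContDiff ℝ ∞ w) : ContDiff ℝ 2 w := by
  exact_mod_cast contDiff_infty.1 hw 2

theorem contDiff_deriv_infty {w : ℝ → ℝ} (hw : ContDiff ℝ ∞ w) : ContDiff ℝ ∞ (deriv w) :=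
  (contDiff_infty_iff_deriv.1 hw).2

theorem hasDerivAt_of_contDiff_infty {w : ℝ → ℝ} (hw : ContDiff ℝ ∞ w) (s : ℝ) :
    HasDerivAt w (deriv w s) s := (hw.differentiable (by simp) s).hasDerivAt

theorem contDiff_logLap {N : ℕ} {w : ℝ → ℝ} (hw : ContDiff ℝ ∞ w) : ContDiff ℝ ∞ (logLap N w) := by
  have h1 := contDiff_deriv_infty hw
  have h2 := contDiff_deriv_infty h1
  unfold logLap
  fun_prop

theorem hardyRellich_radialLift {N : ℕ} {μ : ℝ} {w : ℝ → ℝ} (hw : ContDiff ℝ ∞ w)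
    {x : EuclideanSpace ℝ (Fin N)} (hx : x ∈ extClosed N) :
    hardyRellich N μ (radialLift N w) x
      = radialLift N (logLap N (logLap N w)) x - μ / ‖x‖ ^ 4 * radialLift N w x := by
  have h2 : ContDiff ℝ 2 w := contDiff_two_of_infty hw
  have h2' : ContDiff ℝ 2 (logLap N w) := contDiff_two_of_infty (contDiff_logLap hw)
  rw [hardyRellich, extLaplacian_congr (fun y hy => extLaplacian_radialLift h2 hy) hx,
    extLaplacian_radialLift h2' hx]

/-! ### The Emden–Fowler transform. -/

theorem hasDerivAt_exp_mul (α s : ℝ) :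
    HasDerivAt (fun s : ℝ => Real.exp (α * s)) (α * Real.exp (α * s)) s := by
  simpa [mul_comm] using ((hasDerivAt_id s).const_mul α).exp

theorem deriv_exp_mul_mul {m : ℝ → ℝ} (hm : ContDiff ℝ ∞ m) (α : ℝ) :
    deriv (fun s => Real.exp (α * s) * m s)
      = fun s => Real.exp (α * s) * (deriv m s + α * m s) := by
  ext s
  have := ((hasDerivAt_exp_mul α s).mul (hasDerivAt_of_contDiff_infty hm s)).deriv
  refine this.trans ?_
  ring

theorem logLap_exp_mul {N : ℕ} {m : ℝ → ℝ} (hm : ContDiff ℝ ∞ m) (α : ℝ) :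
    logLap N (fun s => Real.exp (α * s) * m s) = fun s => Real.exp ((α - 2) * s)
      * (deriv (deriv m) s + (2 * α + N - 2) * deriv m s + α * (α + N - 2) * m s) := by
  have hm1 := contDiff_deriv_infty hm
  ext s
  rw [logLap, deriv_exp_mul_mul hm, deriv_exp_mul_mul (by fun_prop)]
  have h1 : deriv (fun s => deriv m s + α * m s) s = deriv (deriv m) s + α * deriv m s :=
    ((hasDerivAt_of_contDiff_infty hm1 s).add
      ((hasDerivAt_of_contDiff_infty hm s).const_mul α)).deriv
  have h2 : Real.exp ((α - 2) * s) = Real.exp (-2 * s) * Real.exp (α * s) := by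
    rw [← Real.exp_add]; ring_nf
  simp only [h1, h2]
  ring

/-- The radial form of `Δ² - μ‖x‖⁻⁴` on `‖x‖ ^ (-(N-4)/2) * m (log ‖x‖)`. -/
def emdenFowler (N : ℕ) (μ : ℝ) (m : ℝ → ℝ) : ℝ → ℝ := fun s =>
  deriv (deriv (deriv (deriv m))) s - (2 * ((N : ℝ) * (N - 4) / 4) + 4) * deriv (deriv m) s
    + (((N : ℝ) * (N - 4) / 4) ^ 2 - μ) * m s

/-- The radial function `‖x‖ ^ (-(N-4)/2) * m (log ‖x‖)`. -/
def emdenLift (N : ℕ) (m : ℝ → ℝ) : EuclideanSpace ℝ (Fin N) → ℝ :=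
  radialLift N fun s => Real.exp (-(((N : ℝ) - 4) / 2) * s) * m s

theorem logLap_emden {N : ℕ} {m : ℝ → ℝ} (hm : ContDiff ℝ ∞ m) :
    logLap N (fun s => Real.exp (-(((N : ℝ) - 4) / 2) * s) * m s)
      = fun s => Real.exp ((-(((N : ℝ) - 4) / 2) - 2) * s)
      * (deriv (deriv m) s + 2 * deriv m s - (N : ℝ) * (N - 4) / 4 * m s) := by
  rw [logLap_exp_mul hm]
  ext s
  ring

/-- With `α = N(N-4)/4`, the first Laplacian acts as `∂² + 2∂ - α` and the second, on the shifted
weight, as `∂² - 2∂ - α`. Their product `(∂² - α)² - 4∂²` has no odd-order terms. -/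
theorem logLap_logLap_emden {N : ℕ} {m : ℝ → ℝ} (hm : ContDiff ℝ ∞ m) (s : ℝ) :
    logLap N (logLap N (fun s => Real.exp (-(((N : ℝ) - 4) / 2) * s) * m s)) s
      = Real.exp ((-(((N : ℝ) - 4) / 2) - 4) * s) * emdenFowler N 0 m s := by
  have hm1 := contDiff_deriv_infty hm
  have hm2 := contDiff_deriv_infty hm1
  have hm3 := contDiff_deriv_infty hm2
  rw [logLap_emden hm, logLap_exp_mul (by fun_prop)]
  have h1 : deriv (fun s => deriv (deriv m) s + 2 * deriv m s - (N : ℝ) * (N - 4) / 4 * m s)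
      = fun s => deriv (deriv (deriv m)) s + 2 * deriv (deriv m) s
        - (N : ℝ) * (N - 4) / 4 * deriv m s := by
    ext s
    exact (((hasDerivAt_of_contDiff_infty hm2 s).add
      ((hasDerivAt_of_contDiff_infty hm1 s).const_mul 2)).sub
        ((hasDerivAt_of_contDiff_infty hm s).const_mul _)).deriv
  have h2 : deriv (fun s => deriv (deriv (deriv m)) s + 2 * deriv (deriv m) s
        - (N : ℝ) * (N - 4) / 4 * deriv m s)
      = fun s => deriv (deriv (deriv (deriv m))) s + 2 * deriv (deriv (deriv m)) s
        - (N : ℝ) * (N - 4) / 4 * deriv (deriv m) s := by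
    ext s
    exact (((hasDerivAt_of_contDiff_infty hm3 s).add
      ((hasDerivAt_of_contDiff_infty hm2 s).const_mul 2)).sub
        ((hasDerivAt_of_contDiff_infty hm1 s).const_mul _)).deriv
  rw [h1, h2, emdenFowler]
  ring_nf

theorem contDiff_exp_mul_mul {m : ℝ → ℝ} (hm : ContDiff ℝ ∞ m) (α : ℝ) :
    ContDiff ℝ ∞ (fun s => Real.exp (α * s) * m s) := by
  fun_prop

theorem extLaplacian_emdenLift {N : ℕ} {m : ℝ → ℝ} (hm : ContDiff ℝ ∞ m)
    {x : EuclideanSpace ℝ (Fin N)} (hx : x ∈ extClosed N) :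
    extLaplacian N (emdenLift N m) x = Real.exp ((-(((N : ℝ) - 4) / 2) - 2) * Real.log ‖x‖)
      * (deriv (deriv m) (Real.log ‖x‖) + 2 * deriv m (Real.log ‖x‖)
        - (N : ℝ) * (N - 4) / 4 * m (Real.log ‖x‖)) := by
  rw [emdenLift, extLaplacian_radialLift
    (contDiff_two_of_infty (contDiff_exp_mul_mul hm _)) hx, logLap_emden hm, radialLift]

theorem hardyRellich_emdenLift {N : ℕ} {μ : ℝ} {m : ℝ → ℝ} (hm : ContDiff ℝ ∞ m)
    {x : EuclideanSpace ℝ (Fin N)} (hx : x ∈ extClosed N) :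
    hardyRellich N μ (emdenLift N m) x = Real.exp ((-(((N : ℝ) - 4) / 2) - 4) * Real.log ‖x‖)
      * emdenFowler N μ m (Real.log ‖x‖) := by
  have hx0 := ne_zero_of_mem_extClosed hx
  rw [emdenLift, hardyRellich_radialLift (contDiff_exp_mul_mul hm _) hx]
  simp only [radialLift]
  rw [logLap_logLap_emden hm]
  have h2 : Real.exp ((-(((N : ℝ) - 4) / 2) - 4) * Real.log ‖x‖)
      = (‖x‖ ^ 4)⁻¹ * Real.exp (-(((N : ℝ) - 4) / 2) * Real.log ‖x‖) := by
    have : (‖x‖ ^ 4)⁻¹ = Real.exp (-4 * Real.log ‖x‖) := by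
      rw [exp_mul_log_norm hx0, Real.rpow_neg (norm_nonneg _)]
      norm_num
    rw [this, ← Real.exp_add]; ring_nf
  rw [h2]
  simp only [emdenFowler]
  field_simp
  ring

/-! ### Characteristic exponents. -/

/-- The characteristic polynomial is quadratic in the square of the exponent, with roots `ν² = d -
q` and `τ² = d + q`. The sum and product relations say that it factors as `(∂² - ν²)(∂² - τ²)`. The
inequalities `2 < τ`, `ν ≤ (N-2)/2` and the gap `τ² - ν² ≥ 2(N-2)` are what the two profiles
require. -/
theorem exists_exponents {N : ℕ} (hN : 5 ≤ N) {μ : ℝ} (h0 : 0 < μ) (h1 : μ ≤ muStar N) :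
    ∃ ν τ : ℝ, 0 ≤ ν ∧ ν ≤ ((N : ℝ) - 2) / 2 ∧ ν < τ ∧ 2 < τ ∧ 2 * ((N : ℝ) - 2) ≤ τ ^ 2 - ν ^ 2 ∧
      ν ^ 2 + τ ^ 2 = 2 * ((N : ℝ) * (N - 4) / 4) + 4 ∧
      ν ^ 2 * τ ^ 2 = ((N : ℝ) * (N - 4) / 4) ^ 2 - μ ∧
      muN N μ = ((N : ℝ) - 4) / 2 + ν ∧ (μ < muStar N → 0 < ν) := by
  have hN' : (5 : ℝ) ≤ N := by exact_mod_cast hN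
  set q := Real.sqrt (((N : ℝ) - 2) ^ 2 + μ) with hq
  have hq2 : q ^ 2 = ((N : ℝ) - 2) ^ 2 + μ := Real.sq_sqrt (by positivity)
  have hq0 : 0 ≤ q := Real.sqrt_nonneg _
  set d := (((N : ℝ) - 2) / 2) ^ 2 + 1 with hd
  -- This identity is the origin of `μ*`: it makes `q ≤ d` the same as `μ ≤ μ*`.
  have hd2 : d ^ 2 = ((N : ℝ) - 2) ^ 2 + muStar N := by rw [hd, muStar]; ring
  have hdpos : 0 < d := by positivity
  have hqN : (N : ℝ) - 2 ≤ q := Real.le_sqrt_of_sq_le (by linarith)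
  have hqd : q ≤ d := by
    refine abs_le_of_sq_le_sq' (by linarith) hdpos.le |>.2
  have hX : Real.sqrt (d - q) ^ 2 = d - q := Real.sq_sqrt (by linarith)
  have hY : Real.sqrt (d + q) ^ 2 = d + q := Real.sq_sqrt (by linarith)
  refine ⟨Real.sqrt (d - q), Real.sqrt (d + q), Real.sqrt_nonneg _, ?_, ?_, ?_, ?_, ?_, ?_, ?_, ?_⟩
  · refine Real.sqrt_le_iff.2 ⟨by linarith, ?_⟩
    linarith
  · exact Real.sqrt_lt_sqrt (by linarith) (by linarith)
  · refine Real.lt_sqrt_of_sq_lt ?_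
    nlinarith
  · rw [hX, hY]; linarith
  · rw [hX, hY, hd]; ring
  · rw [hX, hY]
    have : (d - q) * (d + q) = d ^ 2 - q ^ 2 := by ring
    rw [this, hd2, hq2, muStar]; ring
  · rw [muN]
  · intro h
    refine Real.sqrt_pos.2 ?_
    have : q < d := abs_lt_of_sq_lt_sq' (by linarith) hdpos.le |>.2
    linarith

/-! ### Separated test functions. -/

theorem emdenLift_const_mul {N : ℕ} (c : ℝ) (m : ℝ → ℝ) :
    emdenLift N (fun s => c * m s) = fun x => c * emdenLift N m x := by
  ext x
  simp only [emdenLift, radialLift]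
  ring

theorem emdenFowler_const_mul {N : ℕ} {μ c : ℝ} (m : ℝ → ℝ) (s : ℝ) :
    emdenFowler N μ (fun s => c * m s) s = c * emdenFowler N μ m s := by
  simp only [emdenFowler, deriv_const_mul_field']
  ring

theorem continuous_emdenFowler {N : ℕ} {μ : ℝ} {m : ℝ → ℝ} (hm : ContDiff ℝ ∞ m) :
    Continuous (emdenFowler N μ m) := by
  have h2 := contDiff_deriv_infty (contDiff_deriv_infty hm)
  have h4 := (contDiff_deriv_infty (contDiff_deriv_infty h2)).continuous
  have h2' := h2.continuous
  have h0 := hm.continuous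
  unfold emdenFowler
  fun_prop

theorem measurableSet_extClosed (N : ℕ) : MeasurableSet (extClosed N) :=
  (isClosed_extClosed N).measurableSet

theorem measurableSet_spaceTime (N : ℕ) : MeasurableSet (spaceTime N) :=
  measurableSet_Ioi.prod (measurableSet_extClosed N)

theorem continuousOn_emdenLift {N : ℕ} {m : ℝ → ℝ} (hm : Continuous m) :
    ContinuousOn (emdenLift N m) (extClosed N) :=
  continuousOn_radialLift (by fun_prop)

theorem contDiffOn_emdenLift {N : ℕ} {m : ℝ → ℝ} (hm : ContDiff ℝ ∞ m) {n : ℕ∞} :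
    ContDiffOn ℝ n (emdenLift N m) (extClosed N) :=
  (contDiffOn_radialLift (contDiff_exp_mul_mul hm _)).of_le (by exact_mod_cast le_top)

theorem continuousOn_log_norm (N : ℕ) :
    ContinuousOn (fun x : EuclideanSpace ℝ (Fin N) => Real.log ‖x‖) (extClosed N) :=
  continuousOn_radialLift (w := id) continuous_id

theorem log_norm_nonneg {N : ℕ} {x : EuclideanSpace ℝ (Fin N)} (hx : x ∈ extClosed N) :
    0 ≤ Real.log ‖x‖ := Real.log_nonneg hx

/-- The closed shell `1 ≤ ‖x‖ ≤ e ^ R`. -/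
def shell (N : ℕ) (R : ℝ) : Set (EuclideanSpace ℝ (Fin N)) :=
  {x | x ∈ extClosed N ∧ Real.log ‖x‖ ≤ R}

theorem isCompact_shell (N : ℕ) (R : ℝ) : IsCompact (shell N R) := by
  have : shell N R = extClosed N ∩ Metric.closedBall 0 (Real.exp R) := by
    ext x
    constructor
    · rintro ⟨h1, h2⟩
      refine ⟨h1, ?_⟩
      rw [mem_closedBall_zero_iff]
      exact (Real.log_le_iff_le_exp (norm_pos_iff.2 (ne_zero_of_mem_extClosed h1))).1 h2
    · rintro ⟨h1, h2⟩
      refine ⟨h1, ?_⟩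
      rw [mem_closedBall_zero_iff] at h2
      exact (Real.log_le_iff_le_exp (norm_pos_iff.2 (ne_zero_of_mem_extClosed h1))).2 h2
  rw [this]
  exact (isCompact_closedBall _ _).inter_left (isClosed_extClosed N)

theorem shell_subset {N : ℕ} {R : ℝ} : shell N R ⊆ extClosed N := fun _ hx => hx.1

theorem hardyRellich_mul_emdenLift {N : ℕ} {μ c : ℝ} {m : ℝ → ℝ} (hm : ContDiff ℝ ∞ m)
    {x : EuclideanSpace ℝ (Fin N)} (hx : x ∈ extClosed N) :
    hardyRellich N μ (fun y => c * emdenLift N m y) x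
      = c * (Real.exp ((-(((N : ℝ) - 4) / 2) - 4) * Real.log ‖x‖)
        * emdenFowler N μ m (Real.log ‖x‖)) := by
  rw [← emdenLift_const_mul, hardyRellich_emdenLift (by fun_prop) hx, emdenFowler_const_mul]
  ring

/-- The Laplacian at `s = 0` is a multiple of `m'' + 2m' - N(N-4)/4 m`. Once `m 0 = 0` the Navier
condition therefore loses its zeroth-order term, which explains the form of `hmn`. -/
theorem isTestFunction_mul_emdenLift {N : ℕ} {η m : ℝ → ℝ} {R : ℝ} (hη : ContDiff ℝ ∞ η)
    (hηc : HasCompactSupport η) (hηs : tsupport η ⊆ Ioi 0) (hη0 : ∀ t, 0 ≤ η t)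
    (hm : ContDiff ℝ ∞ m) (hm0 : ∀ s, 0 ≤ s → 0 ≤ m s) (hmR : ∀ s, R ≤ s → m s = 0)
    (hmd : m 0 = 0) (hmn : deriv (deriv m) 0 + 2 * deriv m 0 = 0) :
    IsTestFunction N (fun z => η z.1 * emdenLift N m z.2) := by
  have hηd := contDiff_deriv_infty hη
  have hV : ContinuousOn (fun z : ℝ × EuclideanSpace ℝ (Fin N) => emdenLift N m z.2)
      (spaceTime N) :=
    (continuousOn_emdenLift hm.continuous).comp continuousOn_snd fun z hz => hz.2
  have hd : ∀ (t : ℝ) (x : EuclideanSpace ℝ (Fin N)), HasDerivAt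
      (fun s => η s * emdenLift N m x) (deriv η t * emdenLift N m x) t := fun t x =>
    (hasDerivAt_of_contDiff_infty hη t).mul_const _
  refine ⟨⟨?_, ?_, ?_, ?_, ?_⟩, ?_, ?_, ?_⟩
  · exact fun t _ x _ => (hd t x).differentiableAt
  · simp only [(hd _ _).deriv]
    exact (hηd.continuous.comp continuous_fst).continuousOn.mul hV
  · intro t _
    have h4 : ContDiffOn ℝ 4 (emdenLift N m) (extClosed N) := by
      exact_mod_cast contDiffOn_emdenLift hm (n := 4)
    exact (contDiffOn_const (c := η t)).mul h4
  · intro k hk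
    have hVk : ContDiffOn ℝ k (emdenLift N m) (extClosed N) := contDiffOn_emdenLift hm
    have h1 : ContinuousOn (fun z : ℝ × EuclideanSpace ℝ (Fin N) =>
        η z.1 • iteratedFDerivWithin ℝ k (emdenLift N m) (extClosed N) z.2) (spaceTime N) :=
      (hη.continuous.comp continuous_fst).continuousOn.smul
        ((hVk.continuousOn_iteratedFDerivWithin le_rfl (uniqueDiffOn_extClosed N)).comp
          continuousOn_snd fun z hz => hz.2)
    refine h1.congr fun z hz => ?_
    exact iteratedFDerivWithin_const_smul_apply (a := η z.1) (hVk z.2 hz.2) (uniqueDiffOn_extClosed N) hz.2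
  · refine ⟨tsupport η ×ˢ shell N R, hηc.isCompact.prod (isCompact_shell N R),
      prod_mono hηs shell_subset, ?_⟩
    rintro ⟨t, x⟩ hz hz'
    by_cases ht : t ∈ tsupport η
    · have hx : R ≤ Real.log ‖x‖ := by
        by_contra hcon
        exact hz' ⟨ht, hz.2, (not_le.1 hcon).le⟩
      simp [emdenLift, radialLift, hmR _ hx]
    · simp [image_eq_zero_of_notMem_tsupport ht]
  · rintro ⟨t, x⟩ hz
    exact mul_nonneg (hη0 t) (mul_nonneg (Real.exp_pos _).le (hm0 _ (log_norm_nonneg hz.2)))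
  · intro t ht x hx
    have : ‖x‖ = 1 := hx
    simp [emdenLift, radialLift, this, hmd]
  · intro t ht x hx
    have h1 : ‖x‖ = 1 := hx
    have hx' : x ∈ extClosed N := h1.ge
    change extLaplacian N (fun y => η t * emdenLift N m y) x = 0
    rw [← emdenLift_const_mul, extLaplacian_emdenLift (by fun_prop) hx', h1]
    simp only [deriv_const_mul_field', Real.log_one, hmd]
    linear_combination (Real.exp ((-(((N : ℝ) - 4) / 2) - 2) * 0) * η t) * hmn

/-! ### Young's inequality and the absorbed weak identity. -/

theorem integrableOn_mul_of_compact {X : Type*} [TopologicalSpace X] [MeasurableSpace X]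
    [OpensMeasurableSpace X] [T2Space X] {ρ : Measure X} {g b : X → ℝ} {K D : Set X}
    (hK : IsCompact K) (hKD : K ⊆ D) (hD : MeasurableSet D) (hg : IntegrableOn g K ρ)
    (hb : ContinuousOn b D) (hb0 : ∀ z ∈ D, z ∉ K → b z = 0) :
    IntegrableOn (fun z => g z * b z) D ρ := by
  refine (hg.mul_continuousOn (hb.mono hKD) hK).of_forall_sdiff_eq_zero hD fun z hz => ?_
  rw [hb0 z hz.1 hz.2, mul_zero]

/-- Young's inequality, with the weight split as `W^{1/p} · W^{-1/p}`. The coefficient `1/2` allows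
two such terms to be absorbed by one copy of the nonlinearity. Assuming a bound by `Φ^{1/p} G^{1/q}`
avoids dividing by a test function that may vanish. -/
theorem young_weight {p q : ℝ} (hpq : p.HolderConjugate q) {u Y c W Φ G : ℝ} (hc : 0 ≤ c)
    (hW : 0 < W) (hΦ : 0 ≤ Φ) (hG : 0 ≤ G) (hY : |Y| ≤ c * (Φ ^ (1 / p) * G ^ (1 / q))) :
    |u * Y| ≤ W * |u| ^ p * Φ / 2 + (2 * c) ^ q * W ^ (-(q / p)) * G := by
  have hp := hpq.pos
  have hq := hpq.symm.pos
  set A := 1 / 2 * (|u| * W ^ (1 / p) * Φ ^ (1 / p)) with hA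
  set B := 2 * c * (W ^ (-(1 / p)) * G ^ (1 / q)) with hB
  have hA0 : 0 ≤ A := by positivity
  have hB0 : 0 ≤ B := by positivity
  have hWW : W ^ (1 / p) * W ^ (-(1 / p)) = 1 := by
    rw [← Real.rpow_add hW]; simp
  have h1 : |u * Y| ≤ A * B := by
    rw [abs_mul]
    calc |u| * |Y| ≤ |u| * (c * (Φ ^ (1 / p) * G ^ (1 / q))) := by gcongr
      _ = |u| * (c * (Φ ^ (1 / p) * G ^ (1 / q))) * (W ^ (1 / p) * W ^ (-(1 / p))) := by
        rw [hWW, mul_one]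
      _ = A * B := by rw [hA, hB]; ring
  have h2 := Real.young_inequality_of_nonneg hA0 hB0 hpq
  have hinv : ∀ {y : ℝ}, 0 ≤ y → ∀ {r : ℝ}, 0 < r → (y ^ (1 / r)) ^ r = y := fun hy r hr => by
    rw [← Real.rpow_mul hy, one_div_mul_cancel hr.ne', Real.rpow_one]
  have hAp : A ^ p = (1 / 2) ^ p * (W * |u| ^ p * Φ) := by
    rw [hA, Real.mul_rpow (by norm_num) (by positivity),
      Real.mul_rpow (by positivity) (by positivity), Real.mul_rpow (by positivity) (by positivity),
      hinv hW.le hp, hinv hΦ hp]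
    ring
  have hBq : B ^ q = (2 * c) ^ q * W ^ (-(q / p)) * G := by
    rw [hB, Real.mul_rpow (by positivity) (by positivity),
      Real.mul_rpow (x := W ^ (-(1 / p))) (by positivity) (by positivity), hinv hG hq, ← Real.rpow_mul hW.le]
    rw [show -(1 / p) * q = -(q / p) by ring]
    ring
  have hF0 : 0 ≤ W * |u| ^ p * Φ := by positivity
  have h3 : A ^ p / p ≤ W * |u| ^ p * Φ / 2 := by
    have : ((1 : ℝ) / 2) ^ p ≤ 1 / 2 := by
      calc ((1 : ℝ) / 2) ^ p ≤ (1 / 2) ^ (1 : ℝ) :=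
            Real.rpow_le_rpow_of_exponent_ge (by norm_num) (by norm_num) hpq.lt.le
        _ = 1 / 2 := by simp
    calc A ^ p / p ≤ A ^ p := div_le_self (by positivity) hpq.lt.le
      _ ≤ 1 / 2 * (W * |u| ^ p * Φ) := by rw [hAp]; gcongr
      _ = _ := by ring
  have h4 : B ^ q / q ≤ (2 * c) ^ q * W ^ (-(q / p)) * G := by
    rw [← hBq]
    exact div_le_self (by positivity) hpq.symm.lt.le
  linarith

theorem spaceTime_measure (N : ℕ) :
    (volume : Measure (ℝ × EuclideanSpace ℝ (Fin N))).restrict (spaceTime N)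
      = (volume.restrict (Ioi 0)).prod (volume.restrict (extClosed N)) := by
  rw [spaceTime, Measure.prod_restrict]
  rfl

/-- Testing a weak solution against `η(t) ‖x‖ ^ (-(N-4)/2) m(log ‖x‖)` and absorbing the
nonlinear term by Young's inequality. -/
theorem weakSolution_test_bound {N : ℕ} {μ σ p q : ℝ} (hpq : p.HolderConjugate q)
    {f : EuclideanSpace ℝ (Fin N) → ℝ} (hf : LocallyIntegrableOn f (extClosed N))
    {u : ℝ × EuclideanSpace ℝ (Fin N) → ℝ} (hu : IsWeakSolution N μ σ p f u)
    {η m : ℝ → ℝ} {R T₁ T₂ : ℝ} (hη : ContDiff ℝ ∞ η)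
    (hT₁ : 0 < T₁) (hηs : tsupport η ⊆ Icc T₁ T₂) (hT : T₁ ≤ T₂)
    (hη0 : ∀ t, 0 ≤ η t)
    (hm : ContDiff ℝ ∞ m) (hm0 : ∀ s, 0 ≤ s → 0 ≤ m s) (hmR : ∀ s, R ≤ s → m s = 0)
    (hmd : m 0 = 0) (hmn : deriv (deriv m) 0 + 2 * deriv m 0 = 0)
    {G₁ G₂ c₂ : EuclideanSpace ℝ (Fin N) → ℝ} {c₁ : ℝ} (hc₁ : 0 ≤ c₁)
    (hc₂ : ∀ x ∈ extClosed N, 0 ≤ c₂ x)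
    (hG₁ : ∀ x ∈ extClosed N, 0 ≤ G₁ x) (hG₂ : ∀ x ∈ extClosed N, 0 ≤ G₂ x)
    (hY₁ : ∀ t, ∀ x ∈ extClosed N, |deriv η t * emdenLift N m x|
      ≤ c₁ * ((η t * emdenLift N m x) ^ (1 / p) * G₁ x ^ (1 / q)))
    (hY₂ : ∀ t, ∀ x ∈ extClosed N, |hardyRellich N μ (fun y => η t * emdenLift N m y) x|
      ≤ c₂ x * ((η t * emdenLift N m x) ^ (1 / p) * G₂ x ^ (1 / q)))
    (hI₁ : IntegrableOn (fun x => (2 * c₁) ^ q * (‖x‖ ^ σ) ^ (-(q / p)) * G₁ x) (extClosed N))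
    (hI₂ : IntegrableOn (fun x => (2 * c₂ x) ^ q * (‖x‖ ^ σ) ^ (-(q / p)) * G₂ x) (extClosed N)) :
    (∫ t, η t) * (∫ x in extClosed N, f x * emdenLift N m x)
      ≤ (T₂ - T₁) * ((∫ x in extClosed N, (2 * c₁) ^ q * (‖x‖ ^ σ) ^ (-(q / p)) * G₁ x)
        + ∫ x in extClosed N, (2 * c₂ x) ^ q * (‖x‖ ^ σ) ^ (-(q / p)) * G₂ x) := by
  have hηs' : tsupport η ⊆ Ioi 0 := fun t ht => hT₁.trans_le (hηs ht).1
  have hηc : HasCompactSupport η := isCompact_Icc.of_isClosed_subset (isClosed_tsupport η) hηs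
  have hηd := contDiff_deriv_infty hη
  have htest := isTestFunction_mul_emdenLift (N := N) hη hηc hηs' hη0 hm hm0 hmR hmd hmn
  set K := tsupport η ×ˢ shell N R with hKdef
  have hK : IsCompact K := hηc.isCompact.prod (isCompact_shell N R)
  have hKD : K ⊆ spaceTime N := prod_mono hηs' shell_subset
  have hVc := continuousOn_emdenLift (N := N) hm.continuous
  have hVR : ∀ x : EuclideanSpace ℝ (Fin N), x ∈ extClosed N → x ∉ shell N R →
      emdenLift N m x = 0 ∧ emdenFowler N μ m (Real.log ‖x‖) = 0 := by
    intro x hx hxs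
    have hR : R < Real.log ‖x‖ := by
      by_contra hcon
      exact hxs ⟨hx, not_lt.1 hcon⟩
    have hev : m =ᶠ[𝓝 (Real.log ‖x‖)] fun _ => 0 := by
      filter_upwards [Ioi_mem_nhds hR] with s hs using hmR s (le_of_lt hs)
    have h2 : deriv (deriv m) =ᶠ[𝓝 (Real.log ‖x‖)] fun _ => 0 := by
      have := hev.deriv.deriv
      simpa using this
    have h4 := h2.deriv.deriv
    refine ⟨by simp [emdenLift, radialLift, hmR _ hR.le], ?_⟩
    simp [emdenFowler, h2.self_of_nhds, h4.self_of_nhds, hmR _ hR.le]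
  have hp1 : 1 < p := hpq.lt
  have humem := hu.memLp_loc K hK hKD
  have hfin : IsFiniteMeasure ((volume : Measure (ℝ × EuclideanSpace ℝ (Fin N))).restrict K) :=
    ⟨by rw [Measure.restrict_apply_univ]; exact hK.measure_lt_top⟩
  have huint : IntegrableOn u K := humem.integrable (by
    rw [← ENNReal.ofReal_one]; exact ENNReal.ofReal_le_ofReal hp1.le)
  have hupint : IntegrableOn (fun z => |u z| ^ p) K := by
    have := humem.integrable_norm_rpow (by simpa using hpq.pos) (by simp)
    simp only [ENNReal.toReal_ofReal hpq.pos.le, Real.norm_eq_abs] at this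
    exact this
  have hD := measurableSet_spaceTime N
  have hη1 : ContinuousOn (fun z : ℝ × EuclideanSpace ℝ (Fin N) => η z.1) (spaceTime N) :=
    (hη.continuous.comp continuous_fst).continuousOn
  have hη2 : ContinuousOn (fun z : ℝ × EuclideanSpace ℝ (Fin N) => deriv η z.1) (spaceTime N) :=
    (hηd.continuous.comp continuous_fst).continuousOn
  have hV2 : ContinuousOn (fun z : ℝ × EuclideanSpace ℝ (Fin N) => emdenLift N m z.2)
      (spaceTime N) := hVc.comp continuousOn_snd fun z hz => hz.2
  have hlog2 : ContinuousOn (fun z : ℝ × EuclideanSpace ℝ (Fin N) => Real.log ‖z.2‖)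
      (spaceTime N) := (continuousOn_log_norm N).comp continuousOn_snd fun z hz => hz.2
  have hpow2 : ContinuousOn (fun z : ℝ × EuclideanSpace ℝ (Fin N) => ‖z.2‖ ^ σ)
      (spaceTime N) := by
    refine ContinuousOn.rpow_const (by fun_prop) fun z hz => Or.inl ?_
    exact norm_ne_zero_iff.2 (ne_zero_of_mem_extClosed hz.2)
  have hφ0 : ∀ z ∈ spaceTime N, z ∉ K → η z.1 = 0 ∧ deriv η z.1 = 0 ∨
      (emdenLift N m z.2 = 0 ∧ emdenFowler N μ m (Real.log ‖z.2‖) = 0) := by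
    intro z hz hzK
    by_cases ht : z.1 ∈ tsupport η
    · exact Or.inr (hVR z.2 hz.2 fun hx => hzK ⟨ht, hx⟩)
    · refine Or.inl ⟨image_eq_zero_of_notMem_tsupport ht, ?_⟩
      exact image_eq_zero_of_notMem_tsupport fun h => ht (tsupport_deriv_subset h)
  have hderiv : ∀ z : ℝ × EuclideanSpace ℝ (Fin N),
      deriv (fun s => η s * emdenLift N m z.2) z.1 = deriv η z.1 * emdenLift N m z.2 := fun z =>
    ((hasDerivAt_of_contDiff_infty hη z.1).mul_const _).deriv
  have iF1 : IntegrableOn (fun z : ℝ × EuclideanSpace ℝ (Fin N) =>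
      ‖z.2‖ ^ σ * |u z| ^ p * (η z.1 * emdenLift N m z.2)) (spaceTime N) := by
    have := integrableOn_mul_of_compact (b := fun z => ‖z.2‖ ^ σ * (η z.1 * emdenLift N m z.2))
      hK hKD hD hupint (hpow2.mul (hη1.mul hV2)) (by
        intro z hz hzK
        rcases hφ0 z hz hzK with h | h <;> simp [h.1])
    refine this.congr_fun (fun z _ => ?_) hD
    ring
  have iG1 : IntegrableOn (fun z : ℝ × EuclideanSpace ℝ (Fin N) =>
      u z * (deriv η z.1 * emdenLift N m z.2)) (spaceTime N) :=
    integrableOn_mul_of_compact hK hKD hD huint (hη2.mul hV2) (by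
      intro z hz hzK
      rcases hφ0 z hz hzK with h | h
      · simp [h.2]
      · simp [h.1])
  have iG2 : IntegrableOn (fun z : ℝ × EuclideanSpace ℝ (Fin N) =>
      u z * hardyRellich N μ (fun y => η z.1 * emdenLift N m y) z.2) (spaceTime N) := by
    have hc : Continuous (emdenFowler N μ m) := continuous_emdenFowler hm
    have := integrableOn_mul_of_compact (b := fun z : ℝ × EuclideanSpace ℝ (Fin N) => η z.1 *
        (Real.exp ((-(((N : ℝ) - 4) / 2) - 4) * Real.log ‖z.2‖)
        * emdenFowler N μ m (Real.log ‖z.2‖))) hK hKD hD huint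
        (hη1.mul ((Real.continuous_exp.comp_continuousOn (continuousOn_const.mul hlog2)).mul
          (hc.comp_continuousOn hlog2))) (by
        intro z hz hzK
        rcases hφ0 z hz hzK with h | h
        · simp [h.1]
        · simp [h.2])
    refine this.congr_fun (fun z hz => ?_) hD
    simp only [hardyRellich_mul_emdenLift hm hz.2]
  have hfV : IntegrableOn (fun x => f x * emdenLift N m x) (extClosed N) :=
    integrableOn_mul_of_compact (isCompact_shell N R) shell_subset (measurableSet_extClosed N)
      (hf.integrableOn_compact_subset shell_subset (isCompact_shell N R)) hVc
      fun x hx hxs => (hVR x hx hxs).1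
  have hηint : Integrable η := hη.continuous.integrable_of_hasCompactSupport hηc
  have hF2 : ∫ z in spaceTime N, f z.2 * (η z.1 * emdenLift N m z.2)
      = (∫ t, η t) * (∫ x in extClosed N, f x * emdenLift N m x) := by
    have h1 : ∫ t in Ioi 0, η t = ∫ t, η t := by
      refine setIntegral_eq_integral_of_forall_compl_eq_zero fun t ht => ?_
      exact image_eq_zero_of_notMem_tsupport fun h => ht (hηs' h)
    rw [← h1, ← integral_prod_mul, spaceTime_measure]
    congr 1
    ext z
    ring
  set E₁ := fun x : EuclideanSpace ℝ (Fin N) => (2 * c₁) ^ q * (‖x‖ ^ σ) ^ (-(q / p)) * G₁ x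
  set E₂ := fun x : EuclideanSpace ℝ (Fin N) => (2 * c₂ x) ^ q * (‖x‖ ^ σ) ^ (-(q / p)) * G₂ x
  -- The time indicator makes the majorant integrable on all of `D` and produces the factor `T₂ -
  -- T₁`.
  set B := fun z : ℝ × EuclideanSpace ℝ (Fin N) =>
    (Icc T₁ T₂).indicator (fun _ => (1 : ℝ)) z.1 * (E₁ z.2 + E₂ z.2) with hBdef
  have hind : Integrable ((Icc T₁ T₂).indicator (fun _ => (1 : ℝ))) (volume.restrict (Ioi 0)) :=
    (IntegrableOn.integrable_indicator (by simp) measurableSet_Icc).restrict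
  have iB : IntegrableOn B (spaceTime N) := by
    rw [IntegrableOn, spaceTime_measure]
    exact hind.mul_prod (hI₁.add hI₂)
  have hBint : ∫ z in spaceTime N, B z = (T₂ - T₁) * ((∫ x in extClosed N, E₁ x)
      + ∫ x in extClosed N, E₂ x) := by
    rw [spaceTime_measure]
    refine (integral_prod_mul _ (fun x => E₁ x + E₂ x)).trans ?_
    rw [integral_add hI₁ hI₂]
    congr 1
    have hI : Icc T₁ T₂ ⊆ Ioi 0 := fun t ht => hT₁.trans_le ht.1
    rw [setIntegral_indicator measurableSet_Icc, inter_eq_right.2 hI]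
    simp [hT]
  have key := hu.weak_eq _ htest
  simp only [hderiv] at key
  -- Young is applied to the time term and to the space term, each paying half of the nonlinear
  -- term. For `t` outside `[T₁, T₂]` both terms vanish.
  have hpt : ∀ z ∈ spaceTime N, -(u z * (deriv η z.1 * emdenLift N m z.2))
      + u z * hardyRellich N μ (fun y => η z.1 * emdenLift N m y) z.2
      ≤ ‖z.2‖ ^ σ * |u z| ^ p * (η z.1 * emdenLift N m z.2) + B z := by
    rintro ⟨t, x⟩ hz
    have hx : x ∈ extClosed N := hz.2
    have hW : 0 < ‖x‖ ^ σ := Real.rpow_pos_of_pos (norm_pos_iff.2 (ne_zero_of_mem_extClosed hx)) _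
    have hΦ : 0 ≤ η t * emdenLift N m x := htest.nonneg _ hz
    by_cases ht : t ∈ Icc T₁ T₂
    · have h1 := young_weight hpq (u := u (t, x)) hc₁ hW hΦ (hG₁ x hx) (hY₁ t x hx)
      have h2 := young_weight hpq (u := u (t, x)) (hc₂ x hx) hW hΦ (hG₂ x hx) (hY₂ t x hx)
      have h1' := (abs_le.1 h1).1
      have h2' := (abs_le.1 h2).2
      simp only [hBdef, indicator_of_mem ht, one_mul, E₁, E₂]
      linarith
    · have h1 : t ∉ tsupport η := fun h => ht (hηs h)
      have h2 : η t = 0 := image_eq_zero_of_notMem_tsupport h1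
      have h3 : deriv η t = 0 :=
        image_eq_zero_of_notMem_tsupport fun h => h1 (tsupport_deriv_subset h)
      simp only [hBdef, indicator_of_notMem ht, hardyRellich_mul_emdenLift hm hx, h2, h3]
      simp
  have hle := setIntegral_mono_on (iG1.neg.add iG2) (iF1.add iB) hD hpt
  have e1 := integral_add iG1.neg iG2
  have e2 := integral_add iF1 iB
  have e3 := integral_neg (μ := volume.restrict (spaceTime N))
    (fun z : ℝ × EuclideanSpace ℝ (Fin N) => u z * (deriv η z.1 * emdenLift N m z.2))
  simp only [Pi.add_apply, Pi.neg_apply] at hle e1 e2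
  rw [e1, e2, e3, hBint] at hle
  rw [← hF2]
  linarith

/-! ### Cutoffs whose derivatives are controlled by their own powers. -/

/-- Derivatives of a high power of a smooth function are divisible by a slightly lower power. -/
theorem exists_iterate_deriv_pow {ζ : ℝ → ℝ} (hζ : ContDiff ℝ ∞ ζ) (k n : ℕ) :
    ∃ g : ℝ → ℝ, ContDiff ℝ ∞ g ∧ deriv^[k] (fun s => ζ s ^ (n + k)) = fun s => ζ s ^ n * g s := by
  have hζ' := contDiff_deriv_infty hζ
  induction k generalizing n with
  | zero => exact ⟨fun _ => 1, contDiff_const, by simp⟩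
  | succ k ih =>
    obtain ⟨g, hg, h⟩ := ih (n + 1)
    have hg' := contDiff_deriv_infty hg
    refine ⟨fun s => (n + 1 : ℝ) * deriv ζ s * g s + ζ s * deriv g s, by fun_prop, ?_⟩
    rw [Function.iterate_succ_apply', show n + (k + 1) = n + 1 + k by ring, h]
    ext s
    have := (((hasDerivAt_of_contDiff_infty hζ s).pow (n + 1)).mul
      (hasDerivAt_of_contDiff_infty hg s)).deriv
    refine this.trans ?_
    simp only [Pi.pow_apply, add_tsub_cancel_right]
    push_cast
    ring

theorem hasCompactSupport_iterate_deriv {ζ : ℝ → ℝ} (hζ : HasCompactSupport (deriv ζ)) (k : ℕ) :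
    HasCompactSupport (deriv^[k + 1] ζ) := by
  induction k with
  | zero => exact hζ
  | succ k ih => rw [Function.iterate_succ_apply']; exact ih.deriv

/-- For `0 ≤ ζ ≤ 1` with `ζ'` compactly supported, the derivatives of a high power `χ = ζ ^ l` are
controlled by `χ ^ (1/p)`. -/
theorem exists_pow_deriv_bound {p : ℝ} (hp : 1 < p) {ζ : ℝ → ℝ} (hζ : ContDiff ℝ ∞ ζ)
    (h0 : ∀ s, 0 ≤ ζ s) (h1 : ∀ s, ζ s ≤ 1) (hc : HasCompactSupport (deriv ζ)) :
    ∃ l : ℕ, l ≠ 0 ∧ ∃ C : ℝ, 0 ≤ C ∧ ∀ k < 4, ∀ s,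
      |deriv^[k + 1] (fun s => ζ s ^ l) s| ≤ C * (ζ s ^ l) ^ (1 / p) := by
  obtain ⟨n, hn⟩ := exists_nat_ge (4 / (p - 1))
  have hp0 : 0 < p - 1 := by linarith
  -- This is the purpose of `n ≥ 4/(p-1)`: after four derivatives `ζ^{n+4}` still contains the
  -- factor `ζ^n`, and `ζ^n ≤ (ζ^{n+4})^{1/p}` because `0 ≤ ζ ≤ 1`.
  have hn' : ((n + 4 : ℕ) : ℝ) * (1 / p) ≤ n := by
    rw [div_le_iff₀ hp0] at hn
    rw [mul_one_div, div_le_iff₀ (by linarith)]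
    push_cast
    linarith
  refine ⟨n + 4, by simp, ?_⟩
  have hcl : HasCompactSupport (deriv fun s => ζ s ^ (n + 4)) := by
    have : (deriv fun s => ζ s ^ (n + 4)) = fun s => ((n + 4 : ℕ) * ζ s ^ (n + 3)) * deriv ζ s := by
      ext s
      exact ((hasDerivAt_of_contDiff_infty hζ s).pow (n + 4)).deriv
    rw [this]
    exact hc.mul_left
  have hpow : ∀ s, ζ s ^ n ≤ (ζ s ^ (n + 4)) ^ (1 / p) := by
    intro s
    rcases (h0 s).eq_or_lt with hs | hs
    -- At a zero of `ζ` the left side must vanish, so `0 ^ 0 = 1` has to be ruled out.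
    · have hn0 : n ≠ 0 := by
        rintro rfl
        have : 0 < 4 / (p - 1) := by positivity
        simp only [Nat.cast_zero] at hn
        linarith
      rw [← hs, zero_pow hn0]
      positivity
    · rw [← Real.rpow_natCast, ← Real.rpow_natCast, ← Real.rpow_mul hs.le]
      exact Real.rpow_le_rpow_of_exponent_ge hs (h1 s) hn'
  have hk : ∀ k < 4, ∃ C : ℝ, 0 ≤ C ∧ ∀ s,
      |deriv^[k + 1] (fun s => ζ s ^ (n + 4)) s| ≤ C * (ζ s ^ (n + 4)) ^ (1 / p) := by
    intro k hk
    -- Since `k < 4`, the truncated subtraction is harmless and the remaining exponent is at least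
    -- `n`.
    obtain ⟨g, hg, h⟩ := exists_iterate_deriv_pow hζ (k + 1) (n + 3 - k)
    rw [show n + 3 - k + (k + 1) = n + 4 by lia] at h
    have hcomp := hasCompactSupport_iterate_deriv hcl k
    obtain ⟨C, hC⟩ := hcomp.isCompact.exists_bound_of_continuousOn hg.continuous.continuousOn
    refine ⟨max C 0, le_max_right _ _, fun s => ?_⟩
    by_cases hs : s ∈ tsupport (deriv^[k + 1] fun s => ζ s ^ (n + 4))
    · have hgs := (hC s hs).trans (le_max_left C 0)
      rw [h]
      simp only [abs_mul, abs_pow, abs_of_nonneg (h0 s)]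
      rw [mul_comm]
      refine mul_le_mul hgs ?_ (pow_nonneg (h0 s) _) (le_max_right _ _)
      exact (pow_le_pow_of_le_one (h0 s) (h1 s) (by lia)).trans (hpow s)
    · rw [image_eq_zero_of_notMem_tsupport hs, abs_zero]
      have := h0 s
      positivity
  choose! C hC using hk
  refine ⟨∑ k ∈ Finset.range 4, C k, Finset.sum_nonneg fun k hk => (hC k (Finset.mem_range.1 hk)).1,
    fun k hk s => ((hC k hk).2 s).trans ?_⟩
  have := h0 s
  gcongr
  exact Finset.single_le_sum (f := C) (fun k hk => (hC k (Finset.mem_range.1 hk)).1)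
    (Finset.mem_range.2 hk)

theorem exists_space_cutoff {p : ℝ} (hp : 1 < p) : ∃ χ : ℝ → ℝ, ContDiff ℝ ∞ χ ∧
    (∀ s, 0 ≤ χ s) ∧ (∀ s, χ s ≤ 1) ∧ (∀ s ≤ 1, χ s = 1) ∧ (∀ s, 2 ≤ s → χ s = 0) ∧
    ∃ C : ℝ, 0 ≤ C ∧ ∀ k < 4, ∀ s, |deriv^[k + 1] χ s| ≤ C * χ s ^ (1 / p) := by
  set ζ : ℝ → ℝ := fun s => Real.smoothTransition (2 - s) with hζdef
  have hζ : ContDiff ℝ ∞ ζ := Real.smoothTransition.contDiff.comp (by fun_prop)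
  have hc : HasCompactSupport (deriv ζ) := by
    refine HasCompactSupport.intro (isCompact_Icc (a := (1 : ℝ)) (b := 2)) fun s hs => ?_
    rw [mem_Icc, not_and_or, not_le, not_le] at hs
    rcases hs with hs | hs
    · have : ζ =ᶠ[𝓝 s] fun _ => 1 := by
        filter_upwards [Iio_mem_nhds hs] with y hy
        exact Real.smoothTransition.one_of_one_le (by linarith [mem_Iio.1 hy])
      rw [this.deriv_eq, deriv_const]
    · have : ζ =ᶠ[𝓝 s] fun _ => 0 := by
        filter_upwards [Ioi_mem_nhds hs] with y hy
        exact Real.smoothTransition.zero_of_nonpos (by linarith [mem_Ioi.1 hy])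
      rw [this.deriv_eq, deriv_const]
  obtain ⟨l, hl, C, hC, h⟩ := exists_pow_deriv_bound hp hζ
    (fun s => Real.smoothTransition.nonneg _) (fun s => Real.smoothTransition.le_one _) hc
  refine ⟨fun s => ζ s ^ l, hζ.pow l, fun s => pow_nonneg (Real.smoothTransition.nonneg _) _,
    fun s => pow_le_one₀ (Real.smoothTransition.nonneg _) (Real.smoothTransition.le_one _),
    fun s hs => ?_, fun s hs => ?_, C, hC, h⟩
  · simp only [hζdef]
    rw [Real.smoothTransition.one_of_one_le (by linarith), one_pow]
  · simp only [hζdef]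
    rw [Real.smoothTransition.zero_of_nonpos (by linarith), zero_pow hl]

theorem exists_time_cutoff {p : ℝ} (hp : 1 < p) : ∃ η : ℝ → ℝ, ContDiff ℝ ∞ η ∧
    (∀ s, 0 ≤ η s) ∧ (∀ s, η s ≤ 1) ∧ tsupport η ⊆ Icc 1 3 ∧ 0 < ∫ t, η t ∧
    ∃ C : ℝ, 0 ≤ C ∧ ∀ s, |deriv η s| ≤ C * η s ^ (1 / p) := by
  let ζ : ContDiffBump (2 : ℝ) := ⟨1 / 2, 1, by norm_num, by norm_num⟩
  have hζ : ContDiff ℝ ∞ ζ := ζ.contDiff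
  obtain ⟨l, hl, C, hC, h⟩ := exists_pow_deriv_bound hp hζ (fun s => ζ.nonneg) (fun s => ζ.le_one)
    ζ.hasCompactSupport.deriv
  have hsupp : tsupport (fun s => ζ s ^ l) ⊆ Icc 1 3 := by
    refine closure_minimal (fun s hs => ?_) isClosed_Icc
    have hs' : s ∈ Function.support ζ := fun h0 => hs (by simp [h0, hl])
    rw [ζ.support_eq, Real.ball_eq_Ioo] at hs'
    have h1 : (2 : ℝ) - 1 < s := hs'.1
    have h2 : s < (2 : ℝ) + 1 := hs'.2
    constructor <;> linarith
  have hcs : HasCompactSupport (fun s => ζ s ^ l) :=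
    isCompact_Icc.of_isClosed_subset (isClosed_tsupport _) hsupp
  refine ⟨fun s => ζ s ^ l, hζ.pow l, fun s => pow_nonneg ζ.nonneg _,
    fun s => pow_le_one₀ ζ.nonneg ζ.le_one, hsupp, ?_, C, hC, fun s => h 0 (by norm_num) s⟩
  refine (hζ.continuous.pow l).integral_pos_of_hasCompactSupport_nonneg_nonzero hcs
    (fun s => pow_nonneg ζ.nonneg _) (x := 2) ?_
  have : ζ 2 = 1 := ζ.one_of_mem_closedBall (by simp; exact ζ.rIn_pos.le)
  simp [this]

/-! ### The positive homogeneous profile. -/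

theorem hasDerivAt_exp_neg_mul (ν s : ℝ) :
    HasDerivAt (fun s : ℝ => Real.exp (-ν * s)) (-ν * Real.exp (-ν * s)) s :=
  hasDerivAt_exp_mul (-ν) s

/-- The solution of `g'' = ν² g`, `g(0) = 0`, `g'(0) = 1`. -/
theorem exists_growing_solution {ν : ℝ} (hν : 0 ≤ ν) : ∃ g g' : ℝ → ℝ,
    ContDiff ℝ ∞ g ∧ (∀ s, HasDerivAt g (g' s) s) ∧ (∀ s, HasDerivAt g' (ν ^ 2 * g s) s) ∧
    g 0 = 0 ∧ g' 0 = 1 ∧ (∀ s, 0 < s → 0 < g s) ∧ (∀ s, 1 ≤ s → g 1 ≤ g s) ∧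
    (∃ C : ℝ, 0 ≤ C ∧ ∀ s, 1 ≤ s → |g' s| ≤ C * g s) ∧
    ∀ δ, 0 ≤ δ → (0 < δ ∨ 0 < ν) →
      ∃ C : ℝ, 0 ≤ C ∧ ∀ s, 0 ≤ s → g s ≤ C * Real.exp ((ν + δ) * s) := by
  -- The solution is `s` for `ν = 0` and `sinh (νs)/ν` otherwise. Linear growth is not `O(e^{0·s})`,
  -- hence the alternative `0 < δ ∨ 0 < ν` in the growth bound.
  rcases hν.eq_or_lt with rfl | hν
  · refine ⟨fun s => s, fun _ => 1, contDiff_id, hasDerivAt_id, fun s => ?_, rfl, rfl,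
      fun s hs => hs, fun s hs => hs, ⟨1, zero_le_one, fun s hs => ?_⟩, ?_⟩
    · simpa using hasDerivAt_const s (1 : ℝ)
    · simpa using hs
    · intro δ hδ h
      have hδ' : 0 < δ := h.resolve_right (lt_irrefl _)
      refine ⟨δ⁻¹, by positivity, fun s hs => ?_⟩
      rw [zero_add, ← div_eq_inv_mul, le_div_iff₀ hδ']
      linarith [Real.add_one_le_exp (δ * s)]
  · have hs1 : 0 < Real.sinh ν := Real.sinh_pos_iff.2 hν
    have hlin : ∀ s, HasDerivAt (fun s : ℝ => ν * s) ν s := fun s => by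
      simpa using (hasDerivAt_id s).const_mul ν
    refine ⟨fun s => Real.sinh (ν * s) / ν, fun s => Real.cosh (ν * s), ?_, fun s => ?_,
      fun s => ?_, by simp, by simp, fun s hs => ?_, fun s hs => ?_,
      ⟨(1 + 1 / Real.sinh ν) * ν, by positivity, fun s hs => ?_⟩, ?_⟩
    · exact (Real.contDiff_sinh.comp (by fun_prop)).div_const _
    · convert! ((hlin s).sinh.div_const ν) using 1
      field_simp
    · convert! (hlin s).cosh using 1
      field_simp
    · have : 0 < Real.sinh (ν * s) := Real.sinh_pos_iff.2 (by positivity)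
      positivity
    · have : Real.sinh (ν * 1) ≤ Real.sinh (ν * s) := Real.sinh_le_sinh.2 (by gcongr)
      exact (div_le_div_iff_of_pos_right hν).2 this
    · have h1 : Real.sinh ν ≤ Real.sinh (ν * s) := Real.sinh_le_sinh.2 (by nlinarith)
      have h2 : Real.cosh (ν * s) - Real.sinh (ν * s) = Real.exp (-(ν * s)) := Real.cosh_sub_sinh _
      have h3 : Real.exp (-(ν * s)) ≤ 1 := Real.exp_le_one_iff.2 (by nlinarith)
      have h4 : 1 ≤ 1 / Real.sinh ν * Real.sinh (ν * s) := by
        rw [one_div_mul_eq_div, le_div_iff₀ hs1]; linarith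
      rw [abs_of_pos (Real.cosh_pos _)]
      have h5 : (1 + 1 / Real.sinh ν) * ν * (Real.sinh (ν * s) / ν)
          = Real.sinh (ν * s) + 1 / Real.sinh ν * Real.sinh (ν * s) := by
        field_simp
      rw [h5]
      linarith
    · intro δ hδ _
      refine ⟨1 / ν, by positivity, fun s hs => ?_⟩
      have h1 : Real.sinh (ν * s) ≤ Real.exp (ν * s) := by
        rw [Real.sinh_eq]
        have := Real.exp_pos (-(ν * s))
        have := Real.exp_pos (ν * s)
        linarith
      have h2 : Real.exp (ν * s) ≤ Real.exp ((ν + δ) * s) := Real.exp_le_exp.2 (by nlinarith)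
      calc Real.sinh (ν * s) / ν = 1 / ν * Real.sinh (ν * s) := by ring
        _ ≤ _ := by gcongr; exact h1.trans h2

theorem deriv_eq_of_hasDerivAt {f f' : ℝ → ℝ} (h : ∀ s, HasDerivAt f (f' s) s) : deriv f = f' :=
  funext fun s => (h s).deriv

theorem emdenFowler_eq_zero_of_hasDerivAt {N : ℕ} {μ : ℝ} {h h₁ h₂ h₃ h₄ : ℝ → ℝ}
    (H₀ : ∀ s, HasDerivAt h (h₁ s) s) (H₁ : ∀ s, HasDerivAt h₁ (h₂ s) s)
    (H₂ : ∀ s, HasDerivAt h₂ (h₃ s) s) (H₃ : ∀ s, HasDerivAt h₃ (h₄ s) s) (s : ℝ) :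
    emdenFowler N μ h s = h₄ s - (2 * ((N : ℝ) * (N - 4) / 4) + 4) * h₂ s
      + (((N : ℝ) * (N - 4) / 4) ^ 2 - μ) * h s := by
  rw [emdenFowler, deriv_eq_of_hasDerivAt H₀, deriv_eq_of_hasDerivAt H₁, deriv_eq_of_hasDerivAt H₂,
    deriv_eq_of_hasDerivAt H₃]

theorem exists_power_bound {ν τ : ℝ} (hν : 0 ≤ ν) (hτ : 0 ≤ τ) : ∃ M : ℝ, 1 ≤ M ∧ ν + τ ≤ M ∧
    ν ^ 2 + τ ^ 2 ≤ M ∧ ν ^ 3 + τ ^ 3 ≤ M ∧ ν ^ 2 ≤ M := by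
  refine ⟨1 + (ν + τ) + (ν ^ 2 + τ ^ 2) + (ν ^ 3 + τ ^ 3), ?_, ?_, ?_, ?_, ?_⟩ <;>
  · have : 0 ≤ ν ^ 2 := by positivity
    have : 0 ≤ τ ^ 2 := by positivity
    have : 0 ≤ ν ^ 3 := by positivity
    have : 0 ≤ τ ^ 3 := by positivity
    linarith

/-- The positive solution of the homogeneous radial problem with Navier conditions, of maximal
growth among the slow modes. -/
theorem exists_harmonic_profile {N : ℕ} {μ ν τ : ℝ} (hν : 0 ≤ ν) (hντ : ν < τ) (hτ : 2 < τ)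
    (hsum : ν ^ 2 + τ ^ 2 = 2 * ((N : ℝ) * (N - 4) / 4) + 4)
    (hprod : ν ^ 2 * τ ^ 2 = ((N : ℝ) * (N - 4) / 4) ^ 2 - μ) :
    ∃ h : ℝ → ℝ, ContDiff ℝ ∞ h ∧ h 0 = 0 ∧ deriv (deriv h) 0 + 2 * deriv h 0 = 0 ∧
      (∀ s, emdenFowler N μ h s = 0) ∧ (∀ s, 0 < s → 0 < h s) ∧
      (∃ C : ℝ, 0 ≤ C ∧ ∀ s, 1 ≤ s → |deriv h s| ≤ C * h s ∧ |deriv (deriv h) s| ≤ C * h s ∧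
        |deriv (deriv (deriv h)) s| ≤ C * h s) ∧
      ∀ δ, 0 ≤ δ → (0 < δ ∨ 0 < ν) →
        ∃ C : ℝ, 0 ≤ C ∧ ∀ s, 0 ≤ s → h s ≤ C * Real.exp ((ν + δ) * s) := by
  obtain ⟨g, g', hg, hg1, hg2, hg0, hg0', hgpos, hgmono, ⟨C₁, hC₁, hgC⟩, hgrow⟩ :=
    exists_growing_solution hν
  -- The ansatz `A g + 2(e^{-νs} - e^{-τs})` vanishes at `0` for every `A`, and `h'' + 2h' = 0` at
  -- `0` forces this value. It is positive because `τ > 2`. The difference of exponentials is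
  -- nonnegative for `s ≥ 0`, so `h ≥ A g > 0` when `s > 0`.
  set A := (τ - ν) * (τ + ν - 2) with hAdef
  have hA : 0 < A := mul_pos (by linarith) (by linarith)
  set h : ℝ → ℝ := fun s => A * g s + 2 * (Real.exp (-ν * s) - Real.exp (-τ * s)) with hh
  set h₁ : ℝ → ℝ := fun s =>
    A * g' s + 2 * (-ν * Real.exp (-ν * s) - -τ * Real.exp (-τ * s)) with hh₁
  set h₂ : ℝ → ℝ := fun s =>
    A * (ν ^ 2 * g s) + 2 * (ν ^ 2 * Real.exp (-ν * s) - τ ^ 2 * Real.exp (-τ * s)) with hh₂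
  set h₃ : ℝ → ℝ := fun s => A * (ν ^ 2 * g' s)
    + 2 * (ν ^ 2 * (-ν * Real.exp (-ν * s)) - τ ^ 2 * (-τ * Real.exp (-τ * s))) with hh₃
  set h₄ : ℝ → ℝ := fun s => A * (ν ^ 2 * (ν ^ 2 * g s))
    + 2 * (ν ^ 2 * (ν ^ 2 * Real.exp (-ν * s)) - τ ^ 2 * (τ ^ 2 * Real.exp (-τ * s))) with hh₄
  have eν := hasDerivAt_exp_neg_mul ν
  have eτ := hasDerivAt_exp_neg_mul τ
  have H₀ : ∀ s, HasDerivAt h (h₁ s) s := fun s =>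
    ((hg1 s).const_mul A).add (((eν s).sub (eτ s)).const_mul 2)
  have H₁ : ∀ s, HasDerivAt h₁ (h₂ s) s := fun s => by
    convert! ((hg2 s).const_mul A).add
      ((((eν s).const_mul (-ν)).sub ((eτ s).const_mul (-τ))).const_mul 2) using 1
    simp only [hh₂]; ring
  have H₂ : ∀ s, HasDerivAt h₂ (h₃ s) s := fun s =>
    (((hg1 s).const_mul (ν ^ 2)).const_mul A).add
      ((((eν s).const_mul (ν ^ 2)).sub ((eτ s).const_mul (τ ^ 2))).const_mul 2)
  have H₃ : ∀ s, HasDerivAt h₃ (h₄ s) s := fun s => by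
    convert! (((hg2 s).const_mul (ν ^ 2)).const_mul A).add
      (((((eν s).const_mul (-ν)).const_mul (ν ^ 2)).sub
        (((eτ s).const_mul (-τ)).const_mul (τ ^ 2))).const_mul 2) using 1
    simp only [hh₄]; ring
  have hτ0 : 0 < τ := by linarith
  have hexp : ∀ a s : ℝ, 0 ≤ a → 0 ≤ s → Real.exp (-a * s) ≤ 1 := fun a s ha hs =>
    Real.exp_le_one_iff.2 (by nlinarith)
  have hpos : ∀ s, 0 ≤ s → A * g s ≤ h s := fun s hs => by
    have : Real.exp (-τ * s) ≤ Real.exp (-ν * s) := Real.exp_le_exp.2 (by nlinarith)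
    simp only [hh]; linarith
  refine ⟨h, ?_, ?_, ?_, ?_, ?_, ?_, ?_⟩
  · fun_prop
  · simp [hh, hg0]
  · rw [deriv_eq_of_hasDerivAt H₀, deriv_eq_of_hasDerivAt H₁]
    simp only [hh₁, hh₂, hg0, hg0', mul_zero, Real.exp_zero, hAdef]
    ring
  · intro s
    rw [emdenFowler_eq_zero_of_hasDerivAt H₀ H₁ H₂ H₃, ← hsum, ← hprod]
    simp only [hh, hh₂, hh₄]
    ring
  · exact fun s hs => (mul_pos hA (hgpos s hs)).trans_le (hpos s hs.le)
  · rw [deriv_eq_of_hasDerivAt H₀, deriv_eq_of_hasDerivAt H₁, deriv_eq_of_hasDerivAt H₂]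
    have hg1' : 0 < A * g 1 := mul_pos hA (hgpos 1 one_pos)
    obtain ⟨M, hM1', hM1, hM2, hM3, hM4⟩ := exists_power_bound hν hτ0.le
    have hM0 : 0 < M := by linarith
    -- The decaying exponentials contribute at most `2M` to each derivative. Since `h ≥ A g(1)` for
    -- `s ≥ 1`, this constant is at most `c h`.
    obtain ⟨c, hc0, hcdef⟩ : ∃ c, 0 < c ∧ c * (A * g 1) = 2 * M :=
      ⟨2 * M / (A * g 1), by positivity, div_mul_cancel₀ _ hg1'.ne'⟩
    have hbase : ∀ s, 1 ≤ s → 2 * M ≤ c * h s := fun s hs => by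
      have h1 : A * g 1 ≤ h s :=
        (mul_le_mul_of_nonneg_left (hgmono s hs) hA.le).trans (hpos s (by linarith))
      calc 2 * M = c * (A * g 1) := hcdef.symm
        _ ≤ c * h s := by gcongr
    have hgs : ∀ s, 1 ≤ s → 0 < g s := fun s hs => hgpos s (by linarith)
    refine ⟨M * (1 + C₁) + c, by positivity, fun s hs => ?_⟩
    have hs0 : 0 ≤ s := by linarith
    have e1 := hexp ν s hν hs0
    have e2 := hexp τ s hτ0.le hs0
    have e1' := Real.exp_pos (-ν * s)
    have e2' := Real.exp_pos (-τ * s)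
    have hAg : 0 < A * g s := mul_pos hA (hgs s hs)
    have hhs := hpos s hs0
    have key : ∀ a b : ℝ, |b| ≤ 2 * M → |a| ≤ M * (1 + C₁) * (A * g s) →
        |a + b| ≤ (M * (1 + C₁) + c) * h s := by
      intro a b hb' ha
      calc |a + b| ≤ |a| + |b| := abs_add_le _ _
        _ ≤ M * (1 + C₁) * (A * g s) + 2 * M := add_le_add ha hb'
        _ ≤ M * (1 + C₁) * h s + c * h s := 
            add_le_add (by gcongr) (hbase s hs)
        _ = _ := by ring
    have hexpb : ∀ a b : ℝ, 0 ≤ a → 0 ≤ b → a + b ≤ M →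
        |2 * (a * Real.exp (-ν * s) - b * Real.exp (-τ * s))| ≤ 2 * M := by
      intro a b ha hb' hab
      have h1 : a * Real.exp (-ν * s) ≤ a := mul_le_of_le_one_right ha e1
      have h2 : b * Real.exp (-τ * s) ≤ b := mul_le_of_le_one_right hb' e2
      have h3 : 0 ≤ a * Real.exp (-ν * s) := by positivity
      have h4 : 0 ≤ b * Real.exp (-τ * s) := by positivity
      rw [abs_le]
      constructor <;> linarith
    have hg's : |A * g' s| ≤ C₁ * (A * g s) := by
      rw [abs_mul, abs_of_pos hA]
      calc A * |g' s| ≤ A * (C₁ * g s) := by gcongr; exact hgC s hs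
        _ = _ := by ring
    refine ⟨?_, ?_, ?_⟩
    · refine key _ _ ?_ (hg's.trans ?_)
      · have := hexpb ν τ hν hτ0.le hM1
        rw [← abs_neg]
        convert this using 2
        ring
      · exact mul_le_mul_of_nonneg_right (by nlinarith) hAg.le
    · refine key _ _ (hexpb _ _ (sq_nonneg _) (sq_nonneg _) hM2) ?_
      rw [abs_of_nonneg (by have := hgs s hs; positivity)]
      calc A * (ν ^ 2 * g s) = ν ^ 2 * (A * g s) := by ring
        _ ≤ M * (1 + C₁) * (A * g s) :=
            mul_le_mul_of_nonneg_right (by nlinarith) hAg.le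
    · refine key _ _ ?_ ?_
      · have := hexpb (ν ^ 3) (τ ^ 3) (by positivity) (by positivity) hM3
        rw [← abs_neg]
        convert this using 2
        ring
      · calc |A * (ν ^ 2 * g' s)| = ν ^ 2 * |A * g' s| := by
              rw [mul_left_comm, abs_mul, abs_of_nonneg (sq_nonneg ν)]
          _ ≤ M * (C₁ * (A * g s)) := by gcongr
          _ ≤ M * (1 + C₁) * (A * g s) := by
              have : 0 ≤ M * (A * g s) := by positivity
              linarith
  · intro δ hδ hor
    obtain ⟨C, hC, hgr⟩ := hgrow δ hδ hor
    refine ⟨A * C + 2, by positivity, fun s hs => ?_⟩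
    have h1 : 1 ≤ Real.exp ((ν + δ) * s) := Real.one_le_exp (by positivity)
    have h2 := hexp ν s hν hs
    have h3 := Real.exp_pos (-τ * s)
    have h4 := mul_le_mul_of_nonneg_left (hgr s hs) hA.le
    simp only [hh]
    linarith

/-! ### Logarithmic truncation. -/

/-- The Leibniz rule, arranged to isolate the only term in which `c` is not differentiated. That
term vanishes when `h` is a homogeneous solution. -/
theorem emdenFowler_mul {N : ℕ} {μ : ℝ} {h c : ℝ → ℝ} (hh : ContDiff ℝ ∞ h) (hc : ContDiff ℝ ∞ c)
    (s : ℝ) : emdenFowler N μ (fun s => h s * c s) s = emdenFowler N μ h s * c s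
      + (4 * (deriv (deriv (deriv h)) s * deriv c s) + 6 * (deriv (deriv h) s * deriv (deriv c) s)
      + 4 * (deriv h s * deriv (deriv (deriv c)) s) + h s * deriv (deriv (deriv (deriv c))) s)
      - (2 * ((N : ℝ) * (N - 4) / 4) + 4) * (2 * (deriv h s * deriv c s)
        + h s * deriv (deriv c) s) := by
  have hh1 := contDiff_deriv_infty hh
  have hh2 := contDiff_deriv_infty hh1
  have hh3 := contDiff_deriv_infty hh2
  have hc1 := contDiff_deriv_infty hc
  have hc2 := contDiff_deriv_infty hc1
  have hc3 := contDiff_deriv_infty hc2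
  have D : ∀ {a b : ℝ → ℝ}, ContDiff ℝ ∞ a → ContDiff ℝ ∞ b → ∀ s,
      HasDerivAt (fun s => a s * b s) (deriv a s * b s + a s * deriv b s) s := fun ha hb s =>
    (hasDerivAt_of_contDiff_infty ha s).mul (hasDerivAt_of_contDiff_infty hb s)
  have H₁ : ∀ s, HasDerivAt (fun s => deriv h s * c s + h s * deriv c s)
      (deriv (deriv h) s * c s + 2 * (deriv h s * deriv c s) + h s * deriv (deriv c) s) s :=
    fun s => by
      convert! (D hh1 hc s).add (D hh hc1 s) using 1
      ring
  have H₂ : ∀ s, HasDerivAt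
      (fun s => deriv (deriv h) s * c s + 2 * (deriv h s * deriv c s) + h s * deriv (deriv c) s)
      (deriv (deriv (deriv h)) s * c s + 3 * (deriv (deriv h) s * deriv c s)
        + 3 * (deriv h s * deriv (deriv c) s) + h s * deriv (deriv (deriv c)) s) s :=
    fun s => by
      convert! ((D hh2 hc s).add ((D hh1 hc1 s).const_mul 2)).add (D hh hc2 s) using 1
      ring
  have H₃ : ∀ s, HasDerivAt
      (fun s => deriv (deriv (deriv h)) s * c s + 3 * (deriv (deriv h) s * deriv c s)
        + 3 * (deriv h s * deriv (deriv c) s) + h s * deriv (deriv (deriv c)) s)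
      (deriv (deriv (deriv (deriv h))) s * c s + 4 * (deriv (deriv (deriv h)) s * deriv c s)
        + 6 * (deriv (deriv h) s * deriv (deriv c) s)
        + 4 * (deriv h s * deriv (deriv (deriv c)) s) + h s * deriv (deriv (deriv (deriv c))) s) s :=
    fun s => by
      convert! (((D hh3 hc s).add ((D hh2 hc1 s).const_mul 3)).add ((D hh1 hc2 s).const_mul 3)).add
        (D hh hc3 s) using 1
      ring
  rw [emdenFowler_eq_zero_of_hasDerivAt (D hh hc) H₁ H₂ H₃, emdenFowler]
  ring

theorem deriv_comp_inv_mul (f : ℝ → ℝ) (a S : ℝ) :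
    deriv (fun s => a * f (S⁻¹ * s)) = fun s => a * S⁻¹ * deriv f (S⁻¹ * s) := by
  ext s
  rw [deriv_const_mul_field, deriv_comp_mul_left, smul_eq_mul, mul_assoc]

/-- Cutting off a radial solution at logarithmic scale `S` costs only a factor `1/S`. -/
theorem exists_truncation_bound {N : ℕ} {μ p : ℝ} {h χ : ℝ → ℝ} (hh : ContDiff ℝ ∞ h)
    (hP : ∀ s, emdenFowler N μ h s = 0) (hpos : ∀ s, 0 < s → 0 < h s)
    (hC : ∃ C : ℝ, 0 ≤ C ∧ ∀ s, 1 ≤ s → |deriv h s| ≤ C * h s ∧ |deriv (deriv h) s| ≤ C * h s ∧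
        |deriv (deriv (deriv h)) s| ≤ C * h s)
    (hχ : ContDiff ℝ ∞ χ) (hχ0 : ∀ s, 0 ≤ χ s) (hχ1 : ∀ s ≤ 1, χ s = 1)
    (hχC : ∃ C : ℝ, 0 ≤ C ∧ ∀ k < 4, ∀ s, |deriv^[k + 1] χ s| ≤ C * χ s ^ (1 / p)) :
    ∃ C : ℝ, 0 ≤ C ∧ ∀ S, 1 ≤ S →
      (∀ s < S, emdenFowler N μ (fun s => h s * χ (S⁻¹ * s)) s = 0) ∧
      ∀ s, S ≤ s → |emdenFowler N μ (fun s => h s * χ (S⁻¹ * s)) s|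
        ≤ C / S * (h s * χ (S⁻¹ * s) ^ (1 / p)) := by
  obtain ⟨C, hC0, hC⟩ := hC
  obtain ⟨K, hK0, hK⟩ := hχC
  set d := |2 * ((N : ℝ) * (N - 4) / 4) + 4| with hd
  refine ⟨K * (14 * C + 1 + d * (2 * C + 1)), by positivity, fun S hS => ⟨fun s hs => ?_,
    fun s hs => ?_⟩⟩
  · have hS0 : 0 < S := by linarith
    have hev : (fun s => h s * χ (S⁻¹ * s)) =ᶠ[𝓝 s] h := by
      filter_upwards [Iio_mem_nhds hs] with y hy
      rw [hχ1 _ (by rw [inv_mul_le_iff₀ hS0]; linarith [mem_Iio.1 hy]), mul_one]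
    have h2 := hev.deriv.deriv
    rw [← hP s, emdenFowler, emdenFowler, h2.self_of_nhds, h2.deriv.deriv.self_of_nhds,
      show h s * χ (S⁻¹ * s) = h s from hev.self_of_nhds]
  · have hS0 : 0 < S := by linarith
    set c : ℝ → ℝ := fun s => χ (S⁻¹ * s) with hc
    have hcs : ContDiff ℝ ∞ c := by fun_prop
    have d1 : deriv c = fun s => S⁻¹ * deriv χ (S⁻¹ * s) := by
      simpa using deriv_comp_inv_mul χ 1 S
    have d2 : deriv (deriv c) = fun s => S⁻¹ * S⁻¹ * deriv (deriv χ) (S⁻¹ * s) := by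
      rw [d1, deriv_comp_inv_mul]
    have d3 : deriv (deriv (deriv c))
        = fun s => S⁻¹ * S⁻¹ * S⁻¹ * deriv (deriv (deriv χ)) (S⁻¹ * s) := by
      rw [d2, deriv_comp_inv_mul]
    have d4 : deriv (deriv (deriv (deriv c)))
        = fun s => S⁻¹ * S⁻¹ * S⁻¹ * S⁻¹ * deriv (deriv (deriv (deriv χ))) (S⁻¹ * s) := by
      rw [d3, deriv_comp_inv_mul]
    have hi0 : 0 < S⁻¹ := by positivity
    have hi1 : S⁻¹ ≤ 1 := inv_le_one_of_one_le₀ hS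
    set X := χ (S⁻¹ * s) ^ (1 / p) with hX
    have hX0 : 0 ≤ X := Real.rpow_nonneg (hχ0 _) _
    -- The `k`-th derivative of the rescaled cutoff carries `S⁻ᵏ`. As `S ≥ 1`, keeping a single
    -- factor `S⁻¹` suffices; `a` collects the others.
    have hbd : ∀ a y : ℝ, 0 ≤ a → a ≤ 1 → |y| ≤ K * X → |a * S⁻¹ * y| ≤ S⁻¹ * (K * X) := by
      intro a y ha ha1 hy
      rw [abs_mul, abs_mul, abs_of_nonneg ha, abs_of_pos hi0]
      have : a * S⁻¹ ≤ S⁻¹ := mul_le_of_le_one_left hi0.le ha1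
      gcongr
    have b1 : |deriv c s| ≤ S⁻¹ * (K * X) := by
      rw [d1]
      simpa using hbd 1 _ zero_le_one le_rfl (hK 0 (by norm_num) (S⁻¹ * s))
    have b2 : |deriv (deriv c) s| ≤ S⁻¹ * (K * X) := by
      rw [d2]
      exact hbd _ _ hi0.le hi1 (hK 1 (by norm_num) (S⁻¹ * s))
    have b3 : |deriv (deriv (deriv c)) s| ≤ S⁻¹ * (K * X) := by
      rw [d3]
      exact hbd _ _ (by positivity) (mul_le_one₀ hi1 hi0.le hi1)
        (hK 2 (by norm_num) (S⁻¹ * s))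
    have b4 : |deriv (deriv (deriv (deriv c))) s| ≤ S⁻¹ * (K * X) := by
      rw [d4]
      exact hbd _ _ (by positivity)
        (mul_le_one₀ (mul_le_one₀ hi1 hi0.le hi1) hi0.le hi1) (hK 3 (by norm_num) (S⁻¹ * s))
    obtain ⟨a1, a2, a3⟩ := hC s (hS.trans hs)
    have hs0 : 0 < h s := hpos s (by linarith)
    set Z := S⁻¹ * (K * X) with hZ
    have hZ0 : 0 ≤ Z := by positivity
    have prod : ∀ {a b : ℝ}, |a| ≤ C * h s → |b| ≤ Z → |a * b| ≤ C * h s * Z := fun ha hb => by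
      rw [abs_mul]
      exact mul_le_mul ha hb (abs_nonneg _) (by positivity)
    have p0 : ∀ {b : ℝ}, |b| ≤ Z → |h s * b| ≤ h s * Z := fun hb => by
      rw [abs_mul, abs_of_pos hs0]
      gcongr
    have t1 := prod a3 b1
    have t2 := prod a2 b2
    have t3 := prod a1 b3
    have t4 := p0 b4
    have t5 := prod a1 b1
    have t6 := p0 b2
    rw [emdenFowler_mul hh hcs, hP, zero_mul, zero_add]
    -- The constant `14 = 4 + 6 + 4` counts the binomial terms containing a derivative of `h`.
    have q1 : |4 * (deriv (deriv (deriv h)) s * deriv c s)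
        + 6 * (deriv (deriv h) s * deriv (deriv c) s)
        + 4 * (deriv h s * deriv (deriv (deriv c)) s) + h s * deriv (deriv (deriv (deriv c))) s|
        ≤ 14 * (C * h s * Z) + h s * Z := by
      rw [abs_le] at t1 t2 t3 t4 ⊢
      constructor <;> linarith
    have q2 : |2 * (deriv h s * deriv c s) + h s * deriv (deriv c) s|
        ≤ 2 * (C * h s * Z) + h s * Z := by
      rw [abs_le] at t5 t6 ⊢
      constructor <;> linarith
    have q3 : |(2 * ((N : ℝ) * (N - 4) / 4) + 4) * (2 * (deriv h s * deriv c s)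
        + h s * deriv (deriv c) s)| ≤ d * (2 * (C * h s * Z) + h s * Z) := by
      rw [abs_mul]
      gcongr
    refine (abs_sub _ _).trans ((add_le_add q1 q3).trans (le_of_eq ?_))
    rw [hZ]
    field_simp

/-! ### Scale estimate and nonexistence. -/

theorem nontrivial_euclidean {N : ℕ} (hN : 5 ≤ N) : Nontrivial (EuclideanSpace ℝ (Fin N)) := by
  have : Nonempty (Fin N) := ⟨⟨0, by lia⟩⟩
  infer_instance

/-- The shell `e ^ S ≤ ‖x‖ ≤ e ^ (2S)`, as an indicator in the radial variable. -/
def shellWeight (N : ℕ) (S : ℝ) : ℝ → ℝ :=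
  (Icc (Real.exp S) (Real.exp (2 * S))).indicator fun y => (y ^ N)⁻¹

/-- In polar coordinates `‖x‖ ^ (-N)` becomes the logarithmic measure `dy/y`, for which the shell
has length `S`. The prefactor is the area of the unit sphere. -/
theorem radial_shellWeight {N : ℕ} (hN : 5 ≤ N) {S : ℝ} (hS : 0 ≤ S) :
    Integrable (fun x : EuclideanSpace ℝ (Fin N) => shellWeight N S ‖x‖) ∧
    ∫ x : EuclideanSpace ℝ (Fin N), shellWeight N S ‖x‖
      = (N * (volume : Measure (EuclideanSpace ℝ (Fin N))).real (Metric.ball 0 1)) * S := by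
  have := nontrivial_euclidean hN
  have hdim : Module.finrank ℝ (EuclideanSpace ℝ (Fin N)) = N := by simp
  have he : Real.exp S ≤ Real.exp (2 * S) := Real.exp_le_exp.2 (by linarith)
  have hpos : ∀ y ∈ Icc (Real.exp S) (Real.exp (2 * S)), 0 < y := fun y hy =>
    (Real.exp_pos S).trans_le hy.1
  have heq : ∀ y : ℝ, y ^ (N - 1) * shellWeight N S y
      = (Icc (Real.exp S) (Real.exp (2 * S))).indicator (fun y => y⁻¹) y := by
    intro y
    by_cases hy : y ∈ Icc (Real.exp S) (Real.exp (2 * S))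
    · rw [shellWeight, indicator_of_mem hy, indicator_of_mem hy]
      have h0 := (hpos y hy).ne'
      obtain ⟨n, rfl⟩ : ∃ n, N = n + 1 := ⟨N - 1, by lia⟩
      rw [add_tsub_cancel_right, pow_succ]
      field_simp
    · rw [shellWeight, indicator_of_notMem hy, indicator_of_notMem hy, mul_zero]
  have hcont : IntegrableOn (fun y : ℝ => y⁻¹) (Icc (Real.exp S) (Real.exp (2 * S))) :=
    (continuousOn_id.inv₀ fun y hy => (hpos y hy).ne').integrableOn_compact isCompact_Icc
  constructor
  · rw [integrable_fun_norm_addHaar, hdim]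
    simp only [smul_eq_mul, heq]
    exact (hcont.integrable_indicator measurableSet_Icc).integrableOn
  · rw [integral_fun_norm_addHaar, hdim]
    simp only [smul_eq_mul, heq, nsmul_eq_mul]
    have hI : Icc (Real.exp S) (Real.exp (2 * S)) ⊆ Ioi 0 := fun y hy => hpos y hy
    rw [setIntegral_indicator measurableSet_Icc, inter_eq_right.2 hI, integral_Icc_eq_integral_Ioc,
      ← intervalIntegral.integral_of_le he, integral_inv_of_pos (Real.exp_pos _) (Real.exp_pos _),
      Real.log_div (Real.exp_pos _).ne' (Real.exp_pos _).ne', Real.log_exp, Real.log_exp]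
    ring

theorem extClosed_ae_eq_extDomain {N : ℕ} (hN : 5 ≤ N) :
    (extClosed N : Set (EuclideanSpace ℝ (Fin N))) =ᵐ[volume] extDomain N := by
  have := nontrivial_euclidean hN
  have h0 : volume (Metric.sphere (0 : EuclideanSpace ℝ (Fin N)) 1) = 0 :=
    Measure.addHaar_sphere _ _ _
  have : extClosed N = extDomain N ∪ Metric.sphere 0 1 := by
    ext x
    simp only [extClosed, extDomain, mem_union, mem_sphere_zero_iff_norm, mem_ofPred_eq]
    rw [le_iff_lt_or_eq, eq_comm (a := (1 : ℝ))]
  rw [this]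
  exact union_ae_eq_left_of_ae_eq_empty (ae_eq_empty.2 h0)

theorem rpow_one_div_mul_rpow_one_div {p q : ℝ} (hpq : p.HolderConjugate q) {V : ℝ} (hV : 0 ≤ V) :
    V ^ (1 / p) * V ^ (1 / q) = V := by
  have := hpq.inv_add_inv_eq_one
  rw [← Real.rpow_add_of_nonneg hV (by have := hpq.pos; positivity)
    (by have := hpq.symm.pos; positivity), one_div, one_div, this, Real.rpow_one]

theorem le_rpow_one_div {p : ℝ} (hp : 1 < p) {V : ℝ} (h0 : 0 ≤ V) (h1 : V ≤ 1) :
    V ≤ V ^ (1 / p) := by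
  rcases h0.eq_or_lt with rfl | h
  · positivity
  · calc V = V ^ (1 : ℝ) := (Real.rpow_one V).symm
      _ ≤ V ^ (1 / p) := Real.rpow_le_rpow_of_exponent_ge h h1
        ((div_le_one (by linarith)).2 hp.le)

/-- The powers of `‖x‖` in the space error come from the operator, `-4q`, from the dual weight,
`-σq/p`, and from the test profile. With growth rate `ν + δ` they sum to the borderline power `-n`.
-/
theorem holder_exponent_identity {p q : ℝ} (hpq : p.HolderConjugate q) (σ ν n : ℝ) :
    -4 * q + -(σ * (q / p)) + (-((n - 4) / 2) + (ν + ((σ + 4) / (p - 1) - (n - 4) / 2 - ν)))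
      = -n := by
  have h1 : p - 1 ≠ 0 := hpq.sub_one_ne_zero
  have h2 := hpq.conjugate_eq
  have h3 : p ≠ 0 := hpq.pos.ne'
  rw [h2]
  field_simp
  ring

theorem emdenLift_nonneg {N : ℕ} {m : ℝ → ℝ} (hm : ∀ s, 0 ≤ s → 0 ≤ m s)
    {x : EuclideanSpace ℝ (Fin N)} (hx : x ∈ extClosed N) : 0 ≤ emdenLift N m x :=
  mul_nonneg (Real.exp_pos _).le (hm _ (log_norm_nonneg hx))

theorem ae_extClosed_of_ae_extDomain {N : ℕ} (hN : 5 ≤ N)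
    {P : EuclideanSpace ℝ (Fin N) → Prop} (h : ∀ᵐ x ∂(volume.restrict (extDomain N)), P x) :
    ∀ᵐ x ∂(volume.restrict (extClosed N)), P x := by
  rwa [Measure.restrict_congr_set (extClosed_ae_eq_extDomain hN)]

/-- This is the fixed positive quantity, independent of `S` and `T`, that contradicts the vanishing
errors. -/
theorem setIntegral_shell_pos {N : ℕ} (hN : 5 ≤ N) {f : EuclideanSpace ℝ (Fin N) → ℝ}
    (hf : LocallyIntegrableOn f (extClosed N))
    (hfpos : ∀ᵐ x ∂(volume.restrict (extDomain N)), 0 < f x) {h : ℝ → ℝ} (hh : Continuous h)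
    (hpos : ∀ s, 0 < s → 0 < h s) : 0 < ∫ x in shell N 1, f x * emdenLift N h x := by
  have := nontrivial_euclidean hN
  have hint : IntegrableOn (fun x => f x * emdenLift N h x) (shell N 1) :=
    (hf.integrableOn_compact_subset shell_subset (isCompact_shell N 1)).mul_continuousOn
      ((continuousOn_emdenLift hh).mono shell_subset) (isCompact_shell N 1)
  have hH : ∀ x ∈ extDomain N, 0 < emdenLift N h x := fun x (hx : 1 < ‖x‖) =>
    mul_pos (Real.exp_pos _) (hpos _ (Real.log_pos hx))
  have hpos' : ∀ᵐ x ∂(volume.restrict (extDomain N)), 0 < f x * emdenLift N h x := by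
    filter_upwards [hfpos, ae_restrict_mem (isOpen_extDomain N).measurableSet] with x h1 h2
    exact mul_pos h1 (hH x h2)
  have hpos'' : ∀ᵐ x ∂(volume.restrict (shell N 1)), 0 < f x * emdenLift N h x :=
    ae_restrict_of_ae_restrict_of_subset shell_subset (ae_extClosed_of_ae_extDomain hN hpos')
  refine (integral_pos_iff_support_of_nonneg_ae (hpos''.mono fun x hx => hx.le) hint).2 ?_
  have hsup : (volume.restrict (shell N 1)) (Function.support fun x => f x * emdenLift N h x)ᶜ = 0 := by
    rw [← mem_ae_iff]
    filter_upwards [hpos''] with x hx using hx.ne'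
  rw [measure_of_measure_compl_eq_zero hsup, Measure.restrict_apply_univ]
  set O : Set (EuclideanSpace ℝ (Fin N)) := extDomain N ∩ Metric.ball 0 (Real.exp 1) with hO
  have hOopen : IsOpen O := (isOpen_extDomain N).inter Metric.isOpen_ball
  have hOsub : O ⊆ shell N 1 := fun x hx => by
    refine ⟨extDomain_subset_extClosed N hx.1, ?_⟩
    have h1 : 0 < ‖x‖ := zero_lt_one.trans (show 1 < ‖x‖ from hx.1)
    exact (Real.log_le_iff_le_exp h1).2 (mem_ball_zero_iff.1 hx.2).le
  -- A vector of norm `2` then lies in the open set `O`, which therefore has positive measure.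
  have he : 2 < Real.exp 1 := lt_trans (by norm_num) Real.exp_one_gt_d9
  obtain ⟨x, hx⟩ := NormedSpace.exists_lt_norm ℝ (EuclideanSpace ℝ (Fin N)) 0
  have hOne : O.Nonempty := by
    refine ⟨(2 / ‖x‖) • x, ?_⟩
    have hn : ‖(2 / ‖x‖) • x‖ = 2 := by
      rw [norm_smul, Real.norm_of_nonneg (by positivity), div_mul_cancel₀ _ hx.ne']
    refine ⟨?_, ?_⟩
    · change 1 < ‖(2 / ‖x‖) • x‖
      rw [hn]; norm_num
    · rw [mem_ball_zero_iff, hn]; exact he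
  exact (hOopen.measure_pos volume hOne).trans_le (measure_mono hOsub)

/-- The estimate obtained by testing at time scale `T` and logarithmic space scale `S`. -/
theorem weakSolution_scale_bound {N : ℕ} (hN : 5 ≤ N) {μ σ p q ν : ℝ} (hpq : p.HolderConjugate q)
    {f : EuclideanSpace ℝ (Fin N) → ℝ} (hf : LocallyIntegrableOn f (extClosed N))
    (hfpos : ∀ᵐ x ∂(volume.restrict (extDomain N)), 0 < f x)
    {u : ℝ × EuclideanSpace ℝ (Fin N) → ℝ} (hu : IsWeakSolution N μ σ p f u)
    {h : ℝ → ℝ} (hh : ContDiff ℝ ∞ h) (hh0 : h 0 = 0)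
    (hhn : deriv (deriv h) 0 + 2 * deriv h 0 = 0) (hP : ∀ s, emdenFowler N μ h s = 0)
    (hpos : ∀ s, 0 < s → 0 < h s)
    (hC : ∃ C : ℝ, 0 ≤ C ∧ ∀ s, 1 ≤ s → |deriv h s| ≤ C * h s ∧ |deriv (deriv h) s| ≤ C * h s ∧
        |deriv (deriv (deriv h)) s| ≤ C * h s)
    (hgrow : ∃ C : ℝ, 0 ≤ C ∧ ∀ s, 0 ≤ s →
      h s ≤ C * Real.exp ((ν + ((σ + 4) / (p - 1) - ((N : ℝ) - 4) / 2 - ν)) * s)) :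
    ∃ a b : ℝ, 0 ≤ a ∧ 0 ≤ b ∧ ∃ J : ℝ → ℝ, ∀ S, 1 ≤ S → ∀ T, 0 < T →
      (∫ x in shell N 1, f x * emdenLift N h x) ≤ (a / T) ^ q * J S + b * ((1 / S) ^ q * S) := by
  have hp1 : 1 < p := hpq.lt
  have hq0 : 0 < q := hpq.symm.pos
  obtain ⟨χ, hχ, hχ0, hχ1, hχone, hχzero, hχC⟩ := exists_space_cutoff hp1
  obtain ⟨η, hη, hη0, hη1, hηs, hηint, Cη, hCη0, hCη⟩ := exists_time_cutoff hp1
  obtain ⟨C, hC0, hCP⟩ := exists_truncation_bound (p := p) hh hP hpos hC hχ hχ0 hχone hχC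
  obtain ⟨Ch, hCh0, hCh⟩ := hgrow
  have hnn : ∀ s, 0 ≤ s → 0 ≤ h s := fun s hs => by
    rcases hs.eq_or_lt with rfl | hs
    · exact hh0.ge
    · exact (hpos s hs).le
  set Iη := ∫ t, η t with hIη
  set κ := -(((N : ℝ) - 4) / 2) with hκ
  set δ := (σ + 4) / (p - 1) - ((N : ℝ) - 4) / 2 - ν with hδ
  set cN := N * (volume : Measure (EuclideanSpace ℝ (Fin N))).real (Metric.ball 0 1) with hcN
  set V : ℝ → EuclideanSpace ℝ (Fin N) → ℝ := fun S => emdenLift N fun s => h s * χ (S⁻¹ * s)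
    with hV
  -- No bound on the growth of `J₀` in `S` is needed: `T` goes to infinity while `S` is fixed.
  set J₀ : ℝ → ℝ := fun S => ∫ x in extClosed N, (‖x‖ ^ σ) ^ (-(q / p)) * V S x with hJ₀
  refine ⟨2 * Cη, 2 * ((2 * C) ^ q * Ch * cN) / Iη, by positivity, by positivity,
    fun S => 2 / Iη * J₀ S, fun S hS T hT => ?_⟩
  have hS0 : 0 < S := by linarith
  set m : ℝ → ℝ := fun s => h s * χ (S⁻¹ * s) with hm
  have hms : ContDiff ℝ ∞ m := by fun_prop
  have hm0 : ∀ s, 0 ≤ s → 0 ≤ m s := fun s hs => mul_nonneg (hnn s hs) (hχ0 _)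
  have hmR : ∀ s, 2 * S ≤ s → m s = 0 := fun s hs => by
    simp only [hm]
    rw [hχzero _ (by rw [le_inv_mul_iff₀ hS0]; linarith), mul_zero]
  have hmev : m =ᶠ[𝓝 0] h := by
    filter_upwards [Iio_mem_nhds hS0] with s hs
    simp only [hm]
    rw [hχone _ (by rw [inv_mul_le_iff₀ hS0]; linarith [mem_Iio.1 hs]), mul_one]
  have hVnn : ∀ x ∈ extClosed N, 0 ≤ emdenLift N m x := fun x hx => emdenLift_nonneg hm0 hx
  have hηT : ContDiff ℝ ∞ (fun t => η (T⁻¹ * t)) := by fun_prop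
  have hηTs : tsupport (fun t => η (T⁻¹ * t)) ⊆ Icc T (3 * T) := by
    refine closure_minimal (fun t ht => ?_) isClosed_Icc
    have h1 : T⁻¹ * t ∈ Icc (1 : ℝ) 3 := hηs (subset_tsupport η ht)
    obtain ⟨h2, h3⟩ := h1
    rw [le_inv_mul_iff₀ hT] at h2
    rw [inv_mul_le_iff₀ hT] at h3
    constructor <;> linarith
  have hηTint : ∫ t, η (T⁻¹ * t) = T * Iη := by
    rw [Measure.integral_comp_mul_left, inv_inv, abs_of_pos hT, smul_eq_mul]
  have hηTd : ∀ t, deriv (fun t => η (T⁻¹ * t)) t = T⁻¹ * deriv η (T⁻¹ * t) := fun t => by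
    have := congrFun (deriv_comp_inv_mul η 1 T) t
    simpa using this
  -- `G₂` majorises the weighted profile `‖x‖ ^ (-(N-4)/2) h` on the shell `S ≤ s ≤ 2S`, where the
  -- operator applied to the truncated profile is supported.
  set G₂ : EuclideanSpace ℝ (Fin N) → ℝ := fun x =>
    {x : EuclideanSpace ℝ (Fin N) | ‖x‖ ∈ Icc (Real.exp S) (Real.exp (2 * S))}.indicator
      (fun x => Ch * Real.exp ((κ + (ν + δ)) * Real.log ‖x‖)) x with hG₂
  set c₂ : EuclideanSpace ℝ (Fin N) → ℝ := fun x => C / S * Real.exp (-4 * Real.log ‖x‖) with hc₂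
  have hmem : ∀ x ∈ extClosed N, ‖x‖ ∈ Icc (Real.exp S) (Real.exp (2 * S)) ↔
      S ≤ Real.log ‖x‖ ∧ Real.log ‖x‖ ≤ 2 * S := fun x hx => by
    have hx0 := norm_pos_iff.2 (ne_zero_of_mem_extClosed hx)
    rw [mem_Icc, Real.le_log_iff_exp_le hx0, Real.log_le_iff_le_exp hx0]
  have hI₂eq : ∀ x ∈ extClosed N, (2 * c₂ x) ^ q * (‖x‖ ^ σ) ^ (-(q / p)) * G₂ x
      = (2 * C / S) ^ q * Ch * shellWeight N S ‖x‖ := by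
    intro x hx
    have hx0 := norm_pos_iff.2 (ne_zero_of_mem_extClosed hx)
    by_cases hmx : ‖x‖ ∈ Icc (Real.exp S) (Real.exp (2 * S))
    · simp only [hG₂]
      rw [indicator_of_mem (by exact hmx), shellWeight, indicator_of_mem hmx]
      have e1 : (2 * c₂ x) ^ q = (2 * C / S) ^ q * Real.exp ((-4 * q) * Real.log ‖x‖) := by
        rw [hc₂, show 2 * (C / S * Real.exp (-4 * Real.log ‖x‖))
          = 2 * C / S * Real.exp (-4 * Real.log ‖x‖) by ring,
          Real.mul_rpow (by positivity) (by positivity), ← Real.exp_mul]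
        ring_nf
      have e2 : (‖x‖ ^ σ) ^ (-(q / p)) = Real.exp (-(σ * (q / p)) * Real.log ‖x‖) := by
        rw [← Real.rpow_mul hx0.le, exp_mul_log_norm (ne_zero_of_mem_extClosed hx)]
        ring_nf
      have e3 : (‖x‖ ^ N)⁻¹ = Real.exp (-(N : ℝ) * Real.log ‖x‖) := by
        rw [exp_mul_log_norm (ne_zero_of_mem_extClosed hx), Real.rpow_neg hx0.le,
          Real.rpow_natCast]
      have e4 : Real.exp (-(N : ℝ) * Real.log ‖x‖) = Real.exp ((-4 * q) * Real.log ‖x‖)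
          * Real.exp (-(σ * (q / p)) * Real.log ‖x‖)
          * Real.exp ((κ + (ν + δ)) * Real.log ‖x‖) := by
        rw [← Real.exp_add, ← Real.exp_add]
        congr 1
        rw [hκ, hδ]
        linear_combination (-Real.log ‖x‖) * holder_exponent_identity hpq σ ν N
      rw [e1, e2, e3, e4]
      ring
    · simp only [hG₂]
      rw [indicator_of_notMem (by exact hmx), shellWeight, indicator_of_notMem hmx]
      simp
  -- The time derivative does not touch the spatial factor `V`, so splitting `V = V^{1/p} V^{1/q}`
  -- allows `G₁ = V`.
  have hY₁ : ∀ t, ∀ x ∈ extClosed N, |deriv (fun t => η (T⁻¹ * t)) t * emdenLift N m x|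
      ≤ Cη / T * ((η (T⁻¹ * t) * emdenLift N m x) ^ (1 / p) * emdenLift N m x ^ (1 / q)) := by
    intro t x hx
    have hv := hVnn x hx
    rw [hηTd, Real.mul_rpow (hη0 _) hv, mul_assoc (_ ^ (1 / p)), rpow_one_div_mul_rpow_one_div hpq hv,
      abs_mul, abs_of_nonneg hv, abs_mul, abs_of_pos (inv_pos.2 hT)]
    have := hCη (T⁻¹ * t)
    calc T⁻¹ * |deriv η (T⁻¹ * t)| * emdenLift N m x
        ≤ T⁻¹ * (Cη * η (T⁻¹ * t) ^ (1 / p)) * emdenLift N m x := by gcongr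
      _ = _ := by ring
  have hG₂nn : ∀ x ∈ extClosed N, 0 ≤ G₂ x := fun x _ =>
    indicator_nonneg (fun y _ => by positivity) x
  have hY₂ : ∀ t, ∀ x ∈ extClosed N, |hardyRellich N μ (fun y => η (T⁻¹ * t) * emdenLift N m y) x|
      ≤ c₂ x * ((η (T⁻¹ * t) * emdenLift N m x) ^ (1 / p) * G₂ x ^ (1 / q)) := by
    intro t x hx
    have hr : 0 ≤ c₂ x * ((η (T⁻¹ * t) * emdenLift N m x) ^ (1 / p) * G₂ x ^ (1 / q)) := by
      have := hη0 (T⁻¹ * t)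
      have := hVnn x hx
      have := hG₂nn x hx
      have : 0 ≤ c₂ x := by simp only [hc₂]; positivity
      positivity
    rw [hardyRellich_mul_emdenLift hms hx]
    set s := Real.log ‖x‖ with hs
    have hs0 : 0 ≤ s := log_norm_nonneg hx
    rcases lt_or_ge s S with hsS | hsS
    · rw [(hCP S hS).1 s hsS]
      simpa using hr
    have hb := (hCP S hS).2 s hsS
    rcases lt_or_ge (2 * S) s with hs2 | hs2
    · rw [hχzero _ (by rw [le_inv_mul_iff₀ hS0]; linarith),
        Real.zero_rpow (by have := hpq.pos; positivity), mul_zero, mul_zero] at hb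
      rw [abs_nonpos_iff.1 hb]
      simpa using hr
    have hG : G₂ x = Ch * Real.exp ((κ + (ν + δ)) * s) :=
      indicator_of_mem (by exact (hmem x hx).2 ⟨hsS, hs2⟩) _
    set H := Real.exp (κ * s) * h s with hH
    have hH0 : 0 ≤ H := mul_nonneg (Real.exp_pos _).le (hnn s hs0)
    have hHG : H ≤ G₂ x := by
      rw [hG, add_mul, Real.exp_add]
      calc H ≤ Real.exp (κ * s) * (Ch * Real.exp ((ν + δ) * s)) := by
            rw [hH]; gcongr; exact hCh s hs0
        _ = _ := by ring
    have hVx : emdenLift N m x = H * χ (S⁻¹ * s) := by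
      simp only [emdenLift, radialLift, hm, hH]
      ring
    have hη' := hη0 (T⁻¹ * t)
    have hχ' := hχ0 (S⁻¹ * s)
    have hexp : Real.exp ((κ - 4) * s) = Real.exp (-4 * s) * Real.exp (κ * s) := by
      rw [← Real.exp_add]; ring_nf
    rw [abs_mul, abs_mul, abs_of_nonneg hη', abs_of_pos (Real.exp_pos _), hVx, hexp,
      Real.mul_rpow hη' (by positivity), Real.mul_rpow hH0 hχ']
    calc η (T⁻¹ * t) * (Real.exp (-4 * s) * Real.exp (κ * s) * |emdenFowler N μ m s|)
        ≤ η (T⁻¹ * t) ^ (1 / p) * (Real.exp (-4 * s) * Real.exp (κ * s)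
          * (C / S * (h s * χ (S⁻¹ * s) ^ (1 / p)))) := by
          gcongr
          exact le_rpow_one_div hp1 hη' (hη1 _)
      _ = C / S * Real.exp (-4 * s) * (η (T⁻¹ * t) ^ (1 / p) * (H * χ (S⁻¹ * s) ^ (1 / p))) := by
          rw [hH]; ring
      _ = C / S * Real.exp (-4 * s) * (η (T⁻¹ * t) ^ (1 / p)
          * (H ^ (1 / p) * χ (S⁻¹ * s) ^ (1 / p)) * H ^ (1 / q)) := by
          conv_lhs => rw [← rpow_one_div_mul_rpow_one_div hpq hH0]
          ring
      _ ≤ C / S * Real.exp (-4 * s) * (η (T⁻¹ * t) ^ (1 / p)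
          * (H ^ (1 / p) * χ (S⁻¹ * s) ^ (1 / p)) * G₂ x ^ (1 / q)) := by
          gcongr
  have hVcont : ContinuousOn (emdenLift N m) (extClosed N) := continuousOn_emdenLift hms.continuous
  have hI₀ : IntegrableOn (fun x => (‖x‖ ^ σ) ^ (-(q / p)) * emdenLift N m x) (extClosed N) := by
    have hw : ContinuousOn (fun x : EuclideanSpace ℝ (Fin N) => (‖x‖ ^ σ) ^ (-(q / p)))
        (extClosed N) := by
      have hn : ∀ x ∈ extClosed N, 0 < ‖x‖ := fun x hx =>
        norm_pos_iff.2 (ne_zero_of_mem_extClosed hx)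
      refine ContinuousOn.rpow_const (ContinuousOn.rpow_const (by fun_prop) fun x hx => ?_)
        fun x hx => ?_
      · exact Or.inl (hn x hx).ne'
      · exact Or.inl (Real.rpow_pos_of_pos (hn x hx) _).ne'
    refine integrableOn_mul_of_compact (isCompact_shell N (2 * S)) shell_subset
      (measurableSet_extClosed N)
      ((hw.mono shell_subset).integrableOn_compact (isCompact_shell N _)) hVcont fun x hx hxs => ?_
    have : 2 * S ≤ Real.log ‖x‖ := by
      by_contra hcon
      exact hxs ⟨hx, (not_le.1 hcon).le⟩
    simp [emdenLift, radialLift, hmR _ this]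
  have hrad := radial_shellWeight hN hS0.le
  have hbound := weakSolution_test_bound hpq hf hu hηT hT hηTs (by linarith) (fun t => hη0 _)
    hms hm0 hmR (by simp [hm, hh0])
    (by rw [hmev.deriv.deriv_eq, hmev.deriv_eq]; exact hhn)
    (G₁ := emdenLift N m) (c₁ := Cη / T) (G₂ := G₂) (c₂ := c₂) (by positivity)
    (fun x _ => by simp only [hc₂]; positivity) hVnn hG₂nn hY₁ hY₂
    (IntegrableOn.congr_fun (hI₀.const_mul ((2 * (Cη / T)) ^ q)) (fun x _ => by ring)
      (measurableSet_extClosed N))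
    (IntegrableOn.congr_fun (hrad.1.integrableOn.const_mul ((2 * C / S) ^ q * Ch))
      (fun x hx => (hI₂eq x hx).symm) (measurableSet_extClosed N))
  rw [setIntegral_congr_fun (measurableSet_extClosed N) hI₂eq, integral_const_mul] at hbound
  simp only [mul_assoc ((2 * (Cη / T)) ^ q), integral_const_mul] at hbound
  have hw0 : ∀ y : EuclideanSpace ℝ (Fin N), 0 ≤ shellWeight N S ‖y‖ := fun y =>
    indicator_nonneg (fun z hz => by
      have := (Real.exp_pos S).trans_le hz.1
      positivity) _
  have hint2 : ∫ x in extClosed N, shellWeight N S ‖x‖ ≤ cN * S := by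
    rw [← hrad.2]
    exact setIntegral_le_integral hrad.1 (Filter.Eventually.of_forall hw0)
  have hfV : IntegrableOn (fun x => f x * emdenLift N m x) (extClosed N) := by
    refine integrableOn_mul_of_compact (isCompact_shell N (2 * S)) shell_subset
      (measurableSet_extClosed N)
      (hf.integrableOn_compact_subset shell_subset (isCompact_shell N _)) hVcont fun x hx hxs => ?_
    have : 2 * S ≤ Real.log ‖x‖ := by
      by_contra hcon
      exact hxs ⟨hx, (not_le.1 hcon).le⟩
    simp [emdenLift, radialLift, hmR _ this]
  -- For `S ≥ 1` the cutoff equals `1` on the fixed shell, and positivity of `f` permits discarding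
  -- the rest of the integral.
  have hlow : (∫ x in shell N 1, f x * emdenLift N h x)
      ≤ ∫ x in extClosed N, f x * emdenLift N m x := by
    have e1 : (∫ x in shell N 1, f x * emdenLift N h x)
        = ∫ x in shell N 1, f x * emdenLift N m x := by
      refine setIntegral_congr_fun (isCompact_shell N 1).isClosed.measurableSet fun x hx => ?_
      have : χ (S⁻¹ * Real.log ‖x‖) = 1 :=
        hχone _ (by rw [inv_mul_le_iff₀ hS0]; linarith [hx.2])
      simp [emdenLift, radialLift, hm, this]
    rw [e1]
    refine setIntegral_mono_set hfV ?_ shell_subset.eventuallyLE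
    filter_upwards [ae_extClosed_of_ae_extDomain hN hfpos,
      ae_restrict_mem (measurableSet_extClosed N)] with x h1 h2
    exact mul_nonneg h1.le (hVnn x h2)
  rw [hηTint] at hbound
  have hq1 : (2 * C / S) ^ q = (2 * C) ^ q * (1 / S) ^ q := by
    rw [← Real.mul_rpow (by positivity) (by positivity)]; ring_nf
  have hJ : J₀ S = ∫ x in extClosed N, (‖x‖ ^ σ) ^ (-(q / p)) * emdenLift N m x := rfl
  have h1 : T * Iη * (∫ x in shell N 1, f x * emdenLift N h x)
      ≤ (3 * T - T) * ((2 * (Cη / T)) ^ q * J₀ S + (2 * C / S) ^ q * Ch * (cN * S)) := by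
    refine (mul_le_mul_of_nonneg_left hlow (by positivity)).trans (hbound.trans ?_)
    rw [hJ]
    have h3 : 0 ≤ 3 * T - T := by linarith
    have h4 : (0 : ℝ) ≤ (2 * C / S) ^ q * Ch := by positivity
    refine mul_le_mul_of_nonneg_left (add_le_add le_rfl ?_) h3
    exact mul_le_mul_of_nonneg_left hint2 h4
  have h2 : (∫ x in shell N 1, f x * emdenLift N h x)
      ≤ (2 * T) * ((2 * (Cη / T)) ^ q * J₀ S + (2 * C / S) ^ q * Ch * (cN * S)) / (T * Iη) := by
    rw [le_div_iff₀ (by positivity)]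
    linarith
  refine h2.trans (le_of_eq ?_)
  rw [hq1, mul_div_assoc]
  field_simp

/-- The order of limits is `T → ∞` at fixed `S`, then `S → ∞`. -/
theorem no_weakSolution {N : ℕ} (hN : 5 ≤ N) {σ μ p : ℝ} (hσ : -4 < σ)
    (hcase : (0 < μ ∧ μ ≤ muStar N ∧ 1 < p ∧ p < pCrit N σ μ) ∨
        (0 < μ ∧ μ < muStar N ∧ p = pCrit N σ μ))
    {f : EuclideanSpace ℝ (Fin N) → ℝ} (hf : LocallyIntegrableOn f (extClosed N))
    (hfpos : ∀ᵐ x ∂(volume.restrict (extDomain N)), 0 < f x)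
    (u : ℝ × EuclideanSpace ℝ (Fin N) → ℝ) : ¬ IsWeakSolution N μ σ p f u := by
  intro hu
  have hN' : (5 : ℝ) ≤ N := by exact_mod_cast hN
  have hμ0 : 0 < μ := by rcases hcase with h | h <;> exact h.1
  have hμ1 : μ ≤ muStar N := by
    rcases hcase with h | h
    · exact h.2.1
    · exact h.2.1.le
  obtain ⟨ν, τ, hν, -, hντ, hτ, -, hsum, hprod, hmu, hνpos⟩ := exists_exponents hN hμ0 hμ1
  have hM : 0 < muN N μ := by rw [hmu]; linarith
  have hp1 : 1 < p := by
    rcases hcase with h | h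
    · exact h.2.2.1
    · rw [h.2.2, pCrit]
      have : 0 < (σ + 4) / muN N μ := div_pos (by linarith) hM
      linarith
  have hp0 : 0 < p - 1 := by linarith
  -- The growth margin: positive below `p_crit`, zero at `p_crit`. In the latter case `μ < μ*` gives
  -- `ν > 0`, so that `h` still obeys the bound.
  set δ := (σ + 4) / (p - 1) - ((N : ℝ) - 4) / 2 - ν with hδ
  have hδ' : δ = (σ + 4) / (p - 1) - muN N μ := by rw [hδ, hmu]; ring
  have hδcase : 0 ≤ δ ∧ (0 < δ ∨ 0 < ν) := by
    rcases hcase with h | h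
    · have h1 : p - 1 < (σ + 4) / muN N μ := by
        have := h.2.2.2
        rw [pCrit] at this
        linarith
      have h2 : muN N μ < (σ + 4) / (p - 1) := by
        rw [lt_div_iff₀ hM] at h1
        rw [lt_div_iff₀ hp0]
        linarith
      have : 0 < δ := by rw [hδ']; linarith
      exact ⟨this.le, Or.inl this⟩
    · have h1 : p - 1 = (σ + 4) / muN N μ := by rw [h.2.2, pCrit]; ring
      have h2 : muN N μ = (σ + 4) / (p - 1) := by
        rw [eq_div_iff hM.ne'] at h1
        rw [eq_div_iff hp0.ne']
        linarith
      exact ⟨by rw [hδ']; linarith, Or.inr (hνpos h.2.1)⟩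
  obtain ⟨h, hh, hh0, hhn, hP, hpos, hC, hgrow⟩ :=
    exists_harmonic_profile (N := N) (μ := μ) hν hντ hτ hsum hprod
  have hpq : p.HolderConjugate (p.conjExponent) := Real.HolderConjugate.conjExponent hp1
  set q := p.conjExponent
  have hq1 : 1 < q := hpq.symm.lt
  obtain ⟨a, b, ha, hb, J, hJ⟩ := weakSolution_scale_bound hN hpq hf hfpos hu hh hh0 hhn hP hpos hC
    (hgrow δ hδcase.1 hδcase.2)
  have hIpos := setIntegral_shell_pos hN hf hfpos hh.continuous hpos
  set I := ∫ x in shell N 1, f x * emdenLift N h x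
  have hlim : ∀ S, 1 ≤ S → I ≤ b * ((1 / S) ^ q * S) := by
    intro S hS
    have h1 : Filter.Tendsto (fun T : ℝ => (a / T) ^ q * J S + b * ((1 / S) ^ q * S)) Filter.atTop
        (𝓝 ((0 : ℝ) ^ q * J S + b * ((1 / S) ^ q * S))) := by
      refine Filter.Tendsto.add_const _ (Filter.Tendsto.mul_const _ ?_)
      exact (Filter.Tendsto.const_div_atTop Filter.tendsto_id a).rpow_const (Or.inr (by linarith))
    rw [Real.zero_rpow (by linarith), zero_mul, zero_add] at h1
    refine ge_of_tendsto h1 ?_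
    filter_upwards [Filter.eventually_gt_atTop 0] with T hT using hJ S hS T hT
  -- The gain `S^{-q}` from the truncation beats the shell's logarithmic length `S` because `q > 1`;
  -- this gives decay even at the critical exponent.
  have h2 : Filter.Tendsto (fun S : ℝ => b * ((1 / S) ^ q * S)) Filter.atTop (𝓝 (b * 0)) := by
    refine Filter.Tendsto.const_mul _ ?_
    refine (tendsto_rpow_neg_atTop (y := q - 1) (by linarith)).congr' ?_
    filter_upwards [Filter.eventually_gt_atTop 0] with S hS
    rw [one_div, Real.inv_rpow hS.le, ← Real.rpow_neg hS.le]
    conv_rhs => rw [← Real.rpow_one S, ← Real.rpow_mul hS.le, one_mul, ← Real.rpow_add hS]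
    ring_nf
  have h3 : I ≤ b * 0 := by
    refine ge_of_tendsto h2 ?_
    filter_upwards [Filter.eventually_ge_atTop 1] with S hS using hlim S hS
  linarith

/-! ### Green's identity on the exterior domain. -/

theorem extLaplacian_eq_sum {N : ℕ} (v : EuclideanSpace ℝ (Fin N) → ℝ)
    {x : EuclideanSpace ℝ (Fin N)} (hx : x ∈ extClosed N) :
    extLaplacian N v x = ∑ i, iteratedFDerivWithin ℝ 2 v (extClosed N) x
      ![stdOrthonormalBasis ℝ (EuclideanSpace ℝ (Fin N)) i,
        stdOrthonormalBasis ℝ (EuclideanSpace ℝ (Fin N)) i] :=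
  InnerProductSpace.laplacianWithin_eq_iteratedFDerivWithin_stdOrthonormalBasis v
    (uniqueDiffOn_extClosed N) hx

theorem contDiffOn_extLaplacian {N : ℕ} {v : EuclideanSpace ℝ (Fin N) → ℝ} {n m : WithTop ℕ∞}
    (hv : ContDiffOn ℝ n v (extClosed N)) (hm : m + 2 ≤ n) :
    ContDiffOn ℝ m (extLaplacian N v) (extClosed N) := by
  refine ContDiffOn.congr (f := fun x => ∑ i, iteratedFDerivWithin ℝ 2 v (extClosed N) x
      ![stdOrthonormalBasis ℝ (EuclideanSpace ℝ (Fin N)) i,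
        stdOrthonormalBasis ℝ (EuclideanSpace ℝ (Fin N)) i]) ?_
    fun x hx => extLaplacian_eq_sum v hx
  refine ContDiffOn.sum fun i _ x hx => ?_
  have h := (hv x hx).iteratedFDerivWithin_right (i := 2) (uniqueDiffOn_extClosed N) hm hx
  exact (ContinuousMultilinearMap.apply ℝ (fun _ : Fin 2 => EuclideanSpace ℝ (Fin N)) ℝ
    ![stdOrthonormalBasis ℝ (EuclideanSpace ℝ (Fin N)) i,
        stdOrthonormalBasis ℝ (EuclideanSpace ℝ (Fin N)) i]).contDiff.comp_contDiffWithinAt h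

theorem extLaplacian_eq_zero_of_notMem {N : ℕ} {v : EuclideanSpace ℝ (Fin N) → ℝ}
    {K : Set (EuclideanSpace ℝ (Fin N))} (hK : IsClosed K)
    (hv : ∀ x ∈ extClosed N, x ∉ K → v x = 0) {x : EuclideanSpace ℝ (Fin N)}
    (hx : x ∈ extClosed N) (hxK : x ∉ K) : extLaplacian N v x = 0 := by
  have hev : v =ᶠ[𝓝[extClosed N] x] fun _ => 0 := by
    filter_upwards [mem_nhdsWithin_of_mem_nhds (hK.isOpen_compl.mem_nhds hxK),
      self_mem_nhdsWithin] with y h1 h2 using hv y h2 h1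
  have h := (InnerProductSpace.laplacianWithin_congr_nhdsWithin hev
    (uniqueDiffOn_extClosed N)).self_of_nhdsWithin hx
  rw [extLaplacian, h]
  change extLaplacian N (radialLift N fun _ => 0) x = 0
  rw [extLaplacian_radialLift contDiff_const hx]
  simp [radialLift, logLap]

/-- The products of first derivatives cancel. Summed over an orthonormal basis, this is the
divergence form of `a Δb - b Δa`. -/
theorem hasFDerivAt_wronskian {E : Type*} [NormedAddCommGroup E] [NormedSpace ℝ E]
    {a b : E → ℝ} {x e : E} (ha : ContDiffAt ℝ 2 a x) (hb : ContDiffAt ℝ 2 b x) :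
    HasLineDerivAt ℝ (fun y => a y * fderiv ℝ b y e - b y * fderiv ℝ a y e)
      (a x * fderiv ℝ (fderiv ℝ b) x e e - b x * fderiv ℝ (fderiv ℝ a) x e e) x e := by
  have hda : HasFDerivAt (fderiv ℝ a) (fderiv ℝ (fderiv ℝ a) x) x :=
    ((ha.fderiv_right (m := 1) (by norm_num)).differentiableAt (by norm_num)).hasFDerivAt
  have hdb : HasFDerivAt (fderiv ℝ b) (fderiv ℝ (fderiv ℝ b) x) x :=
    ((hb.fderiv_right (m := 1) (by norm_num)).differentiableAt (by norm_num)).hasFDerivAt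
  have ha0 := (ha.differentiableAt (by norm_num)).hasFDerivAt
  have hb0 := (hb.differentiableAt (by norm_num)).hasFDerivAt
  have hdae : HasFDerivAt (fun y => fderiv ℝ a y e) ((fderiv ℝ (fderiv ℝ a) x).flip e) x := by
    simpa using hda.clm_apply (hasFDerivAt_const e x)
  have hdbe : HasFDerivAt (fun y => fderiv ℝ b y e) ((fderiv ℝ (fderiv ℝ b) x).flip e) x := by
    simpa using hdb.clm_apply (hasFDerivAt_const e x)
  have h := ((ha0.mul hdbe).sub (hb0.mul hdae)).hasLineDerivAt e
  convert! h using 1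
  simp only [sub_apply, add_apply, _root_.smul_apply, ContinuousLinearMap.flip_apply, smul_eq_mul]
  ring

theorem continuousAt_fderiv_fderiv {E : Type*} [NormedAddCommGroup E] [NormedSpace ℝ E]
    {a : E → ℝ} {x : E} (ha : ContDiffAt ℝ 2 a x) (e : E) :
    ContinuousAt (fun y => fderiv ℝ (fderiv ℝ a) y e e) x := by
  have h1 := ha.fderiv_right (m := 1) (by norm_num)
  have h2 := (h1.fderiv_right (m := 0) (by norm_num)).continuousAt
  exact (h2.clm_apply continuousAt_const).clm_apply continuousAt_const

/-- Integration by parts against the constant function `1`. -/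
theorem integral_eq_zero_of_hasLineDerivAt {E : Type*} [NormedAddCommGroup E] [NormedSpace ℝ E]
    [FiniteDimensional ℝ E] [MeasurableSpace E] [BorelSpace E] {ρ : Measure E}
    [ρ.IsAddHaarMeasure] {F F' : E → ℝ} {e : E}
    (hF : Integrable F ρ) (hF' : Integrable F' ρ) (h : ∀ x, HasLineDerivAt ℝ F (F' x) x e) :
    ∫ x, F' x ∂ρ = 0 := by
  have := integral_bilinear_hasLineDerivAt_right_eq_neg_left_of_integrable (μ := ρ)
    (f := fun _ => (1 : ℝ)) (f' := fun _ => 0) (g := F) (g' := F') (v := e)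
    (B := ContinuousLinearMap.mul ℝ ℝ) (by simp) (by simpa using hF') (by simpa using hF)
    (fun x _ => by simpa using (hasFDerivAt_const (1 : ℝ) x).hasLineDerivAt e) (fun x _ => h x)
  simpa using this

/-- Green's identity for functions one of which vanishes near the unit ball. -/
theorem integral_green_of_vanishing {N : ℕ} {w : ℝ → ℝ} {a : ℝ} (ha : 0 < a)
    (hw : ContDiff ℝ ∞ w) (hwa : ∀ s ≤ a, w s = 0) {g : EuclideanSpace ℝ (Fin N) → ℝ}
    (hg : ContDiffOn ℝ 2 g (extDomain N)) {K : Set (EuclideanSpace ℝ (Fin N))} (hK : IsCompact K)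
    (hgK : ∀ x ∈ extDomain N, x ∉ K → g x = 0) :
    ∫ x, (radialLift N w x * (Δ g) x - g x * (Δ (radialLift N w)) x) = 0 := by
  set U := radialLift N w with hU
  have hgat : ∀ x ∈ extDomain N, ContDiffAt ℝ 2 g x := fun x hx =>
    hg.contDiffAt ((isOpen_extDomain N).mem_nhds hx)
  have hUat : ∀ x ∈ extDomain N, ContDiffAt ℝ 2 U x := fun x hx =>
    contDiffAt_radialLift (contDiff_two_of_infty hw)
      (ne_zero_of_mem_extClosed (extDomain_subset_extClosed N hx))
  set O : Set (EuclideanSpace ℝ (Fin N)) := {x | ‖x‖ < Real.exp a} with hO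
  have hOopen : IsOpen O := isOpen_lt continuous_norm continuous_const
  have hU0 : ∀ x ∈ O, U x = 0 := fun x (hx : ‖x‖ < Real.exp a) => by
    refine hwa _ ?_
    -- At the origin the convention `Real.log 0 = 0` puts the argument in the range where `w`
    -- vanishes.
    rcases (norm_nonneg x).eq_or_lt with h | h
    · rw [← h, Real.log_zero]; exact ha.le
    · exact ((Real.log_lt_iff_lt_exp h).2 hx).le
  have hcover : ∀ x, x ∈ O ∨ x ∈ extDomain N := fun x => by
    by_cases hx : x ∈ O
    · exact Or.inl hx
    · exact Or.inr (lt_of_lt_of_le (Real.one_lt_exp_iff.2 ha) (not_lt.1 hx))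
  have hUev : ∀ x ∈ O, U =ᶠ[𝓝 x] 0 := fun x hx => by
    filter_upwards [hOopen.mem_nhds hx] with y hy using hU0 y hy
  have hdU : ∀ x ∈ O, fderiv ℝ U =ᶠ[𝓝 x] 0 := fun x hx => by
    have := (hUev x hx).fderiv (𝕜 := ℝ)
    refine this.trans (Filter.Eventually.of_forall fun y => ?_)
    simp
  have hddU : ∀ x ∈ O, fderiv ℝ (fderiv ℝ U) =ᶠ[𝓝 x] 0 := fun x hx => by
    have := (hdU x hx).fderiv (𝕜 := ℝ)
    refine this.trans (Filter.Eventually.of_forall fun y => ?_)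
    simp
  have hgev : ∀ x ∈ extDomain N, x ∉ K → g =ᶠ[𝓝 x] 0 := fun x hx hxK => by
    filter_upwards [(isOpen_extDomain N).mem_nhds hx, hK.isClosed.isOpen_compl.mem_nhds hxK]
      with y h1 h2 using hgK y h1 h2
  have hdg : ∀ x ∈ extDomain N, x ∉ K → fderiv ℝ g =ᶠ[𝓝 x] 0 := fun x hx hxK => by
    have := (hgev x hx hxK).fderiv (𝕜 := ℝ)
    refine this.trans (Filter.Eventually.of_forall fun y => ?_)
    simp
  have hddg : ∀ x ∈ extDomain N, x ∉ K → fderiv ℝ (fderiv ℝ g) x = 0 := fun x hx hxK => by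
    rw [(hdg x hx hxK).fderiv_eq]
    simp
  -- Near the closed ball `U` vanishes, so `F e` and its directional derivative are continuous with
  -- compact support on the whole space, whatever `g` does inside the ball.
  set F : EuclideanSpace ℝ (Fin N) → EuclideanSpace ℝ (Fin N) → ℝ := fun e x =>
    U x * fderiv ℝ g x e - g x * fderiv ℝ U x e with hF
  set F' : EuclideanSpace ℝ (Fin N) → EuclideanSpace ℝ (Fin N) → ℝ := fun e x =>
    U x * fderiv ℝ (fderiv ℝ g) x e e - g x * fderiv ℝ (fderiv ℝ U) x e e with hF'
  have hFO : ∀ e, ∀ x ∈ O, F e x = 0 := fun e x hx => by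
    simp [hF, hU0 x hx, (hdU x hx).self_of_nhds]
  have hF'O : ∀ e, ∀ x ∈ O, F' e x = 0 := fun e x hx => by
    simp [hF', hU0 x hx, (hddU x hx).self_of_nhds]
  have hline : ∀ e x, HasLineDerivAt ℝ (F e) (F' e x) x e := fun e x => by
    rcases hcover x with hx | hx
    · rw [hF'O e x hx]
      have : F e =ᶠ[𝓝 x] fun _ => 0 := by
        filter_upwards [hOopen.mem_nhds hx] with y hy using hFO e y hy
      simpa using ((hasFDerivAt_const (0 : ℝ) x).congr_of_eventuallyEq this).hasLineDerivAt e
    · exact hasFDerivAt_wronskian (hUat x hx) (hgat x hx)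
  have hFsupp : ∀ e, ∀ x ∉ K, F e x = 0 := fun e x hxK => by
    rcases hcover x with hx | hx
    · exact hFO e x hx
    · simp [hF, (hdg x hx hxK).self_of_nhds, hgK x hx hxK]
  have hF'supp : ∀ e, ∀ x ∉ K, F' e x = 0 := fun e x hxK => by
    rcases hcover x with hx | hx
    · exact hF'O e x hx
    · simp [hF', hddg x hx hxK, hgK x hx hxK]
  have hcontF : ∀ e, Continuous (F e) := fun e => continuous_iff_continuousAt.2 fun x => by
    rcases hcover x with hx | hx
    · have : F e =ᶠ[𝓝 x] fun _ => 0 := by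
        filter_upwards [hOopen.mem_nhds hx] with y hy using hFO e y hy
      exact continuousAt_const.congr this.symm
    · have h1 := hgat x hx
      have h2 := hUat x hx
      exact (h2.continuousAt.mul ((h1.fderiv_right (m := 0)
        (by norm_num)).continuousAt.clm_apply continuousAt_const)).sub
        (h1.continuousAt.mul ((h2.fderiv_right (m := 0)
        (by norm_num)).continuousAt.clm_apply continuousAt_const))
  have hcontF' : ∀ e, Continuous (F' e) := fun e => continuous_iff_continuousAt.2 fun x => by
    rcases hcover x with hx | hx
    · have : F' e =ᶠ[𝓝 x] fun _ => 0 := by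
        filter_upwards [hOopen.mem_nhds hx] with y hy using hF'O e y hy
      exact continuousAt_const.congr this.symm
    · have h1 := hgat x hx
      have h2 := hUat x hx
      exact (h2.continuousAt.mul (continuousAt_fderiv_fderiv h1 e)).sub
        (h1.continuousAt.mul (continuousAt_fderiv_fderiv h2 e))
  have hFint : ∀ e, Integrable (F e) := fun e =>
    (hcontF e).integrable_of_hasCompactSupport (HasCompactSupport.intro hK (hFsupp e))
  have hF'int : ∀ e, Integrable (F' e) := fun e =>
    (hcontF' e).integrable_of_hasCompactSupport (HasCompactSupport.intro hK (hF'supp e))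
  have hzero : ∀ e, ∫ x, F' e x = 0 := fun e =>
    integral_eq_zero_of_hasLineDerivAt (hFint e) (hF'int e) (hline e)
  have hsum : ∀ x, U x * (Δ g) x - g x * (Δ U) x
      = ∑ i, F' (stdOrthonormalBasis ℝ (EuclideanSpace ℝ (Fin N)) i) x := fun x => by
    rw [InnerProductSpace.laplacian_eq_iteratedFDeriv_stdOrthonormalBasis,
      InnerProductSpace.laplacian_eq_iteratedFDeriv_stdOrthonormalBasis]
    simp only [iteratedFDeriv_two_apply, hF', Finset.sum_sub_distrib, Finset.mul_sum,
      Matrix.cons_val_zero, Matrix.cons_val_one]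
  simp only [hsum]
  rw [integral_finsetSum _ fun i _ => hF'int _]
  simp [hzero]

/-- A `C¹` function vanishing on the unit sphere and outside a compact set is `O(log ‖x‖)`. -/
theorem exists_bound_log_norm {N : ℕ} {g : EuclideanSpace ℝ (Fin N) → ℝ}
    (hg : ContDiffOn ℝ 1 g (extClosed N)) (hg0 : ∀ x ∈ unitSphere N, g x = 0)
    {K : Set (EuclideanSpace ℝ (Fin N))} (hK : IsCompact K)
    (hgK : ∀ x ∈ extClosed N, x ∉ K → g x = 0) :
    ∃ C : ℝ, 0 ≤ C ∧ ∀ x ∈ extClosed N, |g x| ≤ C * Real.log ‖x‖ := by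
  obtain ⟨R, hR⟩ := hK.isBounded.subset_closedBall 0
  set B := extClosed N ∩ Metric.closedBall 0 R with hB
  have hBc : IsCompact B := (isCompact_closedBall _ _).inter_left (isClosed_extClosed N)
  have hd : ContinuousOn (fderivWithin ℝ g (extClosed N)) (extClosed N) :=
    hg.continuousOn_fderivWithin (uniqueDiffOn_extClosed N) le_rfl
  obtain ⟨M, hM⟩ := hBc.exists_bound_of_continuousOn (hd.mono inter_subset_left)
  refine ⟨max M 0 * max R 0, by positivity, fun x hx => ?_⟩
  have hlog := log_norm_nonneg hx
  by_cases hxB : ‖x‖ ≤ R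
  swap
  · rw [hgK x hx fun h => hxB (mem_closedBall_zero_iff.1 (hR h)), abs_zero]
    positivity
  have hx1 : 1 ≤ ‖x‖ := hx
  have hxp : 0 < ‖x‖ := by linarith
  -- The exterior is not convex, but the radial segment from `y` on the sphere to `x` stays in it,
  -- so the mean value inequality applies there.
  set y := ‖x‖⁻¹ • x with hy
  have hyn : ‖y‖ = 1 := by
    rw [hy, norm_smul, norm_inv, norm_norm, inv_mul_cancel₀ hxp.ne']
  have hseg : segment ℝ y x ⊆ B := by
    rintro z ⟨a, b, ha, hb, hab, rfl⟩
    have hz : a • y + b • x = (a * ‖x‖⁻¹ + b) • x := by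
      rw [hy, smul_smul, add_smul]
    have hzn : ‖a • y + b • x‖ = a + b * ‖x‖ := by
      rw [hz, norm_smul, Real.norm_of_nonneg (by positivity), add_mul, mul_assoc,
        inv_mul_cancel₀ hxp.ne', mul_one]
    refine ⟨?_, ?_⟩
    · change 1 ≤ ‖a • y + b • x‖
      rw [hzn]; nlinarith
    · rw [mem_closedBall_zero_iff, hzn]; nlinarith
  have hmv := (convex_segment y x).norm_image_sub_le_of_norm_hasFDerivWithin_le
    (f := g) (f' := fderivWithin ℝ g (extClosed N)) (C := max M 0)
    (fun z hz => ((hg.differentiableOn (by norm_num) z (hseg hz).1).hasFDerivWithinAt).mono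
      fun z' hz' => (hseg hz').1)
    (fun z hz => (hM z (hseg hz)).trans (le_max_left _ _))
    (left_mem_segment ℝ y x) (right_mem_segment ℝ y x)
  have hdist : ‖x - y‖ = ‖x‖ - 1 := by
    have : x - y = (1 - ‖x‖⁻¹) • x := by rw [hy, sub_smul, one_smul]
    rw [this, norm_smul, Real.norm_of_nonneg (sub_nonneg.2 (inv_le_one_of_one_le₀ hx1)), sub_mul,
      inv_mul_cancel₀ hxp.ne', one_mul]
  rw [hg0 y hyn, sub_zero, Real.norm_eq_abs, hdist] at hmv
  have hl : ‖x‖ - 1 ≤ ‖x‖ * Real.log ‖x‖ := by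
    have := Real.one_sub_inv_le_log_of_pos hxp
    have h2 := mul_le_mul_of_nonneg_left this hxp.le
    rwa [mul_sub, mul_inv_cancel₀ hxp.ne', mul_one] at h2
  calc |g x| ≤ max M 0 * (‖x‖ - 1) := hmv
    _ ≤ max M 0 * (max R 0 * Real.log ‖x‖) := by
        refine mul_le_mul_of_nonneg_left (hl.trans ?_) (le_max_right _ _)
        exact mul_le_mul_of_nonneg_right (hxB.trans (le_max_left _ _)) hlog
    _ = _ := by ring

theorem deriv_mul_of_contDiff {a b : ℝ → ℝ} (ha : ContDiff ℝ ∞ a) (hb : ContDiff ℝ ∞ b) :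
    deriv (fun s => a s * b s) = fun s => deriv a s * b s + a s * deriv b s :=
  deriv_eq_of_hasDerivAt fun s =>
    (hasDerivAt_of_contDiff_infty ha s).mul (hasDerivAt_of_contDiff_infty hb s)

theorem deriv_deriv_mul_of_contDiff {a b : ℝ → ℝ} (ha : ContDiff ℝ ∞ a) (hb : ContDiff ℝ ∞ b) :
    deriv (deriv fun s => a s * b s) = fun s => deriv (deriv a) s * b s
      + 2 * (deriv a s * deriv b s) + a s * deriv (deriv b) s := by
  have ha1 := contDiff_deriv_infty ha
  have hb1 := contDiff_deriv_infty hb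
  rw [deriv_mul_of_contDiff ha hb]
  refine deriv_eq_of_hasDerivAt fun s => ?_
  convert! ((hasDerivAt_of_contDiff_infty ha1 s).mul (hasDerivAt_of_contDiff_infty hb s)).add
    ((hasDerivAt_of_contDiff_infty ha s).mul (hasDerivAt_of_contDiff_infty hb1 s)) using 1
  ring

/-- A cutoff vanishing on `(-∞, 1]`, equal to one on `[2, ∞)`, with scale-invariant bounds. -/
theorem exists_lower_cutoff : ∃ χ : ℝ → ℝ, ContDiff ℝ ∞ χ ∧ (∀ s ≤ 1, χ s = 0) ∧
    (∀ s, 2 ≤ s → χ s = 1) ∧ (∀ s, 0 ≤ χ s) ∧ (∀ s, χ s ≤ 1) ∧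
    ∃ A : ℝ, 0 ≤ A ∧ ∀ s, |s * deriv χ s| ≤ A ∧ |s ^ 2 * deriv (deriv χ) s| ≤ A := by
  set χ : ℝ → ℝ := fun s => Real.smoothTransition (s - 1) with hχdef
  have hχ : ContDiff ℝ ∞ χ := Real.smoothTransition.contDiff.comp (by fun_prop)
  have h1 := contDiff_deriv_infty hχ
  have h2 := contDiff_deriv_infty h1
  have hc : HasCompactSupport (deriv χ) := by
    refine HasCompactSupport.intro (isCompact_Icc (a := (1 : ℝ)) (b := 2)) fun s hs => ?_
    rw [mem_Icc, not_and_or, not_le, not_le] at hs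
    rcases hs with hs | hs
    · have : χ =ᶠ[𝓝 s] fun _ => 0 := by
        filter_upwards [Iio_mem_nhds hs] with y hy
        exact Real.smoothTransition.zero_of_nonpos (by linarith [mem_Iio.1 hy])
      rw [this.deriv_eq, deriv_const]
    · have : χ =ᶠ[𝓝 s] fun _ => 1 := by
        filter_upwards [Ioi_mem_nhds hs] with y hy
        exact Real.smoothTransition.one_of_one_le (by linarith [mem_Ioi.1 hy])
      rw [this.deriv_eq, deriv_const]
  obtain ⟨A₁, hA₁⟩ := (hc.mul_left (f := fun s => s)).exists_bound_of_continuous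
    (continuous_id.mul h1.continuous)
  obtain ⟨A₂, hA₂⟩ := (hc.deriv.mul_left (f := fun s : ℝ => s ^ 2)).exists_bound_of_continuous
    ((continuous_pow 2).mul h2.continuous)
  refine ⟨χ, hχ, fun s hs => Real.smoothTransition.zero_of_nonpos (by linarith),
    fun s hs => Real.smoothTransition.one_of_one_le (by linarith),
    fun s => Real.smoothTransition.nonneg _, fun s => Real.smoothTransition.le_one _,
    max A₁ A₂, ?_, fun s => ⟨(hA₁ s).trans (le_max_left _ _), (hA₂ s).trans (le_max_right _ _)⟩⟩
  exact (norm_nonneg _).trans ((hA₁ 0).trans (le_max_left _ _))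

theorem deriv_comp_mul_cutoff (χ : ℝ → ℝ) (n : ℝ) :
    deriv (fun s => χ (n * s)) = fun s => n * deriv χ (n * s) := by
  ext s
  rw [deriv_comp_mul_left, smul_eq_mul]

theorem deriv_deriv_comp_mul_cutoff (χ : ℝ → ℝ) (n : ℝ) :
    deriv (deriv fun s => χ (n * s)) = fun s => n ^ 2 * deriv (deriv χ) (n * s) := by
  rw [deriv_comp_mul_cutoff]
  ext s
  rw [deriv_const_mul_field, deriv_comp_mul_left, smul_eq_mul]
  ring

theorem integrableOn_extClosed_of_continuousOn {N : ℕ} {b : EuclideanSpace ℝ (Fin N) → ℝ}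
    (hb : ContinuousOn b (extClosed N)) {K : Set (EuclideanSpace ℝ (Fin N))} (hK : IsCompact K)
    (hbK : ∀ x ∈ extClosed N, x ∉ K → b x = 0) : IntegrableOn b (extClosed N) := by
  have hK' : IsCompact (K ∩ extClosed N) := hK.inter_right (isClosed_extClosed N)
  refine IntegrableOn.of_forall_sdiff_eq_zero
    ((hb.mono inter_subset_right).integrableOn_compact hK') (measurableSet_extClosed N)
    fun x hx => hbK x hx.1 fun h => hx.2 ⟨h, hx.1⟩

/-- The boundary cutoff does not create unbounded terms when both factors vanish on the sphere. -/
theorem exists_logLap_cutoff_bound {N : ℕ} {w χ : ℝ → ℝ} (hw : ContDiff ℝ ∞ w) (hw0 : w 0 = 0)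
    (hχ : ContDiff ℝ ∞ χ) (hχ0 : ∀ s, 0 ≤ χ s) (hχ1 : ∀ s, χ s ≤ 1)
    (hA : ∃ A : ℝ, 0 ≤ A ∧ ∀ s, |s * deriv χ s| ≤ A ∧ |s ^ 2 * deriv (deriv χ) s| ≤ A) (L : ℝ) :
    ∃ C : ℝ, 0 ≤ C ∧ ∀ n : ℝ, ∀ s, 0 < s → s ≤ L →
      |logLap N (fun s => χ (n * s) * w s) s| * s ≤ C := by
  obtain ⟨A, hA0, hA⟩ := hA
  have hw1 := contDiff_deriv_infty hw
  have hw2 := contDiff_deriv_infty hw1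
  obtain ⟨B₁, hB₁⟩ := (isCompact_Icc (a := (0 : ℝ)) (b := L)).exists_bound_of_continuousOn
    hw1.continuous.continuousOn
  obtain ⟨B₂, hB₂⟩ := (isCompact_Icc (a := (0 : ℝ)) (b := L)).exists_bound_of_continuousOn
    hw2.continuous.continuousOn
  set B := max (max B₁ B₂) 0 with hB
  have hB0 : 0 ≤ B := le_max_right _ _
  set L' := max L 0
  have hL' : 0 ≤ L' := le_max_right _ _
  refine ⟨A * B + 2 * (A * B) + B * L' + |(N : ℝ) - 2| * (A * B * L' + B * L'), by positivity,
    fun n s hs hsL => ?_⟩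
  have hsI : s ∈ Icc 0 L := ⟨hs.le, hsL⟩
  have b1 : |deriv w s| ≤ B := (hB₁ s hsI).trans ((le_max_left _ _).trans (le_max_left _ _))
  have b2 : |deriv (deriv w) s| ≤ B :=
    (hB₂ s hsI).trans ((le_max_right _ _).trans (le_max_left _ _))
  have b0 : |w s| ≤ B * s := by
    have := (convex_Icc (0 : ℝ) L).norm_image_sub_le_of_norm_deriv_le (f := w) (C := B)
      (fun x _ => (hasDerivAt_of_contDiff_infty hw x).differentiableAt)
      (fun x hx => (hB₁ x hx).trans ((le_max_left _ _).trans (le_max_left _ _)))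
      (x := 0) (y := s) ⟨le_rfl, hs.le.trans hsL⟩ hsI
    rw [hw0, sub_zero, sub_zero, Real.norm_eq_abs, Real.norm_eq_abs, abs_of_pos hs] at this
    exact this
  have hsL' : s ≤ L' := hsL.trans (le_max_left _ _)
  have hcn : ContDiff ℝ ∞ (fun s => χ (n * s)) := by fun_prop
  obtain ⟨a1, a2⟩ := hA (n * s)
  have hc1 := hχ1 (n * s)
  have hc0 := hχ0 (n * s)
  rw [logLap, deriv_deriv_mul_of_contDiff hcn hw, deriv_mul_of_contDiff hcn hw,
    deriv_deriv_comp_mul_cutoff, deriv_comp_mul_cutoff]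
  set X := deriv χ (n * s)
  set Y := deriv (deriv χ) (n * s)
  set c := χ (n * s)
  have he : |Real.exp (-2 * s)| ≤ 1 := by
    rw [abs_of_pos (Real.exp_pos _)]
    exact Real.exp_le_one_iff.2 (by linarith)
  -- The worst term: one factor `s` from `w = O(s)` and the extra factor `s` turn `n²` into the
  -- scale-invariant `(ns)²`.
  have t1 : |n ^ 2 * Y * w s| * s ≤ A * B := by
    calc |n ^ 2 * Y * w s| * s = |n ^ 2 * Y| * |w s| * s := by rw [abs_mul]
      _ ≤ |n ^ 2 * Y| * (B * s) * s := by gcongr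
      _ = |(n * s) ^ 2 * Y| * B := by
          rw [show (n * s) ^ 2 * Y = n ^ 2 * Y * s ^ 2 by ring, abs_mul _ (s ^ 2),
            abs_of_pos (show 0 < s ^ 2 by positivity)]
          ring
      _ ≤ A * B := by gcongr
  have t2 : |n * X * deriv w s| * s ≤ A * B := by
    calc |n * X * deriv w s| * s = |n * s * X| * |deriv w s| := by
          rw [show n * s * X = n * X * s by ring, abs_mul (n * X) s, abs_of_pos hs, abs_mul]
          ring
      _ ≤ A * B := by gcongr
  have t3 : |c * deriv (deriv w) s| * s ≤ B * L' := by
    rw [abs_mul, abs_of_nonneg hc0]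
    calc c * |deriv (deriv w) s| * s ≤ 1 * B * L' := by gcongr
      _ = _ := by ring
  have t4 : |n * X * w s| * s ≤ A * B * L' := by
    calc |n * X * w s| * s ≤ |n * X| * (B * s) * s := by rw [abs_mul]; gcongr
      _ = |n * s * X| * B * s := by
          rw [show n * s * X = n * X * s by ring, abs_mul (n * X) s, abs_of_pos hs]
          ring
      _ ≤ A * B * L' := by gcongr
  have t5 : |c * deriv w s| * s ≤ B * L' := by
    rw [abs_mul, abs_of_nonneg hc0]
    calc c * |deriv w s| * s ≤ 1 * B * L' := by gcongr
      _ = _ := by ring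
  calc |Real.exp (-2 * s) * (n ^ 2 * Y * w s + 2 * (n * X * deriv w s) + c * deriv (deriv w) s
        + ((N : ℝ) - 2) * (n * X * w s + c * deriv w s))| * s
      ≤ (|n ^ 2 * Y * w s| + 2 * |n * X * deriv w s| + |c * deriv (deriv w) s|
        + |(N : ℝ) - 2| * (|n * X * w s| + |c * deriv w s|)) * s := by
        refine mul_le_mul_of_nonneg_right ?_ hs.le
        rw [abs_mul]
        refine (mul_le_of_le_one_left (abs_nonneg _) he).trans ?_
        refine (abs_add_le _ _).trans (add_le_add ((abs_add_le _ _).trans (add_le_add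
          ((abs_add_le _ _).trans (add_le_add le_rfl ?_)) le_rfl)) ?_)
        · rw [abs_mul, abs_of_pos (by norm_num : (0 : ℝ) < 2)]
        · rw [abs_mul]
          exact mul_le_mul_of_nonneg_left (abs_add_le _ _) (abs_nonneg _)
    _ = |n ^ 2 * Y * w s| * s + 2 * (|n * X * deriv w s| * s) + |c * deriv (deriv w) s| * s
        + |(N : ℝ) - 2| * (|n * X * w s| * s + |c * deriv w s| * s) := by ring
    _ ≤ _ := by gcongr

/-- Green's identity on the exterior domain when both factors vanish on the unit sphere. -/
theorem integral_radialLift_mul_extLaplacian {N : ℕ} (hN : 5 ≤ N) {w : ℝ → ℝ}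
    (hw : ContDiff ℝ ∞ w) (hw0 : w 0 = 0) {g : EuclideanSpace ℝ (Fin N) → ℝ}
    (hg : ContDiffOn ℝ 2 g (extClosed N)) (hg0 : ∀ x ∈ unitSphere N, g x = 0)
    {K : Set (EuclideanSpace ℝ (Fin N))} (hK : IsCompact K)
    (hgK : ∀ x ∈ extClosed N, x ∉ K → g x = 0) :
    ∫ x in extClosed N, radialLift N w x * extLaplacian N g x
      = ∫ x in extClosed N, radialLift N (logLap N w) x * g x := by
  obtain ⟨χ, hχ, hχz, hχo, hχ0, hχ1, hA⟩ := exists_lower_cutoff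
  obtain ⟨R, hR⟩ := hK.isBounded.subset_closedBall 0
  obtain ⟨C, hC0, hC⟩ := exists_logLap_cutoff_bound (N := N) hw hw0 hχ hχ0 hχ1 hA (Real.log R)
  obtain ⟨D, hD0, hD⟩ := exists_bound_log_norm (N := N) (hg.of_le (by norm_num)) hg0 hK hgK
  have hlap : ContinuousOn (extLaplacian N g) (extClosed N) :=
    (contDiffOn_extLaplacian (m := 0) hg (by norm_num)).continuousOn
  have hlapK : ∀ x ∈ extClosed N, x ∉ K → extLaplacian N g x = 0 := fun x hx hxK =>
    extLaplacian_eq_zero_of_notMem hK.isClosed hgK hx hxK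
  -- `W n` vanishes near the sphere, so Green's identity holds for it without boundary terms. In the
  -- limit the singular factor in its Laplacian is compensated by `g = O(log ‖x‖)`, which gives a
  -- bounded majorant.
  set W : ℕ → ℝ → ℝ := fun n s => χ ((n + 1 : ℝ) * s) * w s with hW
  have hWs : ∀ n, ContDiff ℝ ∞ (W n) := fun n => by fun_prop
  have hint : ∀ {v : ℝ → ℝ}, Continuous v →
      IntegrableOn (fun x => radialLift N v x * extLaplacian N g x) (extClosed N) := fun hv =>
    integrableOn_extClosed_of_continuousOn ((continuousOn_radialLift hv).mul hlap) hK
      fun x hx hxK => by rw [hlapK x hx hxK, mul_zero]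
  have hint' : ∀ {v : ℝ → ℝ}, Continuous v →
      IntegrableOn (fun x => radialLift N v x * g x) (extClosed N) := fun hv =>
    integrableOn_extClosed_of_continuousOn ((continuousOn_radialLift hv).mul hg.continuousOn) hK
      fun x hx hxK => by rw [hgK x hx hxK, mul_zero]
  have hgreen : ∀ n, ∫ x in extClosed N, radialLift N (W n) x * extLaplacian N g x
      = ∫ x in extClosed N, radialLift N (logLap N (W n)) x * g x := by
    intro n
    have hn : (0 : ℝ) < n + 1 := by positivity
    have hWz : ∀ s ≤ (1 : ℝ) / (n + 1), W n s = 0 := fun s hs => by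
      rw [le_div_iff₀ hn] at hs
      simp only [hW]
      rw [hχz _ (by linarith), zero_mul]
    have h0 := integral_green_of_vanishing (a := 1 / (n + 1 : ℝ)) (by positivity) (hWs n) hWz
      (hg.mono (extDomain_subset_extClosed N)) hK
      (fun x hx => hgK x (extDomain_subset_extClosed N hx))
    rw [← setIntegral_eq_integral_of_forall_compl_eq_zero (s := extDomain N)] at h0
    · rw [← sub_eq_zero, ← integral_sub (hint (hWs n).continuous)
        (hint' (contDiff_logLap (hWs n)).continuous), ← h0,
        setIntegral_congr_set (extClosed_ae_eq_extDomain hN)]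
      refine setIntegral_congr_fun (isOpen_extDomain N).measurableSet fun x hx => ?_
      rw [extLaplacian_eq N g hx, laplacian_radialLift (contDiff_two_of_infty (hWs n))
        (ne_zero_of_mem_extClosed (extDomain_subset_extClosed N hx))]
      ring
    · intro x hx
      have hx1 : ‖x‖ ≤ 1 := not_lt.1 hx
      have hopen : {y : EuclideanSpace ℝ (Fin N) | ‖y‖ < Real.exp (1 / (n + 1))} ∈ 𝓝 x :=
        (isOpen_lt continuous_norm continuous_const).mem_nhds
          (hx1.trans_lt (Real.one_lt_exp_iff.2 (by positivity)))
      have hev : radialLift N (W n) =ᶠ[𝓝 x] fun _ => 0 := by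
        filter_upwards [hopen] with y hy
        refine hWz _ ?_
        rcases (norm_nonneg y).eq_or_lt with h | h
        · rw [← h, Real.log_zero]; positivity
        · exact ((Real.log_lt_iff_lt_exp h).2 hy).le
      have h1 : (Δ (radialLift N (W n))) x = 0 := by
        rw [(InnerProductSpace.laplacian_congr_nhds hev).self_of_nhds]
        exact congrFun InnerProductSpace.laplacian_const x
      rw [h1, hev.self_of_nhds]
      ring
  have hae : ∀ᵐ x ∂(volume.restrict (extClosed N)), x ∈ extDomain N := by
    rw [Measure.restrict_congr_set (extClosed_ae_eq_extDomain hN)]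
    exact ae_restrict_mem (isOpen_extDomain N).measurableSet
  have hlarge : ∀ s : ℝ, 0 < s → ∀ᶠ n : ℕ in Filter.atTop, W n =ᶠ[𝓝 s] w := fun s hs => by
    have h1 : ∀ᶠ n : ℕ in Filter.atTop, 2 / (s / 2) ≤ (n : ℝ) :=
      tendsto_natCast_atTop_atTop.eventually_ge_atTop _
    filter_upwards [h1] with n hn
    filter_upwards [Ioi_mem_nhds (show s / 2 < s by linarith)] with y hy
    have hy' : s / 2 < y := hy
    simp only [hW]
    rw [hχo, one_mul]
    rw [div_le_iff₀ (by linarith)] at hn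
    nlinarith
  have hlim1 : Filter.Tendsto (fun n => ∫ x in extClosed N, radialLift N (W n) x
      * extLaplacian N g x) Filter.atTop
      (𝓝 (∫ x in extClosed N, radialLift N w x * extLaplacian N g x)) := by
    refine tendsto_integral_of_dominated_convergence
      (fun x => |radialLift N w x * extLaplacian N g x|)
      (fun n => (hint (hWs n).continuous).aestronglyMeasurable) (hint hw.continuous).abs ?_ ?_
    · refine fun n => Filter.Eventually.of_forall fun x => ?_
      simp only [radialLift, hW, Real.norm_eq_abs, mul_assoc]
      rw [abs_mul, abs_of_nonneg (hχ0 _)]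
      exact mul_le_of_le_one_left (abs_nonneg _) (hχ1 _)
    · filter_upwards [hae] with x hx
      refine tendsto_const_nhds.congr' ?_
      filter_upwards [hlarge _ (Real.log_pos hx)] with n hn
      simp only [radialLift]
      rw [hn.self_of_nhds]
  have hlim2 : Filter.Tendsto (fun n => ∫ x in extClosed N, radialLift N (logLap N (W n)) x * g x)
      Filter.atTop (𝓝 (∫ x in extClosed N, radialLift N (logLap N w) x * g x)) := by
    have hb : IntegrableOn (fun _ : EuclideanSpace ℝ (Fin N) => C * D) K :=
      integrableOn_const hK.measure_lt_top.ne
    refine tendsto_integral_of_dominated_convergence (K.indicator fun _ => C * D)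
      (fun n => (hint' (contDiff_logLap (hWs n)).continuous).aestronglyMeasurable)
      (hb.integrable_indicator hK.isClosed.measurableSet).restrict ?_ ?_
    · intro n
      filter_upwards [hae] with x hx
      have hxc := extDomain_subset_extClosed N hx
      have hs : 0 < Real.log ‖x‖ := Real.log_pos hx
      by_cases hxK : x ∈ K
      · rw [indicator_of_mem hxK, norm_mul, Real.norm_eq_abs, Real.norm_eq_abs]
        have hxR : Real.log ‖x‖ ≤ Real.log R := by
          have h1 : ‖x‖ ≤ R := mem_closedBall_zero_iff.1 (hR hxK)
          exact Real.log_le_log (zero_lt_one.trans hx) h1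
        calc |radialLift N (logLap N (W n)) x| * |g x|
            ≤ |radialLift N (logLap N (W n)) x| * (D * Real.log ‖x‖) := by
              gcongr; exact hD x hxc
          _ = (|logLap N (W n) (Real.log ‖x‖)| * Real.log ‖x‖) * D := by
              simp only [radialLift]; ring
          _ ≤ C * D := by gcongr; exact hC _ _ hs hxR
      · rw [indicator_of_notMem hxK, hgK x hxc hxK]
        simp
    · filter_upwards [hae] with x hx
      refine tendsto_const_nhds.congr' ?_
      filter_upwards [hlarge _ (Real.log_pos hx)] with n hn
      simp only [radialLift, logLap]
      rw [hn.deriv.self_of_nhds, hn.deriv.deriv.self_of_nhds]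
  simp only [hgreen] at hlim1
  exact tendsto_nhds_unique hlim1 hlim2

/-- Green's identity is applied to the pair `w`, `Δg` and then to the pair `Δw`, `g`. The four
Navier conditions are exactly the vanishing on the sphere needed in these two steps. -/
theorem integral_radialLift_mul_hardyRellich {N : ℕ} (hN : 5 ≤ N) {μ : ℝ} {w : ℝ → ℝ}
    (hw : ContDiff ℝ ∞ w) (hw0 : w 0 = 0) (hw2 : logLap N w 0 = 0)
    {g : EuclideanSpace ℝ (Fin N) → ℝ} (hg : ContDiffOn ℝ 4 g (extClosed N))
    (hg0 : ∀ x ∈ unitSphere N, g x = 0) (hg2 : ∀ x ∈ unitSphere N, extLaplacian N g x = 0)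
    {K : Set (EuclideanSpace ℝ (Fin N))} (hK : IsCompact K)
    (hgK : ∀ x ∈ extClosed N, x ∉ K → g x = 0) :
    ∫ x in extClosed N, radialLift N w x * hardyRellich N μ g x
      = ∫ x in extClosed N, hardyRellich N μ (radialLift N w) x * g x := by
  have hlap : ContDiffOn ℝ 2 (extLaplacian N g) (extClosed N) :=
    contDiffOn_extLaplacian hg (by norm_num)
  have hlap2 : ContinuousOn (extLaplacian N (extLaplacian N g)) (extClosed N) :=
    (contDiffOn_extLaplacian (m := 0) hlap (by norm_num)).continuousOn
  have hlapK : ∀ x ∈ extClosed N, x ∉ K → extLaplacian N g x = 0 := fun x hx hxK =>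
    extLaplacian_eq_zero_of_notMem hK.isClosed hgK hx hxK
  have hlap2K : ∀ x ∈ extClosed N, x ∉ K → extLaplacian N (extLaplacian N g) x = 0 :=
    fun x hx hxK => extLaplacian_eq_zero_of_notMem hK.isClosed hlapK hx hxK
  have h1 := integral_radialLift_mul_extLaplacian hN hw hw0 hlap hg2 hK hlapK
  have h2 := integral_radialLift_mul_extLaplacian hN (contDiff_logLap hw) hw2
    (hg.of_le (by norm_num)) hg0 hK hgK
  have hpot : ContinuousOn (fun x : EuclideanSpace ℝ (Fin N) => μ / ‖x‖ ^ 4) (extClosed N) :=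
    continuousOn_const.div (by fun_prop) fun x hx =>
      pow_ne_zero 4 (norm_ne_zero_iff.2 (ne_zero_of_mem_extClosed hx))
  have hwc := continuousOn_radialLift (N := N) hw.continuous
  have i0 : IntegrableOn (fun x => radialLift N w x * (μ / ‖x‖ ^ 4 * g x)) (extClosed N) :=
    integrableOn_extClosed_of_continuousOn (hwc.mul (hpot.mul hg.continuousOn)) hK
      fun x hx hxK => by rw [hgK x hx hxK]; simp
  have i1 : IntegrableOn (fun x => radialLift N w x * extLaplacian N (extLaplacian N g) x)
      (extClosed N) :=
    integrableOn_extClosed_of_continuousOn (hwc.mul hlap2) hK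
      fun x hx hxK => by rw [hlap2K x hx hxK, mul_zero]
  have i2 : IntegrableOn (fun x => radialLift N (logLap N (logLap N w)) x * g x) (extClosed N) :=
    integrableOn_extClosed_of_continuousOn ((continuousOn_radialLift
      (contDiff_logLap (contDiff_logLap hw)).continuous).mul hg.continuousOn) hK
      fun x hx hxK => by rw [hgK x hx hxK, mul_zero]
  calc ∫ x in extClosed N, radialLift N w x * hardyRellich N μ g x
      = (∫ x in extClosed N, radialLift N w x * extLaplacian N (extLaplacian N g) x)
        - ∫ x in extClosed N, radialLift N w x * (μ / ‖x‖ ^ 4 * g x) := by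
        rw [← integral_sub i1 i0]
        refine integral_congr_ae (Filter.Eventually.of_forall fun x => ?_)
        simp only [hardyRellich]
        ring
    _ = (∫ x in extClosed N, radialLift N (logLap N (logLap N w)) x * g x)
        - ∫ x in extClosed N, radialLift N w x * (μ / ‖x‖ ^ 4 * g x) := by rw [h1, h2]
    _ = _ := by
        rw [← integral_sub i2 i0]
        refine setIntegral_congr_fun (measurableSet_extClosed N) fun x hx => ?_
        simp only [hardyRellich_radialLift hw hx]
        ring

/-! ### Weak form of the stationary equation. -/

theorem fderivWithin_iteratedFDerivWithin_apply {N k : ℕ} {v : EuclideanSpace ℝ (Fin N) → ℝ}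
    {x : EuclideanSpace ℝ (Fin N)} {n : WithTop ℕ∞} (hv : ContDiffOn ℝ n v (extClosed N))
    (hk : (k : WithTop ℕ∞) < n) (hx : x ∈ extClosed N) {ι : Type*} (I : Finset ι)
    (m : ι → Fin k → EuclideanSpace ℝ (Fin N)) (e : EuclideanSpace ℝ (Fin N)) :
    fderivWithin ℝ (fun y => ∑ i ∈ I, iteratedFDerivWithin ℝ k v (extClosed N) y (m i))
      (extClosed N) x e
      = ∑ i ∈ I, iteratedFDerivWithin ℝ (k + 1) v (extClosed N) x (Fin.cons e (m i)) := by
  have hd := (hv.differentiableOn_iteratedFDerivWithin hk (uniqueDiffOn_extClosed N) x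
    hx).hasFDerivWithinAt
  have h := HasFDerivWithinAt.fun_sum fun i (_ : i ∈ I) =>
    hd.continuousMultilinear_apply_const (m i)
  rw [h.fderivWithin (uniqueDiffOn_extClosed N x hx), _root_.sum_apply]
  refine Finset.sum_congr rfl fun i _ => ?_
  rw [iteratedFDerivWithin_succ_apply_left]
  rfl

/-- Test functions are only known to have jointly continuous iterated derivatives in `(t, x)`.
Writing the bilaplacian through the fourth one transfers that continuity to it. -/
theorem extLaplacian_extLaplacian_eq_sum {N : ℕ} {v : EuclideanSpace ℝ (Fin N) → ℝ}
    (hv : ContDiffOn ℝ 4 v (extClosed N)) {x : EuclideanSpace ℝ (Fin N)} (hx : x ∈ extClosed N) :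
    extLaplacian N (extLaplacian N v) x
      = ∑ i, ∑ j, iteratedFDerivWithin ℝ 4 v (extClosed N) x
        (Fin.cons (stdOrthonormalBasis ℝ (EuclideanSpace ℝ (Fin N)) i)
          (Fin.cons (stdOrthonormalBasis ℝ (EuclideanSpace ℝ (Fin N)) i)
            ![stdOrthonormalBasis ℝ (EuclideanSpace ℝ (Fin N)) j,
              stdOrthonormalBasis ℝ (EuclideanSpace ℝ (Fin N)) j])) := by
  set b := stdOrthonormalBasis ℝ (EuclideanSpace ℝ (Fin N))
  have hu := uniqueDiffOn_extClosed N
  set h : EuclideanSpace ℝ (Fin N) → ℝ := fun y =>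
    ∑ j, iteratedFDerivWithin ℝ 2 v (extClosed N) y ![b j, b j] with hh
  have hhs : ContDiffOn ℝ 2 h (extClosed N) :=
    (contDiffOn_extLaplacian (m := 2) hv (by norm_num)).congr fun y hy =>
      (extLaplacian_eq_sum v hy).symm
  rw [extLaplacian_congr (fun y hy => extLaplacian_eq_sum v hy) hx, extLaplacian_eq_sum _ hx]
  refine Finset.sum_congr rfl fun i _ => ?_
  rw [iteratedFDerivWithin_two_apply _ hu hx]
  simp only [Matrix.cons_val_zero, Matrix.cons_val_one]
  change fderivWithin ℝ (fderivWithin ℝ h (extClosed N)) (extClosed N) x (b i) (b i) = _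
  have hd : HasFDerivWithinAt (fderivWithin ℝ h (extClosed N))
      (fderivWithin ℝ (fderivWithin ℝ h (extClosed N)) (extClosed N) x) (extClosed N) x :=
    ((hhs.fderivWithin hu (m := 1) (by norm_num)).differentiableOn (by norm_num) x
      hx).hasFDerivWithinAt
  have hde : HasFDerivWithinAt (fun y => fderivWithin ℝ h (extClosed N) y (b i))
      ((fderivWithin ℝ (fderivWithin ℝ h (extClosed N)) (extClosed N) x).flip (b i))
      (extClosed N) x := by
    simpa using hd.clm_apply (hasFDerivWithinAt_const (b i) x (extClosed N))
  have h3 := hde.fderivWithin (hu x hx)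
  rw [fderivWithin_congr (f₁ := fun y => fderivWithin ℝ h (extClosed N) y (b i))
    (f := fun y => ∑ j, iteratedFDerivWithin ℝ 3 v (extClosed N) y (Fin.cons (b i) ![b j, b j]))
    (fun y hy => fderivWithin_iteratedFDerivWithin_apply hv (by norm_num) hy _ _ _)
    (fderivWithin_iteratedFDerivWithin_apply hv (by norm_num) hx _ _ _)] at h3
  have h4 := congrArg (fun A : EuclideanSpace ℝ (Fin N) →L[ℝ] ℝ => A (b i)) h3
  simp only [ContinuousLinearMap.flip_apply] at h4
  rw [← h4, fderivWithin_iteratedFDerivWithin_apply hv (by norm_num) hx]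

theorem IsCc14.continuousOn {N : ℕ} {φ : ℝ × EuclideanSpace ℝ (Fin N) → ℝ} (hφ : IsCc14 N φ) :
    ContinuousOn φ (spaceTime N) := by
  have h := hφ.cont_x 0 (by norm_num)
  have h2 := (ContinuousMultilinearMap.apply ℝ (fun _ : Fin 0 => EuclideanSpace ℝ (Fin N)) ℝ
    0).continuous.comp_continuousOn h
  exact h2.congr fun z _ => by simp

theorem IsCc14.continuousOn_hardyRellich {N : ℕ} {μ : ℝ}
    {φ : ℝ × EuclideanSpace ℝ (Fin N) → ℝ} (hφ : IsCc14 N φ) :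
    ContinuousOn (fun z => hardyRellich N μ (fun y => φ (z.1, y)) z.2) (spaceTime N) := by
  have h := hφ.cont_x 4 le_rfl
  have hpot : ContinuousOn (fun z : ℝ × EuclideanSpace ℝ (Fin N) => μ / ‖z.2‖ ^ 4)
      (spaceTime N) :=
    continuousOn_const.div (by fun_prop) fun z hz =>
      pow_ne_zero 4 (norm_ne_zero_iff.2 (ne_zero_of_mem_extClosed hz.2))
  refine ContinuousOn.sub ?_ (hpot.mul hφ.continuousOn)
  refine ContinuousOn.congr (f := fun z : ℝ × EuclideanSpace ℝ (Fin N) => ∑ i, ∑ j,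
    iteratedFDerivWithin ℝ 4 (fun y => φ (z.1, y)) (extClosed N) z.2
        (Fin.cons (stdOrthonormalBasis ℝ (EuclideanSpace ℝ (Fin N)) i)
          (Fin.cons (stdOrthonormalBasis ℝ (EuclideanSpace ℝ (Fin N)) i)
            ![stdOrthonormalBasis ℝ (EuclideanSpace ℝ (Fin N)) j,
              stdOrthonormalBasis ℝ (EuclideanSpace ℝ (Fin N)) j]))) ?_
    fun z hz => extLaplacian_extLaplacian_eq_sum (hφ.diff_x z.1 hz.1) hz.2
  refine continuousOn_finsetSum _ fun i _ => continuousOn_finsetSum _ fun j _ => ?_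
  exact (ContinuousMultilinearMap.apply ℝ (fun _ : Fin 4 => EuclideanSpace ℝ (Fin N)) ℝ
    (Fin.cons (stdOrthonormalBasis ℝ (EuclideanSpace ℝ (Fin N)) i)
          (Fin.cons (stdOrthonormalBasis ℝ (EuclideanSpace ℝ (Fin N)) i)
            ![stdOrthonormalBasis ℝ (EuclideanSpace ℝ (Fin N)) j,
              stdOrthonormalBasis ℝ (EuclideanSpace ℝ (Fin N)) j]))).continuous.comp_continuousOn h

theorem integrableOn_spaceTime_of_continuousOn {N : ℕ}
    {b : ℝ × EuclideanSpace ℝ (Fin N) → ℝ} (hb : ContinuousOn b (spaceTime N))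
    {C : Set (ℝ × EuclideanSpace ℝ (Fin N))} (hC : IsCompact C) (hCD : C ⊆ spaceTime N)
    (hbC : ∀ z ∈ spaceTime N, z ∉ C → b z = 0) : IntegrableOn b (spaceTime N) :=
  IntegrableOn.of_forall_sdiff_eq_zero ((hb.mono hCD).integrableOn_compact hC)
    (measurableSet_spaceTime N) fun z hz => hbC z hz.1 hz.2

/-- Nothing is known about `φ` for `t ≤ 0`. Since the support is compact in `(0,∞)`, extension by
zero is `C¹` on the line and the integral of its derivative vanishes. -/
theorem integral_deriv_eq_zero_of_support {φ : ℝ → ℝ} (hd : ∀ t > 0, DifferentiableAt ℝ φ t)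
    (hc : ContinuousOn (deriv φ) (Ioi 0)) {T : Set ℝ} (hT : IsCompact T) (hTs : T ⊆ Ioi 0)
    (hφT : ∀ t > 0, t ∉ T → φ t = 0) : ∫ t in Ioi 0, deriv φ t = 0 := by
  set ψ : ℝ → ℝ := (Ioi 0).indicator φ with hψ
  set ψ' : ℝ → ℝ := (Ioi 0).indicator (deriv φ) with hψ'
  have hpos : ∀ t > 0, ψ =ᶠ[𝓝 t] φ := fun t ht => by
    filter_upwards [Ioi_mem_nhds ht] with s hs using indicator_of_mem hs _
  have hpos' : ∀ t > 0, ψ' =ᶠ[𝓝 t] deriv φ := fun t ht => by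
    filter_upwards [Ioi_mem_nhds ht] with s hs using indicator_of_mem hs _
  have hz : ∀ t ∉ T, ψ t = 0 := fun t ht => by
    by_cases h0 : t ∈ Ioi 0
    · rw [hψ, indicator_of_mem h0, hφT t h0 ht]
    · exact indicator_of_notMem h0 _
  have hzev : ∀ t ∉ T, ψ =ᶠ[𝓝 t] fun _ => 0 := fun t ht => by
    filter_upwards [hT.isClosed.isOpen_compl.mem_nhds ht] with s hs using hz s hs
  have hz' : ∀ t ∉ T, ψ' t = 0 := fun t ht => by
    by_cases h0 : t ∈ Ioi 0
    · rw [hψ', indicator_of_mem h0, ← (hpos t h0).deriv_eq, (hzev t ht).deriv_eq, deriv_const]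
    · exact indicator_of_notMem h0 _
  have hderiv : ∀ t, HasDerivAt ψ (ψ' t) t := fun t => by
    by_cases ht : t ∈ T
    · have h0 := hTs ht
      rw [hψ', indicator_of_mem h0]
      exact (hd t h0).hasDerivAt.congr_of_eventuallyEq (hpos t h0)
    · rw [hz' t ht]
      exact (hasDerivAt_const t (0 : ℝ)).congr_of_eventuallyEq (hzev t ht)
  have hcont' : Continuous ψ' := continuous_iff_continuousAt.2 fun t => by
    by_cases ht : t ∈ T
    · have h0 := hTs ht
      exact (hc.continuousAt (Ioi_mem_nhds h0)).congr (hpos' t h0).symm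
    · have : ψ' =ᶠ[𝓝 t] fun _ => 0 := by
        filter_upwards [hT.isClosed.isOpen_compl.mem_nhds ht] with s hs using hz' s hs
      exact continuousAt_const.congr this.symm
  have hcont : Continuous ψ := continuous_iff_continuousAt.2 fun t => (hderiv t).continuousAt
  have h := integral_eq_zero_of_hasDerivAt_of_integrable hderiv
    (hcont'.integrable_of_hasCompactSupport (HasCompactSupport.intro hT hz'))
    (hcont.integrable_of_hasCompactSupport (HasCompactSupport.intro hT hz))
  rwa [hψ', integral_indicator measurableSet_Ioi] at h

theorem continuousOn_hardyRellich_radialLift {N : ℕ} {μ : ℝ} {w : ℝ → ℝ} (hw : ContDiff ℝ ∞ w) :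
    ContinuousOn (hardyRellich N μ (radialLift N w)) (extClosed N) := by
  have h4 : ContDiffOn ℝ 4 (radialLift N w) (extClosed N) :=
    contDiffOn_radialLift (by exact_mod_cast contDiff_infty.1 hw 4)
  have h2 : ContDiffOn ℝ 2 (extLaplacian N (radialLift N w)) (extClosed N) :=
    contDiffOn_extLaplacian h4 (by norm_num)
  have hpot : ContinuousOn (fun x : EuclideanSpace ℝ (Fin N) => μ / ‖x‖ ^ 4) (extClosed N) :=
    continuousOn_const.div (by fun_prop) fun x hx =>
      pow_ne_zero 4 (norm_ne_zero_iff.2 (ne_zero_of_mem_extClosed hx))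
  exact (contDiffOn_extLaplacian (m := 0) h2 (by norm_num)).continuousOn.sub
    (hpot.mul h4.continuousOn)

/-- A smooth radial function with Navier boundary conditions satisfies the integrated form of the
stationary equation against all test functions. -/
theorem radialLift_weak_identity {N : ℕ} (hN : 5 ≤ N) {μ : ℝ} {w : ℝ → ℝ}
    (hw : ContDiff ℝ ∞ w) (hw0 : w 0 = 0) (hw2 : logLap N w 0 = 0)
    {φ : ℝ × EuclideanSpace ℝ (Fin N) → ℝ} (hφ : IsTestFunction N φ) :
    (∫ z in spaceTime N, radialLift N w z.2 * deriv (fun s => φ (s, z.2)) z.1) = 0 ∧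
    (∫ z in spaceTime N, radialLift N w z.2 * hardyRellich N μ (fun y => φ (z.1, y)) z.2)
      = ∫ z in spaceTime N, hardyRellich N μ (radialLift N w) z.2 * φ z := by
  obtain ⟨C, hC, hCD, hφC⟩ := hφ.regular.compact_supp
  have hwc : ContinuousOn (fun z : ℝ × EuclideanSpace ℝ (Fin N) => radialLift N w z.2)
      (spaceTime N) :=
    (continuousOn_radialLift hw.continuous).comp continuousOn_snd fun z hz => hz.2
  set K := Prod.snd '' C with hK
  have hKc : IsCompact K := hC.image continuous_snd
  set T := Prod.fst '' C with hT
  have hTc : IsCompact T := hC.image continuous_fst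
  have hTs : T ⊆ Ioi 0 := by
    rintro _ ⟨z, hz, rfl⟩
    exact (hCD hz).1
  have hφK : ∀ t > 0, ∀ x ∈ extClosed N, x ∉ K → φ (t, x) = 0 := fun t ht x hx hxK =>
    hφC (t, x) ⟨ht, hx⟩ fun h => hxK ⟨_, h, rfl⟩
  have hφT : ∀ x ∈ extClosed N, ∀ t > 0, t ∉ T → φ (t, x) = 0 := fun x hx t ht htT =>
    hφC (t, x) ⟨ht, hx⟩ fun h => htT ⟨_, h, rfl⟩
  have hdC : ∀ z ∈ spaceTime N, z ∉ C → deriv (fun s => φ (s, z.2)) z.1 = 0 := by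
    rintro ⟨t, x⟩ hz hzC
    have hev : (fun s => φ (s, x)) =ᶠ[𝓝 t] fun _ => 0 := by
      have h1 : ∀ᶠ s in 𝓝 t, (s, x) ∉ C :=
        (Continuous.prodMk_left x).continuousAt.eventually (hC.isClosed.isOpen_compl.mem_nhds hzC)
      filter_upwards [h1, Ioi_mem_nhds hz.1] with s hs hs0
      exact hφC (s, x) ⟨hs0, hz.2⟩ hs
    rw [hev.deriv_eq, deriv_const]
  have hLC : ∀ z ∈ spaceTime N, z ∉ C → hardyRellich N μ (fun y => φ (z.1, y)) z.2 = 0 := by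
    rintro ⟨t, x⟩ hz hzC
    have hCt : IsClosed {y | (t, y) ∈ C} := hC.isClosed.preimage (Continuous.prodMk_right t)
    have h0 : ∀ y ∈ extClosed N, y ∉ {y | (t, y) ∈ C} → φ (t, y) = 0 := fun y hy hyC =>
      hφC (t, y) ⟨hz.1, hy⟩ hyC
    have h1 : extLaplacian N (extLaplacian N fun y => φ (t, y)) x = 0 :=
      extLaplacian_eq_zero_of_notMem hCt
        (fun y hy hyC => extLaplacian_eq_zero_of_notMem hCt h0 hy hyC) hz.2 hzC
    simp only [hardyRellich]
    rw [h1, h0 x hz.2 hzC]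
    ring
  have i1 : IntegrableOn (fun z => radialLift N w z.2 * deriv (fun s => φ (s, z.2)) z.1)
      (spaceTime N) := integrableOn_spaceTime_of_continuousOn (hwc.mul hφ.regular.cont_t) hC hCD
    fun z hz hzC => mul_eq_zero_of_right _ (hdC z hz hzC)
  have i2 : IntegrableOn (fun z => radialLift N w z.2
      * hardyRellich N μ (fun y => φ (z.1, y)) z.2) (spaceTime N) := integrableOn_spaceTime_of_continuousOn
    (hwc.mul (hφ.regular.continuousOn_hardyRellich (μ := μ))) hC hCD
    fun z hz hzC => mul_eq_zero_of_right _ (hLC z hz hzC)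
  have hLw := continuousOn_hardyRellich_radialLift (N := N) (μ := μ) hw
  have i3 : IntegrableOn (fun z => hardyRellich N μ (radialLift N w) z.2 * φ z)
      (spaceTime N) := integrableOn_spaceTime_of_continuousOn
    ((hLw.comp continuousOn_snd fun z (hz : z ∈ spaceTime N) => hz.2).mul
      hφ.regular.continuousOn) hC hCD
    fun z hz hzC => mul_eq_zero_of_right _ (hφC z hz hzC)
  constructor
  · rw [IntegrableOn, spaceTime_measure] at i1
    rw [spaceTime_measure, integral_prod_symm _ i1]
    refine (setIntegral_congr_fun (g := fun _ => (0 : ℝ)) (measurableSet_extClosed N)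
      fun x hx => ?_).trans (by simp)
    simp only
    rw [integral_const_mul, integral_deriv_eq_zero_of_support
      (fun t ht => hφ.regular.diff_t t ht x hx) ?_ hTc hTs (hφT x hx), mul_zero]
    exact hφ.regular.cont_t.comp (f := fun t : ℝ => (t, x)) (by fun_prop) fun t ht => ⟨ht, hx⟩
  · rw [IntegrableOn, spaceTime_measure] at i2 i3
    rw [spaceTime_measure, integral_prod _ i2]
    refine Eq.trans ?_ (integral_prod _ i3).symm
    refine setIntegral_congr_fun measurableSet_Ioi fun t ht => ?_
    exact integral_radialLift_mul_hardyRellich (g := fun y => φ (t, y)) hN hw hw0 hw2 (hφ.regular.diff_x t ht)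
      (hφ.dirichlet t ht) (hφ.navier t ht) hKc (hφK t ht)

/-! ### The supersolution and existence. -/

/-- Profiles must be smooth on all of `ℝ`, so the argument of the logarithm is blended with the
constant `1` for negative `s`. Agreement on a neighbourhood of `[0,∞)` makes the derivatives at `0`
the right ones. -/
theorem exists_smooth_log : ∃ m : ℝ → ℝ, ContDiff ℝ ∞ m ∧
    ∀ s, -(1 / 2) < s → m s = Real.log (s + 2) := by
  set T : ℝ → ℝ := fun s => Real.smoothTransition (2 * s + 2) with hT
  have hTs : ContDiff ℝ ∞ T := Real.smoothTransition.contDiff.comp (by fun_prop)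
  have hG : ContDiff ℝ ∞ (fun s => (s + 2) * T s + (1 - T s)) := by fun_prop
  refine ⟨fun s => Real.log ((s + 2) * T s + (1 - T s)), hG.log fun s => ?_, fun s hs => ?_⟩
  · have h0 : 0 ≤ T s := Real.smoothTransition.nonneg _
    have h1 : T s ≤ 1 := Real.smoothTransition.le_one _
    rcases le_or_gt s (-1) with h | h
    · have : T s = 0 := Real.smoothTransition.zero_of_nonpos (by linarith)
      rw [this]; norm_num
    · have : 1 ≤ (s + 2) * T s + (1 - T s) := by nlinarith
      linarith
  · have : T s = 1 := Real.smoothTransition.one_of_one_le (by linarith)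
    simp only [this]
    ring_nf

/-- The profile `e^{-νs}(log (s+2) + B) - C e^{-τs}`: it satisfies the Navier conditions and is
a strict supersolution. -/
theorem exists_supersolution_profile {N : ℕ} (hN : 5 ≤ N) {μ ν τ : ℝ} (hν : 0 ≤ ν)
    (hνN : ν ≤ ((N : ℝ) - 2) / 2) (hντ : ν < τ) (hτ : 2 < τ)
    (hθ : 2 * ((N : ℝ) - 2) ≤ τ ^ 2 - ν ^ 2)
    (hsum : ν ^ 2 + τ ^ 2 = 2 * ((N : ℝ) * (N - 4) / 4) + 4)
    (hprod : ν ^ 2 * τ ^ 2 = ((N : ℝ) * (N - 4) / 4) ^ 2 - μ) :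
    ∃ w : ℝ → ℝ, ContDiff ℝ ∞ w ∧ w 0 = 0 ∧ deriv (deriv w) 0 + 2 * deriv w 0 = 0 ∧
      (∀ s, 0 ≤ s → Real.exp (-ν * s) * (1 / (s + 2) ^ 2) ≤ emdenFowler N μ w s) ∧
      ∃ K : ℝ, 0 ≤ K ∧ ∀ s, 0 ≤ s → |w s| ≤ K * (Real.exp (-ν * s) * (s + 2)) := by
  have hN' : (5 : ℝ) ≤ N := by exact_mod_cast hN
  obtain ⟨m, hm, hmlog⟩ := exists_smooth_log
  have hm1 := contDiff_deriv_infty hm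
  have hm2 := contDiff_deriv_infty hm1
  have hm3 := contDiff_deriv_infty hm2
  have hev : ∀ s, -(1 / 2) < s → m =ᶠ[𝓝 s] fun s => Real.log (s + 2) := fun s hs => by
    filter_upwards [Ioi_mem_nhds hs] with y hy using hmlog y hy
  have D1 : ∀ s, -(1 / 2) < s → deriv m s = (s + 2)⁻¹ := fun s hs => by
    rw [(hev s hs).deriv_eq]
    have := ((hasDerivAt_id s).add_const 2).log (by simp; linarith)
    simpa using this.deriv
  have hinv : ∀ s : ℝ, -(1 / 2) < s → HasDerivAt (fun s : ℝ => (s + 2)⁻¹) (-((s + 2)⁻¹) ^ 2) s :=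
    fun s hs => by
      have h0 : s + 2 ≠ 0 := by linarith
      have := ((hasDerivAt_id s).add_const 2).inv h0
      convert! this using 1
      simp only [id]
      field_simp
  have D2 : ∀ s, -(1 / 2) < s → deriv (deriv m) s = -((s + 2)⁻¹) ^ 2 := fun s hs => by
    have : deriv m =ᶠ[𝓝 s] fun s => (s + 2)⁻¹ := by
      filter_upwards [Ioi_mem_nhds hs] with y hy using D1 y hy
    rw [this.deriv_eq, (hinv s hs).deriv]
  have D3 : ∀ s, -(1 / 2) < s → deriv (deriv (deriv m)) s = 2 * ((s + 2)⁻¹) ^ 3 := fun s hs => by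
    have : deriv (deriv m) =ᶠ[𝓝 s] fun s => -((s + 2)⁻¹) ^ 2 := by
      filter_upwards [Ioi_mem_nhds hs] with y hy using D2 y hy
    rw [this.deriv_eq]
    refine HasDerivAt.deriv (((hinv s hs).pow 2).neg.congr_deriv ?_)
    push_cast
    ring
  have D4 : ∀ s, -(1 / 2) < s → deriv (deriv (deriv (deriv m))) s = -6 * ((s + 2)⁻¹) ^ 4 :=
    fun s hs => by
      have : deriv (deriv (deriv m)) =ᶠ[𝓝 s] fun s => 2 * ((s + 2)⁻¹) ^ 3 := by
        filter_upwards [Ioi_mem_nhds hs] with y hy using D3 y hy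
      rw [this.deriv_eq]
      refine HasDerivAt.deriv ((((hinv s hs).pow 3).const_mul 2).congr_deriv ?_)
      push_cast
      ring
  have hden : 0 < (τ - ν) * (ν + τ - 2) := mul_pos (by linarith) (by linarith)
  -- `w 0 = 0` gives `m 0 + B = C`; inserting this in `w'' + 2w' = 0` at `0` yields this linear
  -- equation for `C`, solvable because `τ > 2`.
  obtain ⟨C, hC⟩ : ∃ C : ℝ, C * ((τ - ν) * (ν + τ - 2))
      = deriv (deriv m) 0 + 2 * (1 - ν) * deriv m 0 := ⟨_, div_mul_cancel₀ _ hden.ne'⟩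
  set B := C - m 0 with hB
  have E : ∀ {a : ℝ → ℝ} {a' : ℝ} {s : ℝ}, HasDerivAt a a' s →
      HasDerivAt (fun s => Real.exp (-ν * s) * a s) (Real.exp (-ν * s) * (a' - ν * a s)) s := by
    intro a a' s ha
    convert! (hasDerivAt_exp_neg_mul ν s).mul ha using 1
    ring
  have Eτ : ∀ (c s : ℝ), HasDerivAt (fun s => c * Real.exp (-τ * s))
      (-τ * c * Real.exp (-τ * s)) s := fun c s => by
    convert! (hasDerivAt_exp_neg_mul τ s).const_mul c using 1
    ring
  have M0 : ∀ s, HasDerivAt m (deriv m s) s := hasDerivAt_of_contDiff_infty hm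
  have M1 := hasDerivAt_of_contDiff_infty hm1
  have M2 := hasDerivAt_of_contDiff_infty hm2
  have M3 := hasDerivAt_of_contDiff_infty hm3
  set w : ℝ → ℝ := fun s => Real.exp (-ν * s) * (m s + B) - C * Real.exp (-τ * s) with hw
  set w₁ : ℝ → ℝ := fun s => Real.exp (-ν * s) * (deriv m s - ν * (m s + B))
    - -τ * C * Real.exp (-τ * s) with hw₁
  set w₂ : ℝ → ℝ := fun s => Real.exp (-ν * s) * (deriv (deriv m) s - 2 * ν * deriv m s
    + ν ^ 2 * (m s + B)) - τ ^ 2 * C * Real.exp (-τ * s) with hw₂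
  set w₃ : ℝ → ℝ := fun s => Real.exp (-ν * s) * (deriv (deriv (deriv m)) s
    - 3 * ν * deriv (deriv m) s + 3 * ν ^ 2 * deriv m s - ν ^ 3 * (m s + B))
    - -τ ^ 3 * C * Real.exp (-τ * s) with hw₃
  set w₄ : ℝ → ℝ := fun s => Real.exp (-ν * s) * (deriv (deriv (deriv (deriv m))) s
    - 4 * ν * deriv (deriv (deriv m)) s + 6 * ν ^ 2 * deriv (deriv m) s
    - 4 * ν ^ 3 * deriv m s + ν ^ 4 * (m s + B)) - τ ^ 4 * C * Real.exp (-τ * s) with hw₄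
  have H₀ : ∀ s, HasDerivAt w (w₁ s) s := fun s => (E ((M0 s).add_const B)).sub (Eτ C s)
  have H₁ : ∀ s, HasDerivAt w₁ (w₂ s) s := fun s => by
    convert! (E ((M1 s).sub (((M0 s).add_const B).const_mul ν))).sub (Eτ (-τ * C) s) using 1
    simp only [hw₂, Pi.sub_apply]; ring
  have H₂ : ∀ s, HasDerivAt w₂ (w₃ s) s := fun s => by
    convert! (E (((M2 s).sub ((M1 s).const_mul (2 * ν))).add
      (((M0 s).add_const B).const_mul (ν ^ 2)))).sub (Eτ (τ ^ 2 * C) s) using 1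
    simp only [hw₃, Pi.sub_apply, Pi.add_apply]; ring
  have H₃ : ∀ s, HasDerivAt w₃ (w₄ s) s := fun s => by
    convert! (E ((((M3 s).sub ((M2 s).const_mul (3 * ν))).add
      ((M1 s).const_mul (3 * ν ^ 2))).sub (((M0 s).add_const B).const_mul (ν ^ 3)))).sub
      (Eτ (-τ ^ 3 * C) s) using 1
    simp only [hw₄, Pi.sub_apply, Pi.add_apply]; ring
  refine ⟨w, by fun_prop, ?_, ?_, fun s hs => ?_, |B| + 1 + |C|, by positivity, fun s hs => ?_⟩
  · simp [hw, hB]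
  · rw [deriv_eq_of_hasDerivAt H₀, deriv_eq_of_hasDerivAt H₁]
    simp only [hw₁, hw₂, mul_zero, Real.exp_zero, hB]
    linear_combination -hC
  · rw [emdenFowler_eq_zero_of_hasDerivAt H₀ H₁ H₂ H₃, ← hsum, ← hprod]
    have hs' : -(1 / 2) < s := by linarith
    simp only [hw, hw₂, hw₄]
    rw [D1 s hs', D2 s hs', D3 s hs', D4 s hs']
    set y := (s + 2)⁻¹ with hy
    have hy0 : 0 < y := by positivity
    have hy2 : y ≤ 1 / 2 := by
      rw [hy, inv_le_comm₀ (by linarith) (by norm_num)]; linarith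
    have e1 : 1 / (s + 2) ^ 2 = y ^ 2 := by rw [hy, inv_pow, one_div]
    rw [e1]
    have hyy : y ^ 2 ≤ 1 / 4 := by nlinarith
    -- The right side is `e^{νs}` times the operator applied to `w`: the constant `B` and the
    -- `e^{-τs}` term are annihilated, leaving derivatives of the logarithm, with `y = 1/(s+2)`. The
    -- spectral gap and `ν ≤ (N-2)/2` control the negative terms; for `ν = 0` the bound rests on the
    -- `y²` and `y⁴` terms alone.
    have key : y ^ 2 ≤ (τ ^ 2 - ν ^ 2) * y ^ 2 - 6 * y ^ 4
        + ν * y * (2 * (τ ^ 2 - ν ^ 2) - 8 * y ^ 2 - 4 * ν * y) := by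
      have k1 : 0 ≤ ν * y * (2 * (τ ^ 2 - ν ^ 2) - 8 * y ^ 2 - 4 * ν * y) := by
        refine mul_nonneg (by positivity) ?_
        nlinarith
      have k2 : y ^ 4 ≤ 1 / 4 * y ^ 2 := by
        have : y ^ 4 = y ^ 2 * y ^ 2 := by ring
        rw [this]
        gcongr
      have k3 : 6 * y ^ 2 ≤ (τ ^ 2 - ν ^ 2) * y ^ 2 := by
        gcongr; linarith
      have k4 : 0 ≤ y ^ 2 := by positivity
      linarith
    refine (mul_le_mul_of_nonneg_left key (Real.exp_pos (-ν * s)).le).trans (le_of_eq ?_)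
    ring
  · have hlog : 0 ≤ m s ∧ m s ≤ s + 2 := by
      rw [hmlog s (by linarith)]
      exact ⟨Real.log_nonneg (by linarith), (Real.log_le_sub_one_of_pos (by linarith)).trans
        (by linarith)⟩
    have hexp : Real.exp (-τ * s) ≤ Real.exp (-ν * s) := Real.exp_le_exp.2 (by nlinarith)
    have h2 : 1 ≤ s + 2 := by linarith
    have hE := Real.exp_pos (-ν * s)
    have hE' := Real.exp_pos (-τ * s)
    calc |w s| ≤ |Real.exp (-ν * s) * (m s + B)| + |C * Real.exp (-τ * s)| := abs_sub _ _
      _ = Real.exp (-ν * s) * |m s + B| + |C| * Real.exp (-τ * s) := by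
          rw [abs_mul, abs_mul, abs_of_pos hE, abs_of_pos hE']
      _ ≤ Real.exp (-ν * s) * ((s + 2) + |B| * (s + 2))
          + |C| * (Real.exp (-ν * s) * (s + 2)) := by
          gcongr
          · refine (abs_add_le _ _).trans (add_le_add ?_ (le_mul_of_one_le_right (abs_nonneg _) h2))
            rw [abs_of_nonneg hlog.1]
            exact hlog.2
          · exact hexp.trans (le_mul_of_one_le_right hE.le h2)
      _ = _ := by ring

theorem exists_exp_rpow_bound {β r : ℝ} (hβ : 0 < β) : ∃ M : ℝ, 0 ≤ M ∧ ∀ s, 0 ≤ s →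
    Real.exp (-β * s) * (s + 2) ^ r ≤ M := by
  obtain ⟨n, hn⟩ := exists_nat_ge r
  refine ⟨n.factorial * Real.exp (2 * β) / β ^ n, by positivity, fun s hs => ?_⟩
  have h1 := Real.pow_div_factorial_le_exp (x := β * (s + 2)) (by positivity) n
  have h2 : (s + 2) ^ r ≤ (s + 2) ^ n := by
    rw [← Real.rpow_natCast]
    exact Real.rpow_le_rpow_of_exponent_le (by linarith) hn
  rw [div_le_iff₀ (by positivity), mul_pow] at h1
  rw [le_div_iff₀ (by positivity)]
  calc Real.exp (-β * s) * (s + 2) ^ r * β ^ n ≤ Real.exp (-β * s) * (s + 2) ^ n * β ^ n := by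
        gcongr
    _ = Real.exp (-β * s) * (β ^ n * (s + 2) ^ n) := by ring
    _ ≤ Real.exp (-β * s) * (Real.exp (β * (s + 2)) * n.factorial) := by gcongr
    _ = n.factorial * (Real.exp (-β * s) * Real.exp (β * (s + 2))) := by ring
    _ = _ := by rw [← Real.exp_add]; ring_nf

/-- A smooth radial function with Navier conditions solves the problem with forcing term equal to
its residual. -/
theorem isSmoothStationarySolution_emdenLift {N : ℕ} (hN : 5 ≤ N) {μ σ p : ℝ} (hp : 1 < p)
    {w : ℝ → ℝ} (hw : ContDiff ℝ ∞ w) (hw0 : w 0 = 0)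
    (hwn : deriv (deriv w) 0 + 2 * deriv w 0 = 0) :
    LocallyIntegrableOn (fun x => hardyRellich N μ (emdenLift N w) x
      - ‖x‖ ^ σ * |emdenLift N w x| ^ p) (extClosed N) ∧
    IsSmoothStationarySolution N μ σ p (fun x => hardyRellich N μ (emdenLift N w) x
      - ‖x‖ ^ σ * |emdenLift N w x| ^ p) (emdenLift N w) := by
  set W : ℝ → ℝ := fun s => Real.exp (-(((N : ℝ) - 4) / 2) * s) * w s with hW
  have hWs : ContDiff ℝ ∞ W := contDiff_exp_mul_mul hw _
  have hW0 : W 0 = 0 := by simp [hW, hw0]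
  have hWL : logLap N W 0 = 0 := by
    rw [hW, logLap_emden hw]
    simp only [hw0, mul_zero, sub_zero, hwn]
  have hu : emdenLift N w = radialLift N W := rfl
  have hL := continuousOn_hardyRellich_radialLift (N := N) (μ := μ) hWs
  rw [← hu] at hL
  have huc : ContinuousOn (emdenLift N w) (extClosed N) := continuousOn_emdenLift hw.continuous
  have hnl : ContinuousOn (fun x => ‖x‖ ^ σ * |emdenLift N w x| ^ p) (extClosed N) := by
    refine ContinuousOn.mul (ContinuousOn.rpow_const (by fun_prop) fun x hx => Or.inl ?_)
      (huc.abs.rpow_const fun x hx => Or.inr (by linarith))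
    exact norm_ne_zero_iff.2 (ne_zero_of_mem_extClosed hx)
  have hf : ContinuousOn (fun x => hardyRellich N μ (emdenLift N w) x
      - ‖x‖ ^ σ * |emdenLift N w x| ^ p) (extClosed N) := hL.sub hnl
  refine ⟨hf.locallyIntegrableOn (measurableSet_extClosed N),
    contDiffOn_radialLift hWs, fun x _ => by ring, fun x hx => ?_, fun x hx => ?_, ?_, ?_⟩
  · have : ‖x‖ = 1 := hx
    simp [hu, radialLift, this, hW0]
  · have h1 : ‖x‖ = 1 := hx
    rw [extLaplacian_emdenLift hw (show x ∈ extClosed N from h1.ge), h1, Real.log_one, hw0, hwn]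
    simp
  · intro C hC hCD
    have hc : ContinuousOn (fun z : ℝ × EuclideanSpace ℝ (Fin N) => emdenLift N w z.2) C :=
      huc.comp continuousOn_snd fun z hz => (hCD hz).2
    obtain ⟨M, hM⟩ := hC.exists_bound_of_continuousOn hc
    have : IsFiniteMeasure ((volume : Measure (ℝ × EuclideanSpace ℝ (Fin N))).restrict C) :=
      ⟨by rw [Measure.restrict_apply_univ]; exact hC.measure_lt_top⟩
    exact MemLp.of_bound (hc.aestronglyMeasurable hC.isClosed.measurableSet) M
      (ae_restrict_of_forall_mem hC.isClosed.measurableSet hM)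
  · intro φ hφ
    obtain ⟨h1, h2⟩ := radialLift_weak_identity (μ := μ) hN hWs hW0 hWL hφ
    obtain ⟨C, hC, hCD, hφC⟩ := hφ.regular.compact_supp
    have hcomp : ∀ {b : EuclideanSpace ℝ (Fin N) → ℝ}, ContinuousOn b (extClosed N) →
        IntegrableOn (fun z : ℝ × EuclideanSpace ℝ (Fin N) => b z.2 * φ z) (spaceTime N) :=
      fun {b} hb => integrableOn_spaceTime_of_continuousOn
        ((hb.comp continuousOn_snd fun z (hz : z ∈ spaceTime N) => hz.2).mul
          hφ.regular.continuousOn) hC hCD fun z hz hzC => mul_eq_zero_of_right _ (hφC z hz hzC)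
    rw [← hu] at h1 h2
    rw [h1, h2, neg_zero, zero_add, ← integral_add (hcomp hnl) (hcomp hf)]
    congr 1
    ext z
    ring

theorem exists_stationary_solution {N : ℕ} (hN : 5 ≤ N) {σ μ p : ℝ} (hσ : -4 < σ) (hμ0 : 0 < μ)
    (hμ1 : μ ≤ muStar N) (hp : pCrit N σ μ < p) :
    ∃ f : EuclideanSpace ℝ (Fin N) → ℝ, LocallyIntegrableOn f (extClosed N) ∧
      (∀ x ∈ extDomain N, 0 < f x) ∧
      ∃ u : EuclideanSpace ℝ (Fin N) → ℝ, IsSmoothStationarySolution N μ σ p f u := by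
  have hN' : (5 : ℝ) ≤ N := by exact_mod_cast hN
  obtain ⟨ν, τ, hν, hνN, hντ, hτ, hθ, hsum, hprod, hmu, -⟩ := exists_exponents hN hμ0 hμ1
  have hM : 0 < muN N μ := by rw [hmu]; linarith
  rw [pCrit] at hp
  have hq : 0 < (σ + 4) / muN N μ := div_pos (by linarith) hM
  have hp1 : 1 < p := by linarith
  have hp0 : 0 < p - 1 := by linarith
  set β := (p - 1) * muN N μ - (σ + 4) with hβdef
  have hβ : 0 < β := by
    have : (σ + 4) / muN N μ < p - 1 := by linarith
    rw [div_lt_iff₀ hM] at this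
    linarith
  obtain ⟨w, hw, hw0, hwn, hPw, K, hK, hwK⟩ :=
    exists_supersolution_profile hN hν hνN hντ hτ hθ hsum hprod
  -- The exponent `p + 2` collects `(s+2)^p` from `|w|^p` and `(s+2)²` from dividing by the lower
  -- bound for the residual. `β > 0` is the exponential gain from `p > p_crit`.
  obtain ⟨M, hM0, hMb⟩ := exists_exp_rpow_bound (β := β) (r := p + 2) hβ
  set A := K ^ p * M + 1 with hA
  have hA0 : 0 < A := by positivity
  -- Chosen so that `ε^{p-1} = 1/A`, hence `ε^p K^p M < ε`: the superlinear term is strictly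
  -- dominated.
  set ε := (A⁻¹) ^ (1 / (p - 1)) with hε
  have hε0 : 0 < ε := by positivity
  have hεp : ε ^ (p - 1) = A⁻¹ := by
    rw [hε, ← Real.rpow_mul (by positivity), one_div_mul_cancel hp0.ne', Real.rpow_one]
  have hws : ContDiff ℝ ∞ (fun s => ε * w s) := by fun_prop
  obtain ⟨h1, h2⟩ := isSmoothStationarySolution_emdenLift (μ := μ) (σ := σ) hN hp1 hws
    (by simp [hw0]) (by
      simp only [deriv_const_mul_field']
      linear_combination ε * hwn)
  refine ⟨_, h1, fun x hx => ?_, _, h2⟩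
  have hxc := extDomain_subset_extClosed N hx
  have hx0 := ne_zero_of_mem_extClosed hxc
  rw [sub_pos, hardyRellich_emdenLift hws hxc, emdenFowler_const_mul, ← exp_mul_log_norm hx0]
  simp only [emdenLift, radialLift]
  set s := Real.log ‖x‖ with hs
  have hs0 : 0 ≤ s := log_norm_nonneg hxc
  set κ := -(((N : ℝ) - 4) / 2) with hκ
  have hs2 : 0 < s + 2 := by linarith
  have hExp : Real.exp (σ * s) * (Real.exp (κ * s) * (ε * (K * (Real.exp (-ν * s) * (s + 2))))) ^ p
      = ε ^ p * K ^ p * (Real.exp (-β * s) * (s + 2) ^ (p + 2))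
        * (Real.exp ((κ - 4) * s) * (Real.exp (-ν * s) * (1 / (s + 2) ^ 2))) := by
    rw [Real.mul_rpow (by positivity) (by positivity),
      Real.mul_rpow hε0.le (by positivity), Real.mul_rpow hK (by positivity),
      Real.mul_rpow (by positivity) hs2.le, ← Real.exp_mul, ← Real.exp_mul, Real.rpow_add hs2]
    have e : Real.exp (σ * s) * Real.exp (κ * s * p) * Real.exp (-ν * s * p)
        = Real.exp (-β * s) * Real.exp ((κ - 4) * s) * Real.exp (-ν * s) := by
      rw [← Real.exp_add, ← Real.exp_add, ← Real.exp_add, ← Real.exp_add]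
      congr 1
      rw [hβdef, hmu, hκ]
      ring
    have e2 : (s + 2) ^ (2 : ℝ) * (1 / (s + 2) ^ 2) = 1 := by
      rw [Real.rpow_two]
      field_simp
    calc _ = ε ^ p * K ^ p * (s + 2) ^ p
          * (Real.exp (σ * s) * Real.exp (κ * s * p) * Real.exp (-ν * s * p)) := by ring
      _ = ε ^ p * K ^ p * (s + 2) ^ p * (Real.exp (-β * s) * Real.exp ((κ - 4) * s)
          * Real.exp (-ν * s)) * ((s + 2) ^ (2 : ℝ) * (1 / (s + 2) ^ 2)) := by rw [e, e2, mul_one]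
      _ = _ := by ring
  have hG : 0 < Real.exp ((κ - 4) * s) * (Real.exp (-ν * s) * (1 / (s + 2) ^ 2)) := by positivity
  have hεε : ε ^ p = ε * A⁻¹ := by
    rw [← hεp, ← Real.rpow_one_add' hε0.le (by linarith)]
    ring_nf
  calc Real.exp (σ * s) * |Real.exp (κ * s) * (ε * w s)| ^ p
      ≤ Real.exp (σ * s)
        * (Real.exp (κ * s) * (ε * (K * (Real.exp (-ν * s) * (s + 2))))) ^ p := by
        rw [abs_mul, abs_mul, abs_of_pos (Real.exp_pos _), abs_of_pos hε0]
        have := hwK s hs0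
        gcongr
    _ = ε ^ p * K ^ p * (Real.exp (-β * s) * (s + 2) ^ (p + 2))
        * (Real.exp ((κ - 4) * s) * (Real.exp (-ν * s) * (1 / (s + 2) ^ 2))) := hExp
    _ ≤ ε ^ p * K ^ p * M
        * (Real.exp ((κ - 4) * s) * (Real.exp (-ν * s) * (1 / (s + 2) ^ 2))) := by
        gcongr
        exact hMb s hs0
    _ < ε * (Real.exp ((κ - 4) * s) * (Real.exp (-ν * s) * (1 / (s + 2) ^ 2))) := by
        refine mul_lt_mul_of_pos_right ?_ hG
        have : K ^ p * M * A⁻¹ < 1 := by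
          rw [← div_eq_mul_inv, div_lt_one hA0, hA]; linarith
        calc ε ^ p * K ^ p * M = ε * (K ^ p * M * A⁻¹) := by rw [hεε]; ring
          _ < ε * 1 := by gcongr
          _ = ε := mul_one _
    _ ≤ ε * (Real.exp ((κ - 4) * s) * emdenFowler N μ w s) := by
        gcongr
        exact hPw s hs0
    _ = _ := by ring

end

theorem theorem1p2 (N : ℕ) (hN : 5 ≤ N) (σ μ p : ℝ) (hσ : -4 < σ) :
    (((0 < μ ∧ μ ≤ muStar N ∧ 1 < p ∧ p < pCrit N σ μ) ∨
        (0 < μ ∧ μ < muStar N ∧ p = pCrit N σ μ)) →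
      ∀ f : EuclideanSpace ℝ (Fin N) → ℝ, LocallyIntegrableOn f (extClosed N) →
        (∀ᵐ x ∂(volume.restrict (extDomain N)), 0 < f x) →
        ¬ ∃ u : ℝ × EuclideanSpace ℝ (Fin N) → ℝ, IsWeakSolution N μ σ p f u) ∧
    ((0 < μ ∧ μ ≤ muStar N ∧ pCrit N σ μ < p) →
      ∃ f : EuclideanSpace ℝ (Fin N) → ℝ, LocallyIntegrableOn f (extClosed N) ∧
        (∀ x ∈ extDomain N, 0 < f x) ∧
        ∃ u : EuclideanSpace ℝ (Fin N) → ℝ, IsSmoothStationarySolution N μ σ p f u) := by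
  refine ⟨fun hcase f hf hfpos => ?_, fun h => ?_⟩
  · rintro ⟨u, hu⟩
    exact no_weakSolution hN hσ hcase hf hfpos u hu
  · exact exists_stationary_solution hN hσ h.1 h.2.1 h.2.2
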